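/- **Setting.** Words are elements of $\Sigma^*$, $\Sigma=\{0,1\}$. For $m\in\mathbb Z$ let $\mathbb D_m=\{a/2^m : a\in\mathbb Z\}$ and $\mathbb D=\bigcup_m\mathbb D_m$. A dyadic rational is coded by its reduced form $a/2^k$ ($k\in\mathbb N$ minimal), with $a$ in binary and $k$ in unary; an integer precision $n\in\mathbb Z$ is coded in unary and written $0^n$ (via a fixed bijection $\mathbb Z\cong\mathbb N$); pairs of words are coded by a fixed linear-time pairing $\langle\cdot,\cdot\rangle$. For $\phi:\Sigma^*\to\Sigma^*$ write $\phi(q,0^n)$ for the value at the word coding $(q,n)$. Let $B(x,\delta)$ and $\overline B(x,\delta)$ be the open and closed balls of $(\mathbb R,|\cdot|)$, and $d_S(q)=\min_{x\in S}|q-x|$. Let $\mathcal K$ be the class of non-empty compact $S\subseteq\mathbb R$, $\mathcal R$ the class of non-empty closed $S\subseteq\mathbb R$ with $\overline{S^\circ}=S$ (regular sets), and $\mathcal{CR}$ the class of convex sets in $\mathcal R$ (convex bodies, possibly unbounded). A function $\phi:\Sigma^*\to\Sigma^*$ is, where the conditions are required for all $q\in\mathbb D$ and all $n\in\mathbb Z$,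 * a $\delta_{\mathrm{dist}}$-name of $S$ if $\phi(q,0^n)\in\mathbb D_{n+1}$ and $|\phi(q,0^n)-d_S(q)|\le 2^{-n}$; * a $\delta_{\mathrm{reldist}}$-name of $S$ if $\phi(q,0^n)\in\mathbb D_{n+1}$ and $\tfrac34 d_S(q)-2^{-n}\le\phi(q,0^n)\le\tfrac54 d_S(q)+2^{-n}$; * a $\delta_{\mathrm{setrep}}$-name of $S$ if $\phi$ takes values in $\{0,1\}$, $\phi(q,0^n)=1$ whenever $B(q,2^{-n})\cap S\ne\emptyset$, and $\phi(q,0^n)=0$ whenever $\overline B(q,2^{-n+1})\cap S=\emptyset$; * a $\delta_{\mathrm{wmem}}$-name of $S$ if $\phi$ takes values in $\{0,1\}$, $\phi(q,0^n)=1$ whenever $\overline B(q,2^{-n})\subseteq S$, and $\phi(q,0^n)=0$ whenever $\overline B(q,2^{-n})\cap S=\emptyset$; * a $\delta_{\mathrm{grid}}$-name of $S$ if $\phi(\varepsilon)$ is the unary code (read through its length) of some $b\in\mathbb Z$ with $S\subseteq\overline B(0,2^b)$, $\phi$ takes values in $\{0,1\}$ on all other words, and there are sets $B_n\subseteq\mathbb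 D_n$ with $\phi(q,0^n)=\chi_{B_n}(q)$ such that every $x\in S$ has some $q\in B_n$ with $|q-x|\le2^{-n}$ and every $q\in B_n$ has some $x\in S$ with $|q-x|\le2^{-n}$. A name of $S$ in an enriched representation $\delta\langle E\rangle$ is a pair $\langle\phi,e\rangle$ of a $\delta$-name $\phi$ of $S$ and an advice word $e\in E(S)$. Here $\langle\phi,\psi\rangle(\varepsilon)=\varepsilon$, $\langle\phi,\psi\rangle(0s)=0^{|\psi(s)|}1\phi(s)$, $\langle\phi,\psi\rangle(1s)=0^{|\phi(s)|}1\psi(s)$, and $e$ stands for the constant function with value $e$. The enrichment $b(S)$ consists of the unary codes of all $b\in\mathbb Z$ with $S\subseteq\overline B(0,2^b)$. The enrichment $ar(S)$ ("inner ball") consists of the codes $\langle a,0^r\rangle$ of all $a\in\mathbb D$, $r\in\mathbb Z$ with $B(a,2^{-r})\subseteq S$. The advice word of a name in $\delta\langle E\rangle$ is $e$, that of a $\delta_{\mathrm{grid}}$-name $\phi$ is $\phi(\varepsilon)$, and that of a name in an unenriched representation ($\delta_{\mathrm{setrep}}$, $\delta_{\mathrm{wmem}}$) is $\varepsilon$.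 For a class $Y$ of sets, $\delta\preceq_{\mathrm p}^{Y}\delta'$ means: there are a deterministic function-oracle Turing machine $M$ (each oracle call costs one step) and polynomials $\tau,t$ over $\mathbb N$ such that for every $S\in Y$ and every $\delta$-name $\phi$ of $S$ with advice word $e$ there is a $\delta'$-name $\psi$ of $S$ such that for all $s\in\Sigma^*$, $M$ with oracle $\phi$ and input $s$ outputs $\psi(s)$ within $\tau(|e|)\cdot t(|s|)$ steps. Write $\delta\equiv_{\mathrm p}^Y\delta'$ if both $\delta\preceq_{\mathrm p}^Y\delta'$ and $\delta'\preceq_{\mathrm p}^Y\delta$. **Proposition.** For subsets of $(\mathbb R,|\cdot|)$: 1. $\delta_{\mathrm{dist}}\langle b\rangle\equiv_{\mathrm p}^{\mathcal K}\delta_{\mathrm{reldist}}\langle b\rangle\equiv_{\mathrm p}^{\mathcal K}\delta_{\mathrm{setrep}}\langle b\rangle\equiv_{\mathrm p}^{\mathcal K}\delta_{\mathrm{grid}}$; 2. $\delta_{\mathrm{setrep}}\preceq_{\mathrm p}^{\mathcal R}\delta_{\mathrm{wmem}}$; 3. $\delta_{\mathrm{wmem}}\langle ar\rangle\preceq_{\mathrm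 p}^{\mathcal{CR}}\delta_{\mathrm{setrep}}$. -/

import Mathlib

namespace SetReps

/-! ## Words and encodings -/

/-- Finite words over the binary alphabet `{0, 1}` (`false` is `0`, `true` is `1`). -/
abbrev Word : Type := List Bool

/-- The word `0^k`. -/
def zeros (k : ℕ) : Word := List.replicate k false

/-- Self-delimiting pairing `⟨s, t⟩ = 0 s₁ 0 s₂ … 0 sₖ 1 t` of words. -/
def pairWords (s t : Word) : Word := s.flatMap (fun b => [false, b]) ++ true :: t

/-- Unary coding of an integer, through the bijection `0, -1, 1, -2, 2, … ↦ 0, 1, 2, 3, 4, …`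
of `ℤ` with `ℕ`. -/
def unaryInt (n : ℤ) : Word := zeros (Equiv.intEquivNat n)

/-- The integer that a word denotes when it is read in unary, that is, through its length. -/
def ofUnaryInt (s : Word) : ℤ := Equiv.intEquivNat.symm s.length

/-- Binary coding of an integer (least significant bit first), through the same bijection. -/
def binaryInt (a : ℤ) : Word := (Equiv.intEquivNat a).bits

/-- The dyadic rationals `𝔻ₘ = {a / 2^m | a ∈ ℤ}` of precision `m ∈ ℤ`. -/
def dyadicsOfPrec (m : ℤ) : Set ℚ := {q | ∃ a : ℤ, q = (a : ℚ) / (2 : ℚ) ^ m}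

/-- The set `𝔻` of all dyadic rationals. -/
def dyadics : Set ℚ := ⋃ m : ℤ, dyadicsOfPrec m

/-- The code of a dyadic rational `a / 2^k` in lowest terms: numerator in binary, `k` in unary. -/
def dyadicCode (q : ℚ) : Word := pairWords (binaryInt q.num) (zeros (Nat.log 2 q.den))

/-- The query word `⟨q, 0ⁿ⟩` for a dyadic point `q` and an integer precision `n`. -/
def query (q : ℚ) (n : ℤ) : Word := pairWords (dyadicCode q) (unaryInt n)

/-- Pairing of string functions: `⟨φ, ψ⟩(ε) = ε`, `⟨φ, ψ⟩(0 s) = 0^{|ψ(s)|} 1 φ(s)` and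
`⟨φ, ψ⟩(1 s) = 0^{|φ(s)|} 1 ψ(s)`. -/
def pairFuns (φ ψ : Word → Word) : Word → Word
  | [] => []
  | false :: s => zeros (ψ s).length ++ true :: φ s
  | true :: s => zeros (φ s).length ++ true :: ψ s

/-! ## Function-oracle Turing machines -/

/-- The four distinguished stacks of an oracle machine. -/
inductive Port : Type
  | input | output | query | answer
  deriving DecidableEq

/-- The stack alphabets: the four ports hold bits, the work stack `k` holds symbols of `Γ k`. -/
abbrev StackAlphabet {K : Type} (Γ : K → Type) : Port ⊕ K → Type
  | Sum.inl _ => Bool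
  | Sum.inr k => Γ k

/-- A deterministic function-oracle Turing machine, in Mathlib's multi-stack model `Turing.TM2`
of multi-tape machines: besides the input, output, query and answer ports it has finitely many
work stacks over finite alphabets, finitely many labels (control states) and a finite internal
memory. Control at the label `ask` triggers an oracle call, after which control is at `resume`. -/
structure OracleTM : Type 1 where
  K : Type
  [decEqK : DecidableEq K]
  [finK : Finite K]
  Γ : K → Type
  [finΓ : ∀ k, Finite (Γ k)]
  Λ : Type
  [decEqΛ : DecidableEq Λ]
  [finΛ : Finite Λ]
  σ : Type
  [finσ : Finite σ]
  start : Λ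
  ask : Λ
  resume : Λ
  memory₀ : σ
  prog : Λ → Turing.TM2.Stmt (StackAlphabet Γ) Λ σ

attribute [instance] OracleTM.decEqK OracleTM.finK OracleTM.finΓ OracleTM.decEqΛ OracleTM.finΛ
  OracleTM.finσ

namespace OracleTM

/-- Configurations: current label (`none` when halted), internal memory, contents of the stacks. -/
abbrev Cfg (M : OracleTM) : Type := Turing.TM2.Cfg (StackAlphabet M.Γ) M.Λ M.σ

/-- The initial configuration: the input word on the input stack, its first letter on top. -/
def init (M : OracleTM) (s : Word) : M.Cfg where
  l := some M.start
  var := M.memory₀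
  stk := fun
    | Sum.inl Port.input => s
    | Sum.inl _ => []
    | Sum.inr _ => []

/-- The oracle call: in one step the query word `u` is consumed, the content of the answer stack
is replaced by `φ u` (first letter on top), and control passes to `resume`. -/
def oracleCall (M : OracleTM) (φ : Word → Word) (c : M.Cfg) : M.Cfg where
  l := some M.resume
  var := c.var
  stk := fun
    | Sum.inl Port.input => c.stk (Sum.inl Port.input)
    | Sum.inl Port.output => c.stk (Sum.inl Port.output)
    | Sum.inl Port.query => []
    | Sum.inl Port.answer => φ (c.stk (Sum.inl Port.query))
    | Sum.inr k => c.stk (Sum.inr k)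

/-- One step of the machine with oracle `φ`; a halted machine has no next step. -/
def step (M : OracleTM) (φ : Word → Word) (c : M.Cfg) : Option M.Cfg :=
  if c.l = some M.ask then some (M.oracleCall φ c) else Turing.TM2.step M.prog c

/-- With oracle `φ` and input `s` the machine halts after at most `T` steps, and then the word on
the output stack is `w`. -/
def OutputsWithin (M : OracleTM) (φ : Word → Word) (s w : Word) (T : ℕ) : Prop :=
  ∃ c : M.Cfg, c.l = none ∧ c.stk (Sum.inl Port.output) = w ∧
    Nonempty (StateTransition.EvalsToInTime (M.step φ) (M.init s) (some c) T)

end OracleTM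

/-! ## Classes of subsets of the real line -/

/-- Non-empty compact sets. -/
def compactSets : Set (Set ℝ) := {S | S.Nonempty ∧ IsCompact S}

/-- Non-empty closed sets that are the closure of their interior. -/
def regularSets : Set (Set ℝ) := {S | S.Nonempty ∧ IsClosed S ∧ closure (interior S) = S}

/-- Convex bodies: convex regular sets (not necessarily bounded). -/
def convexBodies : Set (Set ℝ) := {S | S ∈ regularSets ∧ Convex ℝ S}

/-! ## Representations of sets -/

/-- A representation of subsets of the line, as the relation `φ` is a name of `S`. -/
abbrev SetRep : Type := (Word → Word) → Set ℝ → Prop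

/-- A representation whose names carry an advice parameter: the relation
`φ` is a name of `S` with advice parameter `e`. -/
abbrev AdvisedRep : Type := (Word → Word) → Set ℝ → Word → Prop

/-- The string function takes the values `0` and `1` only. -/
def IsPredicate (φ : Word → Word) : Prop := ∀ s, φ s = [false] ∨ φ s = [true]

/-- Distance representation. -/
def distRep : SetRep := fun φ S =>
  ∀ q ∈ dyadics, ∀ n : ℤ, ∃ v ∈ dyadicsOfPrec (n + 1), φ (query q n) = dyadicCode v ∧
    |(v : ℝ) - Metric.infDist (q : ℝ) S| ≤ (2 : ℝ) ^ (-n)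

/-- Relative distance representation. -/
def relDistRep : SetRep := fun φ S =>
  ∀ q ∈ dyadics, ∀ n : ℤ, ∃ v ∈ dyadicsOfPrec (n + 1), φ (query q n) = dyadicCode v ∧
    3 / 4 * Metric.infDist (q : ℝ) S - (2 : ℝ) ^ (-n) ≤ (v : ℝ) ∧
    (v : ℝ) ≤ 5 / 4 * Metric.infDist (q : ℝ) S + (2 : ℝ) ^ (-n)

/-- Local-information representation: answer `1` if the open ball of radius `2⁻ⁿ` about `q` meets
`S`, answer `0` if the closed ball of radius `2⁻ⁿ⁺¹` does not. -/
def setRep : SetRep := fun φ S =>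
  IsPredicate φ ∧ ∀ q ∈ dyadics, ∀ n : ℤ,
    ((Metric.ball (q : ℝ) ((2 : ℝ) ^ (-n)) ∩ S).Nonempty → φ (query q n) = [true]) ∧
    (Metric.closedBall (q : ℝ) ((2 : ℝ) ^ (-n + 1)) ∩ S = ∅ → φ (query q n) = [false])

/-- Weak-membership representation. -/
def wmemRep : SetRep := fun φ S =>
  IsPredicate φ ∧ ∀ q ∈ dyadics, ∀ n : ℤ,
    (Metric.closedBall (q : ℝ) ((2 : ℝ) ^ (-n)) ⊆ S → φ (query q n) = [true]) ∧
    (Metric.closedBall (q : ℝ) ((2 : ℝ) ^ (-n)) ∩ S = ∅ → φ (query q n) = [false])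

/-- Grid representation: `φ(ε)` is a unary outer radius parameter, and `φ(·, 0ⁿ)` is the
characteristic function of a set `Bₙ ⊆ 𝔻ₙ` at Hausdorff distance at most `2⁻ⁿ` from `S`. The
advice parameter of a name is the outer radius parameter `φ(ε)` that it carries. -/
def gridRep : AdvisedRep := fun φ S e =>
  e = φ [] ∧ (∀ s, s ≠ [] → φ s = [false] ∨ φ s = [true]) ∧
  S ⊆ Metric.closedBall 0 ((2 : ℝ) ^ ofUnaryInt (φ [])) ∧
  ∃ B : ℤ → Set ℚ, ∀ n : ℤ,
    B n ⊆ dyadicsOfPrec n ∧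
    (∀ q ∈ dyadics, (q ∈ B n → φ (query q n) = [true]) ∧ (q ∉ B n → φ (query q n) = [false])) ∧
    (∀ x ∈ S, ∃ q ∈ B n, |(q : ℝ) - x| ≤ (2 : ℝ) ^ (-n)) ∧
    (∀ q ∈ B n, ∃ x ∈ S, |(q : ℝ) - x| ≤ (2 : ℝ) ^ (-n))

/-- A representation without advice: the advice parameter is the empty word. -/
def plain (ρ : SetRep) : AdvisedRep := fun φ S e => e = [] ∧ ρ φ S

/-- Enrichment: a name of `S` is a pair `⟨φ₁, φ₂⟩` of a `ρ`-name `φ₁` of `S` and a name `φ₂`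
(the constant function `e`) of some advice parameter `e ∈ E S`. -/
def enrich (ρ : SetRep) (E : Set ℝ → Set Word) : AdvisedRep := fun φ S e =>
  e ∈ E S ∧ ∃ φ₁, ρ φ₁ S ∧ φ = pairFuns φ₁ (fun _ => e)

/-- Outer radius parameters, in unary. -/
def outerRadius : Set ℝ → Set Word := fun S =>
  {e | ∃ b : ℤ, S ⊆ Metric.closedBall 0 ((2 : ℝ) ^ b) ∧ e = unaryInt b}

/-- Inner balls: a dyadic center in binary and a radius parameter in unary. -/
def innerBall : Set ℝ → Set Word := fun S =>
  {e | ∃ a ∈ dyadics, ∃ r : ℤ, Metric.ball (a : ℝ) ((2 : ℝ) ^ (-r)) ⊆ S ∧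
    e = pairWords (dyadicCode a) (unaryInt r)}

/-! ## Polynomial-time reducibility -/

/-- Polynomial-time reduction of `ρ` to `ρ'` over the class `Y`: one oracle machine translates
every `ρ`-name `φ` of every `S ∈ Y` into a `ρ'`-name `ψ` of `S`, computing `ψ s` in time at most
`τ(|e|) · t(|s|)`, where `τ`, `t` are polynomials and `e` is the advice parameter of `φ`. -/
def PolyReduces (Y : Set (Set ℝ)) (ρ ρ' : AdvisedRep) : Prop :=
  ∃ (M : OracleTM) (τ t : Polynomial ℕ), ∀ S ∈ Y, ∀ φ e, ρ φ S e →
    ∃ ψ e', ρ' ψ S e' ∧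
      ∀ s, M.OutputsWithin φ s (ψ s) (τ.eval e.length * t.eval s.length)

/-- Polynomial-time equivalence over the class `Y`. -/
def PolyEquiv (Y : Set (Set ℝ)) (ρ ρ' : AdvisedRep) : Prop :=
  PolyReduces Y ρ ρ' ∧ PolyReduces Y ρ' ρ

end SetReps

/-! The mathematical core is the notion of a `LocalTest`: a decision that is positive when the open
ball of radius `2^(-n)` about `x` meets `S` and negative when the closed ball of twice that radius
misses `S`. A set-representation name is such a test. A relative distance name becomes one by
comparing its value with `11/8 * 2^(-n)` (`localTest_of_relDistRep`), a grid name by searching six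
neighbouring grid points (`localTest_of_gridRep`), and a weak membership name of a convex body by
moving the query point towards the inner ball (`localTest_of_wmemRep`).

Conversely, a test yields the other kinds of names. For distances, an integer `L` with `L * 2^(-m) ≤
d ≤ (L + 2) * 2^(-m)` is refined bit by bit (`distStep_spec`). A sphere on the line has two points,
so each refinement needs boundedly many tests; the outer radius fixes a scale at which the search
can start with `L = 0`. For grids, two tests per grid point suffice (`gridRep_gridFn`). A distance
name is itself a relative distance name, which closes the circle of equivalences. A
set-representation name gives weak membership by raising the precision by one.

The complexity half is a small calculus. Structured programs over stacks, with an exact running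
time, are compiled to oracle machines (`Prog.exists_machine`). The class `FP` of functionals
computable in time polynomial in advice size plus input size, uniformly in the oracle, is closed
under composition, pairing, branching, oracle calls with short answers, and iteration along a word
with controlled growth. Integer and dyadic arithmetic is built from these operations. Since reading
an answer takes time, answer lengths must be bounded: trivially for predicates, and through the
outer radius for distances (`RelName.length_le`). -/

namespace SetReps

/-! ## A structured language for oracle machines -/

/-- Structured programs over bit stacks indexed by `ℕ`. Stacks `0`, `1`, `2`, `3` are the query,
answer, input and output ports. -/
inductive Prog : Type
  | skip
  | push (r : ℕ) (b : Bool)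
  | seq (p q : Prog)
  | case (r : ℕ) (pn p₀ p₁ : Prog)
  | loop (r : ℕ) (p₀ p₁ : Prog)
  | ask

namespace Prog

/-- A strict upper bound for the stacks that a program mentions. -/
def bound : Prog → ℕ
  | skip => 0
  | push r _ => r + 1
  | seq p q => max p.bound q.bound
  | case r pn p₀ p₁ => max (r + 1) (max pn.bound (max p₀.bound p₁.bound))
  | loop r p₀ p₁ => max (r + 1) (max p₀.bound p₁.bound)
  | ask => 0

/-- The continuations met while a program is run in front of the continuation `k`. -/
def conts : Prog → List Prog → Set (List Prog)
  | skip, k => {skip :: k}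
  | push r b, k => {push r b :: k}
  | seq p q, k => {seq p q :: k} ∪ (conts p (q :: k) ∪ conts q k)
  | case r pn p₀ p₁, k => {case r pn p₀ p₁ :: k} ∪ (conts pn k ∪ (conts p₀ k ∪ conts p₁ k))
  | loop r p₀ p₁, k => {loop r p₀ p₁ :: k} ∪
      (conts p₀ (loop r p₀ p₁ :: k) ∪ conts p₁ (loop r p₀ p₁ :: k))
  | ask, k => {ask :: k}

theorem cons_mem_conts (p : Prog) (k : List Prog) : p :: k ∈ conts p k := by
  cases p <;> simp [conts]

/-- These continuations become the control states of the machine. A loop body returns to the loop's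
own continuation, so running a loop creates no new ones. -/
theorem finite_conts (p : Prog) (k : List Prog) : (conts p k).Finite := by
  induction p generalizing k <;> simp_all [conts]

end Prog

/-- Contents of the stacks. -/
abbrev Store : Type := ℕ → Word

/-- Big-step semantics with running time of structured programs with oracle `φ`. -/
inductive Exec (φ : Word → Word) : Prog → Store → Store → ℕ → Prop
  | skip (st) : Exec φ .skip st st 1
  | push (st r b) : Exec φ (.push r b) st (Function.update st r (b :: st r)) 1
  | seq {p q st st₁ st₂ t₁ t₂} : Exec φ p st st₁ t₁ → Exec φ q st₁ st₂ t₂ →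
      Exec φ (.seq p q) st st₂ (t₁ + t₂ + 1)
  | case_nil {r pn p₀ p₁ st st' t} : st r = [] → Exec φ pn st st' t →
      Exec φ (.case r pn p₀ p₁) st st' (t + 1)
  | case_cons {r pn p₀ p₁ st st' t b l} : st r = b :: l →
      Exec φ (bif b then p₁ else p₀) (Function.update st r l) st' t →
      Exec φ (.case r pn p₀ p₁) st st' (t + 1)
  | loop_nil {r p₀ p₁ st} : st r = [] → Exec φ (.loop r p₀ p₁) st st 1
  | loop_cons {r p₀ p₁ st st₁ st₂ t₁ t₂ b l} : st r = b :: l →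
      Exec φ (bif b then p₁ else p₀) (Function.update st r l) st₁ t₁ →
      Exec φ (.loop r p₀ p₁) st₁ st₂ t₂ →
      Exec φ (.loop r p₀ p₁) st st₂ (t₁ + t₂ + 1)
  | ask (st) : Exec φ .ask st (Function.update (Function.update st 1 (φ (st 0))) 0 []) 3

/-! ### Compilation to oracle machines -/

namespace Compile

/-- The machine stack that holds stack `r`. -/
def slot (R : ℕ) : ℕ → Port ⊕ Fin (R + 1)
  | 0 => .inl .query
  | 1 => .inl .answer
  | 2 => .inl .input
  | 3 => .inl .output
  | r + 4 => .inr (Fin.ofNat (R + 1) r)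

/-- A bit as a stack symbol. -/
def toSym {K : Type} : ∀ s : Port ⊕ K, Bool → StackAlphabet (fun _ : K => Bool) s
  | .inl _, b => b
  | .inr _, b => b

/-- A stack symbol as a bit. -/
def ofSym {K : Type} : ∀ s : Port ⊕ K, StackAlphabet (fun _ : K => Bool) s → Bool
  | .inl _, b => b
  | .inr _, b => b

/-- The machine stacks that represent a store. -/
def stackContents (R : ℕ) (st : Store) : ∀ s, List (StackAlphabet (fun _ : Fin (R + 1) => Bool) s)
  | .inl .query => st 0
  | .inl .answer => st 1
  | .inl .input => st 2
  | .inl .output => st 3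
  | .inr k => st (k + 4)

/-- `Fin.ofNat` reduces modulo `R + 1`; the bound `r ≤ R` excludes wrap-around, so different stacks
keep different slots. -/
theorem stackContents_slot {R r : ℕ} (h : r ≤ R) (st : Store) :
    (stackContents R st (slot R r)).map (ofSym _) = st r := by
  match r with
  | 0 | 1 | 2 | 3 => exact List.map_id _
  | r + 4 =>
    have : r % (R + 1) = r := Nat.mod_eq_of_lt (by omega)
    simp only [slot, stackContents, Fin.ofNat, this]
    exact List.map_id _

theorem stackContents_update {R r : ℕ} (h : r ≤ R) (st : Store) (w : Word) :
    stackContents R (Function.update st r w) =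
      Function.update (stackContents R st) (slot R r) (w.map (toSym _)) := by
  funext s
  match r with
  | 0 | 1 | 2 | 3 =>
    rcases s with (_ | _ | _ | _) | k <;> simp [slot, stackContents, Function.update]
    all_goals exact (List.map_id _).symm
  | r + 4 =>
    have hr : r % (R + 1) = r := Nat.mod_eq_of_lt (by omega)
    rcases s with (_ | _ | _ | _) | k
    · simp [slot, stackContents]
    · simp [slot, stackContents]
    · simp [slot, stackContents]
    · simp [slot, stackContents]
    · by_cases hk : (k : ℕ) = r
      · obtain rfl : k = Fin.ofNat (R + 1) r := by ext; simp [Fin.ofNat, hr, hk]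
        simp only [slot, stackContents, Function.update_self]
        have : ((Fin.ofNat (R + 1) r : Fin (R + 1)) : ℕ) + 4 = r + 4 := by omega
        rw [this, Function.update_self]
        exact (List.map_id _).symm
      · have : (Sum.inr k : Port ⊕ Fin (R + 1)) ≠ slot R (r + 4) := by
          intro h; simp only [slot, Sum.inr.injEq] at h; apply hk; rw [h]; simp [Fin.ofNat, hr]
        rw [Function.update_of_ne this]
        simp only [stackContents]
        rw [Function.update_of_ne (by omega)]

theorem ofSym_toSym {K : Type} (s : Port ⊕ K) (b : Bool) : ofSym s (toSym s b) = b := by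
  cases s <;> rfl

theorem toSym_ofSym {K : Type} (s : Port ⊕ K) (x) : toSym s (ofSym s x) = x := by
  cases s <;> rfl

theorem map_toSym_eq {R r : ℕ} (h : r ≤ R) (st : Store) :
    stackContents R st (slot R r) = (st r).map (toSym _) := by
  rw [← stackContents_slot h st, List.map_map]
  conv_lhs => rw [← List.map_id (stackContents R st (slot R r))]
  exact List.map_congr_left fun x _ => (toSym_ofSym _ x).symm

theorem slot_eq_nil {R r : ℕ} (h : r ≤ R) {st : Store} (hr : st r = []) :
    stackContents R st (slot R r) = [] := by
  rw [map_toSym_eq h, hr, List.map_nil]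

theorem slot_eq_cons {R r : ℕ} (h : r ≤ R) {st : Store} {b : Bool} {l : Word}
    (hr : st r = b :: l) :
    stackContents R st (slot R r) = toSym _ b :: l.map (toSym _) := by
  rw [map_toSym_eq h, hr, List.map_cons]

theorem update_nil {R : ℕ} {f : ∀ s, List (StackAlphabet (fun _ : Fin (R + 1) => Bool) s)}
    {s : Port ⊕ Fin (R + 1)} (h : f s = []) : Function.update f s [] = f := by
  rw [← h, Function.update_eq_self]

/-- Control states: a continuation, or one of the two labels around an oracle call. -/
inductive Label (S : Set (List Prog)) : Type
  | cont (k : S)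
  | ask
  | resume

instance (S : Set (List Prog)) [Finite S] : Finite (Label S) :=
  Finite.of_injective
    (fun l : Label S => match l with
      | .cont k => (some (some k) : Option (Option S)) | .ask => some none | .resume => none)
    (by rintro (_ | _ | _) (_ | _ | _) <;> simp)

open Classical in
/-- The label of a continuation. -/
noncomputable def lab (S : Set (List Prog)) (k : List Prog) : Label S :=
  if h : k ∈ S then .cont ⟨k, h⟩ else .ask

/-- The internal memory: the last symbol that was read, and where to go after an oracle call. -/
abbrev Memory (S : Set (List Prog)) : Type := Option Bool × Label S

open Turing.TM2.Stmt in
/-- The statement executed at a continuation. -/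
noncomputable def stmt (R : ℕ) (S : Set (List Prog)) : List Prog →
    Turing.TM2.Stmt (StackAlphabet (fun _ : Fin (R + 1) => Bool)) (Label S) (Memory S)
  | [] => halt
  | .skip :: k => goto fun _ => lab S k
  | .push r b :: k => push (slot R r) (fun _ => toSym _ b) (goto fun _ => lab S k)
  | .seq p q :: k => goto fun _ => lab S (p :: q :: k)
  | .case r pn p₀ p₁ :: k => pop (slot R r) (fun v o => (o.map (ofSym _), v.2))
      (goto fun v => match v.1 with
        | none => lab S (pn :: k)
        | some b => lab S ((bif b then p₁ else p₀) :: k))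
  | .loop r p₀ p₁ :: k => pop (slot R r) (fun v o => (o.map (ofSym _), v.2))
      (goto fun v => match v.1 with
        | none => lab S k
        | some b => lab S ((bif b then p₁ else p₀) :: .loop r p₀ p₁ :: k))
  | .ask :: k => load (fun v => (v.1, lab S k)) (goto fun _ => .ask)

open Classical in
/-- The machine that runs the continuation `k`. -/
noncomputable def machine (R : ℕ) (S : Set (List Prog)) [Finite S] (k : List Prog) : OracleTM where
  K := Fin (R + 1)
  Γ := fun _ => Bool
  Λ := Label S
  σ := Memory S
  start := lab S k
  ask := .ask
  resume := .resume
  memory₀ := (none, .ask)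
  prog := fun l => match l with
    | .cont c => stmt R S c
    | .ask => .halt
    | .resume => .goto fun v => v.2

variable {R : ℕ} {S : Set (List Prog)} [Finite S] {k₀ : List Prog} {φ : Word → Word}

/-- The configuration with continuation `k`. -/
noncomputable def cfg (R : ℕ) (S : Set (List Prog)) [Finite S] (k₀ k : List Prog) (v : Memory S) (st : Store) :
    (machine R S k₀).Cfg :=
  ⟨some (lab S k), v, stackContents R st⟩

/-- `c'` is reached from `c` after exactly `n` steps. -/
def StepsTo (M : OracleTM) (φ : Word → Word) (n : ℕ) (c c' : M.Cfg) : Prop :=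
  (flip bind (M.step φ))^[n] (some c) = some c'

theorem StepsTo.trans {M : OracleTM} {m n : ℕ} {a b c : M.Cfg} (h₁ : StepsTo M φ m a b)
    (h₂ : StepsTo M φ n b c) : StepsTo M φ (m + n) a c := by
  unfold StepsTo at *
  rw [add_comm, Function.iterate_add_apply, h₁, h₂]

theorem StepsTo.single {M : OracleTM} {a b : M.Cfg} (h : M.step φ a = some b) :
    StepsTo M φ 1 a b := h

theorem _root_.SetReps.OracleTM.step_ask (M : OracleTM) (φ : Word → Word) (c : M.Cfg)
    (h : c.l = some M.ask) : M.step φ c = some (M.oracleCall φ c) :=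
  if_pos h

theorem step_cfg {k : List Prog} (hk : k ∈ S) (v : Memory S) (st : Store) :
    (machine R S k₀).step φ (cfg R S k₀ k v st) =
      some (Turing.TM2.stepAux (stmt R S k) v (stackContents R st)) := by
  have : lab S k = .cont ⟨k, hk⟩ := by simp [lab, hk]
  simp only [OracleTM.step, cfg, this]
  rw [if_neg]
  · rfl
  · intro h
    cases Option.some.inj h

/-- Induction on the derivation: each rule of the big-step semantics is charged exactly the machine
steps it takes. The inclusion in `S` keeps `lab` from falling back to its default value. The memory
is arbitrary before and existential after, because a continuation never reads what an earlier one
left there. -/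
theorem stepsTo_of_exec {p : Prog} {st st' : Store} {t : ℕ} (h : Exec φ p st st' t) :
    ∀ k : List Prog, p.bound ≤ R → p.conts k ⊆ S → k ∈ S → ∀ v,
      ∃ v', StepsTo (machine R S k₀) φ t (cfg R S k₀ (p :: k) v st) (cfg R S k₀ k v' st') := by
  induction h with
  | skip st =>
    intro k _ hS _ v
    exact ⟨v, .single (step_cfg (hS (Prog.cons_mem_conts _ _)) _ _)⟩
  | push st r b =>
    intro k hR hS _ v
    refine ⟨v, .single ((step_cfg (hS (Prog.cons_mem_conts _ _)) _ _).trans ?_)⟩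
    simp only [stmt, Turing.TM2.stepAux, cfg]
    rw [stackContents_update (by simp only [Prog.bound] at hR; omega), List.map_cons,
      ← map_toSym_eq (by simp only [Prog.bound] at hR; omega) st]
    rfl
  | @seq p q st st₁ st₂ _ _ _ _ ih₁ ih₂ =>
    intro k hR hS hk v
    simp only [Prog.bound, max_le_iff] at hR
    have h0 := hS (Prog.cons_mem_conts _ _)
    simp only [Prog.conts, Set.union_subset_iff] at hS
    have hq := hS.2.2 (Prog.cons_mem_conts _ _)
    obtain ⟨v₁, h₁⟩ := ih₁ (q :: k) hR.1 hS.2.1 hq v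
    obtain ⟨v₂, h₂⟩ := ih₂ k hR.2 hS.2.2 hk v₁
    have h3 : StepsTo (machine R S k₀) φ 1 (cfg R S k₀ (p.seq q :: k) v st) _ :=
      .single (step_cfg h0 v st)
    refine ⟨v₂, ?_⟩
    have := h3.trans (h₁.trans h₂)
    rwa [add_comm] at this
  | @case_nil r pn p₀ p₁ st st' t hr _ ih =>
    intro k hR hS hk v
    simp only [Prog.bound, max_le_iff] at hR
    have h0 := hS (Prog.cons_mem_conts _ _)
    simp only [Prog.conts, Set.union_subset_iff] at hS
    obtain ⟨v₁, h₁⟩ := ih k hR.2.1 hS.2.1 hk (none, v.2)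
    refine ⟨v₁, ?_⟩
    rw [add_comm]
    refine (StepsTo.single ((step_cfg h0 v st).trans ?_)).trans h₁
    have hr' := slot_eq_nil (by omega : r ≤ R) hr
    simp only [stmt, cfg, Turing.TM2.stepAux, hr']
    exact congrArg some (congrArg (Turing.TM2.Cfg.mk _ _) (update_nil hr'))
  | @case_cons r pn p₀ p₁ st st' t b l hr _ ih =>
    intro k hR hS hk v
    simp only [Prog.bound, max_le_iff] at hR
    have h0 := hS (Prog.cons_mem_conts _ _)
    simp only [Prog.conts, Set.union_subset_iff] at hS
    obtain ⟨v₁, h₁⟩ := ih k (by cases b <;> simp [hR]) (by cases b <;> simp [hS]) hk (some b, v.2)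
    refine ⟨v₁, ?_⟩
    rw [add_comm]
    refine (StepsTo.single ((step_cfg h0 v st).trans ?_)).trans h₁
    have hr' := slot_eq_cons (by omega : r ≤ R) hr
    simp [stmt, cfg, hr', stackContents_update (by omega : r ≤ R), ofSym_toSym]
    rfl
  | @loop_nil r p₀ p₁ st hr =>
    intro k hR hS hk v
    simp only [Prog.bound, max_le_iff] at hR
    have h0 := hS (Prog.cons_mem_conts _ _)
    refine ⟨(none, v.2), .single ((step_cfg h0 v st).trans ?_)⟩
    have hr' := slot_eq_nil (by omega : r ≤ R) hr
    simp only [stmt, cfg, Turing.TM2.stepAux, hr']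
    exact congrArg some (congrArg (Turing.TM2.Cfg.mk _ _) (update_nil hr'))
  | @loop_cons r p₀ p₁ st st₁ st₂ t₁ t₂ b l hr _ _ ih₁ ih₂ =>
    intro k hR hS hk v
    have hR' := hR
    have hS' := hS
    simp only [Prog.bound, max_le_iff] at hR
    have h0 := hS (Prog.cons_mem_conts _ _)
    simp only [Prog.conts, Set.union_subset_iff] at hS
    obtain ⟨v₁, h₁⟩ := ih₁ (.loop r p₀ p₁ :: k) (by cases b <;> simp [hR])
      (by cases b <;> simp [hS]) h0 (some b, v.2)
    obtain ⟨v₂, h₂⟩ := ih₂ k hR' hS' hk v₁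
    refine ⟨v₂, ?_⟩
    rw [add_comm]
    refine (StepsTo.single ((step_cfg h0 v st).trans ?_)).trans (h₁.trans h₂)
    have hr' := slot_eq_cons (by omega : r ≤ R) hr
    simp [stmt, cfg, hr', stackContents_update (by omega : r ≤ R), ofSym_toSym]
    rfl
  | ask st =>
    intro k hR hS hk v
    have h0 := hS (Prog.cons_mem_conts _ _)
    -- An oracle call takes three steps: store the return label and go to `ask`, call, then go from
    -- `resume` to the stored label. The memory is needed because the machine has a single `resume`
    -- label.
    refine ⟨(v.1, lab S k), ?_⟩
    have h1 := StepsTo.single (step_cfg (k₀ := k₀) (R := R) (φ := φ) h0 v st)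
    refine h1.trans (m := 1) (n := 2) (StepsTo.trans (m := 1) (n := 1)
      (.single (OracleTM.step_ask _ _ _ rfl)) (.single ?_))
    simp only [OracleTM.step]
    rw [if_neg (by intro h; cases Option.some.inj h)]
    refine congrArg some ?_
    simp only [cfg, stmt, Turing.TM2.stepAux, machine]
    refine congrArg (Turing.TM2.Cfg.mk _ _) ?_
    funext s
    rcases s with (_ | _ | _ | _) | j <;> simp [stackContents, Function.update]

end Compile

open Compile in
/-- Every structured program is run by an oracle machine, with the same running time up to one
final step. -/
theorem Prog.exists_machine (p : Prog) : ∃ M : OracleTM, ∀ (φ : Word → Word) (s : Word)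
    (st' : Store) (t : ℕ), Exec φ p (Function.update (fun _ => []) 2 s) st' t →
      M.OutputsWithin φ s (st' 3) (t + 1) := by
  let S : Set (List Prog) := insert [] (p.conts [])
  have : Finite S := ((p.finite_conts []).insert []).to_subtype
  refine ⟨machine p.bound S [p], fun φ s st' t h => ?_⟩
  obtain ⟨v', hv⟩ := stepsTo_of_exec (S := S) (k₀ := [p]) h [] le_rfl (Set.subset_insert _ _)
    (Set.mem_insert _ _) (none, .ask)
  -- The extra step executes the empty continuation, which halts.
  have h1 := hv.trans (.single (step_cfg (Set.mem_insert _ _) v' st'))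
  have h2 : cfg p.bound S [p] [p] (none, .ask) (Function.update (fun _ => []) 2 s) =
      (machine p.bound S [p]).init s := by
    refine congrArg (Turing.TM2.Cfg.mk _ _) ?_
    funext r
    rcases r with (_ | _ | _ | _) | k <;> simp [stackContents, Function.update]
    rfl
  rw [h2] at h1
  exact ⟨_, rfl, rfl, ⟨⟨⟨t + 1, h1⟩, le_rfl⟩⟩⟩

/-! ## Polynomial-time functionals -/

/-- Coefficients in `ℕ` make every polynomial monotone, so bounds can be substituted into bounds. -/
theorem eval_mono_nat (P : Polynomial ℕ) {m n : ℕ} (h : m ≤ n) : P.eval m ≤ P.eval n := by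
  rw [Polynomial.eval_eq_sum, Polynomial.eval_eq_sum]
  exact Finset.sum_le_sum fun i _ => Nat.mul_le_mul_left _ (Nat.pow_le_pow_left h i)

namespace Prog

/-- Pour stack `r` on top of stack `d`. -/
def pour (r d : ℕ) : Prog := .loop r (.push d false) (.push d true)

/-- Move the content of stack `r` on top of stack `d`, through the empty stack `u`. -/
def move (r d u : ℕ) : Prog := .seq (pour r u) (pour u d)

/-- Copy the content of stack `r` on top of stack `d`, through the empty stack `u`. -/
def copy (r d u : ℕ) : Prog :=
  .seq (pour r u) (.loop u (.seq (.push r false) (.push d false)) (.seq (.push r true) (.push d true)))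

/-- Empty stack `r`. -/
def clear (r : ℕ) : Prog := .loop r .skip .skip

/-- Push a word on stack `r`. -/
def pushAll (r : ℕ) : Word → Prog
  | [] => .skip
  | b :: w => .seq (pushAll r w) (.push r b)

/-- Replace the contents of stacks `a` and `b` by their pair on stack `a`, through the empty
stack `c`. -/
def pair (a b c : ℕ) : Prog :=
  .seq (.push b true) <| .seq (pour a c) <|
    .seq (.loop c (.seq (.push b false) (.push b false)) (.seq (.push b true) (.push b false))) <|
      move b a c

/-- Distribute the components of the pair on stack `a` over the stacks `a` and `b`, through the
empty stacks `c` and `d`. -/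
def unpair (a b c d : ℕ) : Prog :=
  .seq (.loop a (.case a .skip (.push c false) (.push c true)) (move a b d)) <| pour c a

end Prog

/-- The inverse of `pairWords`, extended to all words. -/
def unpairWords : Word → Word × Word
  | [] => ([], [])
  | true :: l => ([], l)
  | [false] => ([], [])
  | false :: b :: l => (b :: (unpairWords l).1, (unpairWords l).2)

@[simp]
theorem unpairWords_pairWords (s t : Word) : unpairWords (pairWords s t) = (s, t) := by
  induction s with
  | nil => rfl
  | cons b s ih =>
    have : pairWords (b :: s) t = false :: b :: pairWords s t := rfl
    rw [this, unpairWords, ih]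

theorem length_pairWords (s t : Word) : (pairWords s t).length = 2 * s.length + t.length + 1 := by
  induction s with
  | nil => simp [pairWords]
  | cons b s ih =>
    have : pairWords (b :: s) t = false :: b :: pairWords s t := rfl
    rw [this, List.length_cons, List.length_cons, ih, List.length_cons]; omega

theorem length_unpairWords (s : Word) :
    (unpairWords s).1.length + (unpairWords s).2.length ≤ s.length := by
  induction s using unpairWords.induct <;> simp_all [unpairWords]; omega

/-! ### Effect and running time of the stack macros -/

section Exec

variable {φ : Word → Word} {st : Store}

theorem Exec.cast {p : Prog} {st₁ st₂ : Store} {t : ℕ} (h : Exec φ p st st₁ t) (e : st₁ = st₂) :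
    Exec φ p st st₂ t :=
  e ▸ h

/-- The invariant rule for loops: `g u v` is the store when the part `u` of `w` has been consumed
and `v` is left. Each letter costs at most `T` for the body and one step for the loop. -/
theorem Exec.loop_of {r : ℕ} {p₀ p₁ : Prog} {T : ℕ} (g : Word → Word → Store) (w : Word)
    (hr : ∀ u v, u ++ v = w → g u v r = v)
    (hstep : ∀ u b v, u ++ b :: v = w → ∃ t ≤ T,
      Exec φ (bif b then p₁ else p₀) (Function.update (g u (b :: v)) r v) (g (u ++ [b]) v) t) :
    ∃ t ≤ (T + 1) * w.length + 1, Exec φ (.loop r p₀ p₁) (g [] w) (g w []) t := by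
  suffices ∀ v u, u ++ v = w →
      ∃ t ≤ (T + 1) * v.length + 1, Exec φ (.loop r p₀ p₁) (g u v) (g w []) t from this w [] rfl
  intro v
  induction v with
  | nil =>
    intro u hu
    obtain rfl : u = w := by simpa using hu
    exact ⟨1, by simp, .loop_nil (hr _ _ hu)⟩
  | cons b v ih =>
    intro u hu
    obtain ⟨t₁, ht₁, h₁⟩ := hstep u b v hu
    obtain ⟨t₂, ht₂, h₂⟩ := ih (u ++ [b]) (by simpa using hu)
    refine ⟨_, ?_, .loop_cons (hr _ _ hu) h₁ h₂⟩
    rw [List.length_cons, mul_add]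
    omega

theorem Exec.pour {r d : ℕ} (hrd : r ≠ d) :
    ∃ t ≤ 2 * (st r).length + 1, Exec φ (.pour r d) st
      (Function.update (Function.update st d ((st r).reverse ++ st d)) r []) t := by
  have := Exec.loop_of (φ := φ) (r := r) (p₀ := .push d false) (p₁ := .push d true) (T := 1)
    (fun u v => Function.update (Function.update st d (u.reverse ++ st d)) r v) (st r)
    (by simp) (fun u b v _ => ⟨1, le_rfl, by
      have := Exec.push (φ := φ) (Function.update (Function.update st d (u.reverse ++ st d)) r v) d b
      convert this using 1
      · cases b <;> rfl
      · simp
      · funext s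
        simp only [Function.update_apply]
        split_ifs <;> simp_all⟩)
  simpa [Prog.pour] using this

theorem Exec.move {r d u : ℕ} (hrd : r ≠ d) (hru : r ≠ u) (hdu : d ≠ u) (hu : st u = []) :
    ∃ t ≤ 4 * (st r).length + 3, Exec φ (.move r d u) st
      (Function.update (Function.update st d (st r ++ st d)) r []) t := by
  obtain ⟨t₁, ht₁, h₁⟩ := Exec.pour (φ := φ) (st := st) hru
  obtain ⟨t₂, ht₂, h₂⟩ := Exec.pour (φ := φ)
    (st := Function.update (Function.update st u ((st r).reverse ++ st u)) r []) hdu.symm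
  refine ⟨_, ?_, (h₁.seq h₂).cast ?_⟩
  · simp [hru.symm, hu] at ht₂
    omega
  · funext s
    simp only [Function.update_apply]
    split_ifs <;> simp_all

theorem Exec.copy {r d u : ℕ} (hrd : r ≠ d) (hru : r ≠ u) (hdu : d ≠ u) (hu : st u = []) :
    ∃ t ≤ 6 * (st r).length + 3, Exec φ (.copy r d u) st
      (Function.update st d (st r ++ st d)) t := by
  obtain ⟨t₁, ht₁, h₁⟩ := Exec.pour (φ := φ) (st := st) hru
  obtain ⟨t₂, ht₂, h₂⟩ := Exec.loop_of (φ := φ) (r := u)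
    (p₀ := .seq (.push r false) (.push d false)) (p₁ := .seq (.push r true) (.push d true)) (T := 3)
    (fun w v => Function.update (Function.update (Function.update st r w.reverse) d
      (w.reverse ++ st d)) u v) (st r).reverse (by simp) (fun w b v _ => ⟨3, le_rfl, by
      have h1 := Exec.push (φ := φ) (Function.update (Function.update (Function.update st r
        w.reverse) d (w.reverse ++ st d)) u v) r b
      have h2 := h1.seq (Exec.push _ d b)
      convert h2 using 1
      · cases b <;> rfl
      · simp
      · funext s
        simp only [Function.update_apply]
        split_ifs <;> simp_all⟩)
  have h3 : Function.update (Function.update st u ((st r).reverse ++ st u)) r [] =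
      Function.update (Function.update (Function.update st r ([] : Word).reverse) d
        (([] : Word).reverse ++ st d)) u (st r).reverse := by
    funext s
    simp only [Function.update_apply]
    split_ifs <;> simp_all
  refine ⟨_, ?_, ((h₁.cast h3).seq h₂).cast ?_⟩
  · rw [List.length_reverse] at ht₂
    omega
  · funext s
    simp only [Function.update_apply]
    split_ifs <;> simp_all

theorem Exec.clear (r : ℕ) : ∃ t ≤ 2 * (st r).length + 1, Exec φ (.clear r) st
    (Function.update st r []) t := by
  have := Exec.loop_of (φ := φ) (r := r) (p₀ := .skip) (p₁ := .skip) (T := 1)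
    (fun _ v => Function.update st r v) (st r) (by simp) (fun u b v _ => ⟨1, le_rfl, by
      have := Exec.skip (φ := φ) (Function.update st r v)
      convert this using 1
      · cases b <;> rfl
      · simp⟩)
  simpa [Prog.clear] using this

theorem Exec.pushAll (r : ℕ) (w : Word) : Exec φ (.pushAll r w) st
    (Function.update st r (w ++ st r)) (2 * w.length + 1) := by
  induction w with
  | nil =>
    exact (Exec.skip (φ := φ) st).cast (by simp)
  | cons b w ih => exact (ih.seq (Exec.push _ r b)).cast (by simp)

theorem Exec.pair {a b c : ℕ} (hab : a ≠ b) (hac : a ≠ c) (hbc : b ≠ c) (h : st c = []) :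
    ∃ t ≤ 14 * (st a).length + 4 * (st b).length + 20, Exec φ (.pair a b c) st
      (Function.update (Function.update st b []) a (pairWords (st a) (st b))) t := by
  have h₁ := Exec.push (φ := φ) st b true
  obtain ⟨t₂, ht₂, h₂⟩ := Exec.pour (φ := φ) (st := Function.update st b (true :: st b)) hac
  obtain ⟨t₃, ht₃, h₃⟩ := Exec.loop_of (φ := φ) (r := c)
    (p₀ := .seq (.push b false) (.push b false)) (p₁ := .seq (.push b true) (.push b false)) (T := 3)
    (fun w v => Function.update (Function.update (Function.update st a []) b
      (pairWords w.reverse (st b))) c v) (st a).reverse (by simp)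
      (fun w x v _ => ⟨3, le_rfl, by
      have h1 := Exec.push (φ := φ) (Function.update (Function.update (Function.update st a [])
        b (pairWords w.reverse (st b))) c v) b x
      have h2 := h1.seq (Exec.push _ b false)
      convert h2 using 1
      · cases x <;> rfl
      · simp
      · funext s
        simp only [Function.update_apply]
        split_ifs <;> simp_all [pairWords]⟩)
  obtain ⟨t₄, ht₄, h₄⟩ := Exec.move (φ := φ)
    (st := Function.update (Function.update (Function.update st a []) b
      (pairWords (st a).reverse.reverse (st b))) c []) hab.symm hbc hac (by simp)
  have e₂ : Function.update (Function.update (Function.update st b (true :: st b))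
      c ((Function.update st b (true :: st b) a).reverse ++
      Function.update st b (true :: st b) c)) a [] =
      Function.update (Function.update (Function.update st a []) b
      (pairWords ([] : Word).reverse (st b))) c (st a).reverse := by
    funext s
    simp only [Function.update_apply]
    split_ifs <;> simp_all [pairWords]
  refine ⟨_, ?_, (h₁.seq ((h₂.cast e₂).seq (h₃.seq h₄))).cast ?_⟩
  · simp [hab, hbc] at ht₂ ht₃ ht₄
    rw [length_pairWords] at ht₄
    omega
  · funext s
    simp only [Function.update_apply]
    split_ifs <;> simp_all

/-- A marker `0` is consumed by the loop and the letter after it by the inner `case`, which puts it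
on `c`, hence in reverse order. At the separator `1` the remainder moves to `b`; this empties `a`
and thereby ends the loop. -/
theorem Exec.unpair_loop {a b c d : ℕ} (hab : a ≠ b) (hac : a ≠ c) (had : a ≠ d) (hbc : b ≠ c)
    (hbd : b ≠ d) (hcd : c ≠ d) (w : Word) :
    ∀ st : Store, st a = w → st b = [] → st d = [] → ∃ t ≤ 4 * w.length + 6,
      Exec φ (.loop a (.case a .skip (.push c false) (.push c true)) (.move a b d)) st
        (Function.update (Function.update (Function.update st a []) b (unpairWords w).2) c
          ((unpairWords w).1.reverse ++ st c)) t := by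
  induction w using unpairWords.induct with
  | case1 =>
    intro st h hb hd
    refine ⟨1, by simp, (Exec.loop_nil h).cast ?_⟩
    funext s
    simp only [Function.update_apply]
    split_ifs <;> simp_all [unpairWords]
  | case2 l =>
    intro st h hb hd
    obtain ⟨t₁, ht₁, h₁⟩ := Exec.move (φ := φ) (st := Function.update st a l) hab had hbd
      (by simp [had.symm, hd])
    refine ⟨_, ?_, (Exec.loop_cons (b := true) h h₁ (Exec.loop_nil (by simp))).cast ?_⟩
    · simp at ht₁
      rw [List.length_cons]
      omega
    · funext s
      simp only [Function.update_apply]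
      split_ifs <;> simp_all [unpairWords]
  | case3 =>
    intro st h hb hd
    refine ⟨_, ?_, (Exec.loop_cons (b := false) h (Exec.case_nil (by simp) (Exec.skip _))
      (Exec.loop_nil (by simp))).cast ?_⟩
    · simp
    · funext s
      simp only [Function.update_apply]
      split_ifs <;> simp_all [unpairWords]
  | case4 x l ih =>
    intro st h hb hd
    have h₁ := Exec.push (φ := φ) (Function.update (Function.update st a (x :: l)) a l) c x
    have e : (bif x then .push c true else .push c false) = Prog.push c x := by cases x <;> rfl
    rw [← e] at h₁
    obtain ⟨t₃, ht₃, h₃⟩ := ih (Function.update (Function.update (Function.update st a (x :: l)) a l)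
      c (x :: (Function.update (Function.update st a (x :: l)) a l) c))
      (by simp [Function.update_apply, hac])
      (by simp [Function.update_apply, hab.symm, hbc, hb])
      (by simp [Function.update_apply, had.symm, hcd.symm, hd])
    refine ⟨_, ?_, (Exec.loop_cons (b := false) h (Exec.case_cons (by simp) h₁) h₃).cast ?_⟩
    · simp only [List.length_cons]
      omega
    · funext s
      simp only [Function.update_apply]
      split_ifs <;> simp_all [unpairWords]

theorem Exec.unpair {a b c d : ℕ} (hab : a ≠ b) (hac : a ≠ c) (had : a ≠ d) (hbc : b ≠ c)
    (hbd : b ≠ d) (hcd : c ≠ d) (hb : st b = []) (hc : st c = []) (hd : st d = []) :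
    ∃ t ≤ 6 * (st a).length + 9, Exec φ (.unpair a b c d) st
      (Function.update (Function.update st b (unpairWords (st a)).2) a
        (unpairWords (st a)).1) t := by
  obtain ⟨t₁, ht₁, h₁⟩ := Exec.unpair_loop (φ := φ) hab hac had hbc hbd hcd (st a) st rfl hb hd
  obtain ⟨t₂, ht₂, h₂⟩ := Exec.pour (φ := φ) (st := Function.update (Function.update
    (Function.update st a []) b (unpairWords (st a)).2) c ((unpairWords (st a)).1.reverse ++ st c))
    hac.symm
  refine ⟨_, ?_, (h₁.seq h₂).cast ?_⟩
  · have := length_unpairWords (st a)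
    simp [hc] at ht₂
    omega
  · funext s
    simp only [Function.update_apply]
    split_ifs <;> simp_all

end Exec

/-! ### Polynomial-time functionals on coded data and their closure properties -/

/-- Data types whose elements are coded by words. -/
class Code (α : Type) where
  enc : α → Word

open Code (enc)

instance : Code Word := ⟨id⟩
instance : Code Bool := ⟨fun b => [b]⟩
instance {α β : Type} [Code α] [Code β] : Code (α × β) := ⟨
  fun x => pairWords (enc x.1) (enc x.2)⟩

/-- A family of oracles with a size parameter. -/
structure Family where
  Idx : Type
  oracle : Idx → Word → Word
  size : Idx → ℕ

/-- The stacks above `a` and the oracle ports are empty. -/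
def Clean (a : ℕ) (st : Store) : Prop := ∀ r, r < 2 ∨ a < r → st r = []

variable {F : Family} {α β γ δ : Type} [Code α] [Code β] [Code γ] [Code δ]

/-- The functional `f` is computable in polynomial time: for every stack `a`, a program replaces
the code of `x` on stack `a` by the code of `f i x`, using the stacks above `a` and the oracle
`F.oracle i`, within time polynomial in `F.size i` and the size of `x`. -/
def FP (F : Family) (f : F.Idx → α → β) : Prop :=
  ∀ a, 2 ≤ a → ∃ (p : Prog) (P : Polynomial ℕ), ∀ i x (st : Store), st a = enc x →
    Clean a st → ∃ t, t + (enc (f i x)).length ≤ P.eval (F.size i + (enc x).length) ∧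
      Exec (F.oracle i) p st (Function.update st a (enc (f i x))) t

namespace FP

/-- Programs see codes only, so functionals with equal codes are interchangeable even when their
value types differ, as for `b` and `[b]`. -/
theorem of_enc_eq {f : F.Idx → α → β} {g : F.Idx → α → γ} (hf : FP F f)
    (h : ∀ i x, enc (f i x) = enc (g i x)) : FP F g := by
  intro a ha
  obtain ⟨p, P, hp⟩ := hf a ha
  refine ⟨p, P, fun i x st hx hc => ?_⟩
  rw [← h]
  exact hp i x st hx hc

/-- Computability with a size bound of the simplest kind: linear time and output. -/
theorem of_linear {f : F.Idx → α → β} (c : ℕ) (h : ∀ a, 2 ≤ a → ∃ p : Prog, ∀ i x (st : Store),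
    st a = enc x → Clean a st → ∃ t, t + (enc (f i x)).length ≤ c * (enc x).length + c ∧
      Exec (F.oracle i) p st (Function.update st a (enc (f i x))) t) : FP F f := by
  intro a ha
  obtain ⟨p, hp⟩ := h a ha
  refine ⟨p, Polynomial.C c * Polynomial.X + Polynomial.C c, fun i x st hx hc => ?_⟩
  obtain ⟨t, ht, he⟩ := hp i x st hx hc
  refine ⟨t, ht.trans ?_, he⟩
  simp only [Polynomial.eval_add, Polynomial.eval_mul, Polynomial.eval_C, Polynomial.eval_X]
  nlinarith

protected theorem id : FP F (fun _ (x : α) => x) :=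
  of_linear 1 fun a _ => ⟨.skip, fun i x st hx _ => ⟨1, by omega,
    (Exec.skip st).cast (by rw [← hx, Function.update_eq_self])⟩⟩

protected theorem const (y : β) : FP F (fun _ (_ : α) => y) :=
  of_linear (3 * (enc y).length + 3) fun a _ => ⟨.seq (.clear a) (.pushAll a (enc y)),
    fun i x st hx _ => by
      obtain ⟨t, ht, h⟩ := Exec.clear (φ := F.oracle i) (st := st) a
      refine ⟨_, ?_, (h.seq (Exec.pushAll a (enc y))).cast (by simp)⟩
      rw [hx] at ht
      nlinarith⟩

/-- The bound in `FP` covers the output length along with the time, so `g` receives an input whose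
size is controlled by `P`. -/
theorem comp' {g : F.Idx → β → γ} {f : F.Idx → α → β} (hg : FP F g) (hf : FP F f) :
    FP F (fun i x => g i (f i x)) := by
  intro a ha
  obtain ⟨p, P, hp⟩ := hf a ha
  obtain ⟨q, Q, hq⟩ := hg a ha
  refine ⟨.seq p q, P + Q.comp (Polynomial.X + P) + 1, fun i x st hx hc => ?_⟩
  obtain ⟨t₁, ht₁, h₁⟩ := hp i x st hx hc
  obtain ⟨t₂, ht₂, h₂⟩ := hq i (f i x) (Function.update st a (enc (f i x))) (by simp)
    (fun r hr => by rw [Function.update_of_ne (by omega)]; exact hc r hr)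
  refine ⟨_, ?_, (h₁.seq h₂).cast (by simp)⟩
  have := eval_mono_nat Q (show F.size i + (enc (f i x)).length ≤
    F.size i + (enc x).length + P.eval (F.size i + (enc x).length) by omega)
  simp only [Polynomial.eval_add, Polynomial.eval_comp, Polynomial.eval_X, Polynomial.eval_one]
  omega

/-- This is where computability at every base stack matters: `g` works on a copy at `a + 1`, then
`f` on the original moved to `a + 2`, leaving the finished result below it untouched. -/
theorem pair {f : F.Idx → α → β} {g : F.Idx → α → γ} (hf : FP F f) (hg : FP F g) :
    FP F (fun i x => (f i x, g i x)) := by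
  intro a ha
  obtain ⟨p, P, hp⟩ := hf (a + 2) (by omega)
  obtain ⟨q, Q, hq⟩ := hg (a + 1) (by omega)
  refine ⟨.seq (.copy a (a + 1) (a + 2)) <| .seq q <| .seq (.move a (a + 2) (a + 3)) <| .seq p <|
    .seq (.move (a + 2) a (a + 3)) <| .pair a (a + 1) (a + 2),
    10 * Polynomial.X + 20 * P + 6 * Q + 50, fun i x st hx hc => ?_⟩
  have hc1 := hc (a + 1) (by omega)
  have hc2 := hc (a + 2) (by omega)
  have hc3 := hc (a + 3) (by omega)
  have n1 : a ≠ a + 1 := by omega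
  have n2 : a ≠ a + 2 := by omega
  have n3 : a ≠ a + 3 := by omega
  have n4 : a + 1 ≠ a + 2 := by omega
  have n5 : a + 2 ≠ a + 3 := by omega
  have n6 : a + 1 ≠ a + 3 := by omega
  obtain ⟨t₁, ht₁, h₁⟩ := Exec.copy (φ := F.oracle i) (st := st) n1 n2 n4 hc2
  obtain ⟨t₂, ht₂, h₂⟩ := hq i x (Function.update st (a + 1) (st a ++ st (a + 1)))
    (by simp [hc1, hx])
    (fun r hr => by rw [Function.update_of_ne (by omega)]; exact hc r (by omega))
  obtain ⟨t₃, ht₃, h₃⟩ := Exec.move (φ := F.oracle i)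
    (st := Function.update st (a + 1) (enc (g i x))) n2 n3 n5
    (by rw [Function.update_of_ne (by omega), hc3])
  obtain ⟨t₄, ht₄, h₄⟩ := hp i x (Function.update (Function.update (Function.update st (a + 1)
    (enc (g i x))) (a + 2) (enc x)) a []) (by simp)
    (fun r hr => by
      rw [Function.update_of_ne (by omega), Function.update_of_ne (by omega),
        Function.update_of_ne (by omega)]
      exact hc r (by omega))
  obtain ⟨t₅, ht₅, h₅⟩ := Exec.move (φ := F.oracle i)
    (st := Function.update (Function.update (Function.update st (a + 1)
    (enc (g i x))) (a + 2) (enc (f i x))) a []) n2.symm n5 n3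
    (by simp [hc3])
  obtain ⟨t₆, ht₆, h₆⟩ := Exec.pair (φ := F.oracle i)
    (st := Function.update (Function.update st (a + 1) (enc (g i x))) a (enc (f i x)))
    n1 n2 n4 (by simp [hc2])
  have e₃ : Function.update (Function.update (Function.update st (a + 1) (enc (g i x))) (a + 2)
      (Function.update st (a + 1) (enc (g i x)) a ++
        Function.update st (a + 1) (enc (g i x)) (a + 2))) a [] =
      Function.update (Function.update (Function.update st (a + 1)
    (enc (g i x))) (a + 2) (enc x)) a [] := by simp [hx, hc2]
  refine ⟨_, ?_, (h₁.seq <| (h₂.cast (Function.update_idem _ _ _)).seq <| (h₃.cast e₃).seq <|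
    (h₄.cast ?_).seq <| (h₅.cast ?_).seq h₆).cast ?_⟩
  · have := eval_mono_nat P (show F.size i + (enc x).length ≤ F.size i + (enc x).length from le_rfl)
    simp [hx] at ht₁ ht₃ ht₄ ht₅ ht₆
    have e : enc (f i x, g i x) = pairWords (enc (f i x)) (enc (g i x)) := rfl
    rw [e, length_pairWords]
    simp only [Polynomial.eval_add, Polynomial.eval_mul, Polynomial.eval_X, Polynomial.eval_ofNat]
    omega
  · funext r
    simp only [Function.update_apply]
    grind
  · funext r
    simp only [Function.update_apply]
    grind
  · funext r
    simp only [Function.update_apply]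
    have e : enc (f i x, g i x) = pairWords (enc (f i x)) (enc (g i x)) := rfl
    grind

theorem fst {f : F.Idx → α → β × γ} (hf : FP F f) : FP F (fun i x => (f i x).1) := by
  refine comp' (g := fun i (y : β × γ) => y.1) (of_linear 20 fun a _ =>
    ⟨.seq (.unpair a (a + 1) (a + 2) (a + 3)) (.clear (a + 1)), fun i x st hx hc => ?_⟩) hf
  have e : enc x = pairWords (enc x.1) (enc x.2) := rfl
  obtain ⟨t₁, ht₁, h₁⟩ := Exec.unpair (φ := F.oracle i) (st := st) (a := a) (b := a + 1)
    (c := a + 2) (d := a + 3) (by omega) (by omega) (by omega) (by omega) (by omega) (by omega)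
    (hc _ (by omega)) (hc _ (by omega)) (hc _ (by omega))
  obtain ⟨t₂, ht₂, h₂⟩ := Exec.clear (φ := F.oracle i) (st := Function.update (Function.update st
    (a + 1) (unpairWords (st a)).2) a (unpairWords (st a)).1) (a + 1)
  refine ⟨_, ?_, (h₁.seq h₂).cast ?_⟩
  · rw [hx] at ht₁
    simp [hx, e] at ht₂
    rw [e, length_pairWords] at *
    omega
  · have := hc (a + 1) (by omega)
    rw [hx, e, unpairWords_pairWords]
    funext r
    simp only [Function.update_apply]
    grind

theorem snd {f : F.Idx → α → β × γ} (hf : FP F f) : FP F (fun i x => (f i x).2) := by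
  refine comp' (g := fun i (y : β × γ) => y.2) (of_linear 20 fun a _ =>
    ⟨.seq (.unpair a (a + 1) (a + 2) (a + 3)) (.seq (.clear a) (.move (a + 1) a (a + 2))),
      fun i x st hx hc => ?_⟩) hf
  have e : enc x = pairWords (enc x.1) (enc x.2) := rfl
  obtain ⟨t₁, ht₁, h₁⟩ := Exec.unpair (φ := F.oracle i) (st := st) (a := a) (b := a + 1)
    (c := a + 2) (d := a + 3) (by omega) (by omega) (by omega) (by omega) (by omega) (by omega)
    (hc _ (by omega)) (hc _ (by omega)) (hc _ (by omega))
  obtain ⟨t₂, ht₂, h₂⟩ := Exec.clear (φ := F.oracle i) (st := Function.update (Function.update st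
    (a + 1) (unpairWords (st a)).2) a (unpairWords (st a)).1) a
  obtain ⟨t₃, ht₃, h₃⟩ := Exec.move (φ := F.oracle i) (st := Function.update (Function.update st
    (a + 1) (unpairWords (st a)).2) a []) (r := a + 1) (d := a) (u := a + 2) (by omega) (by omega)
    (by omega) (by simp [hc (a + 2) (by omega)])
  refine ⟨_, ?_, (h₁.seq ((h₂.cast (Function.update_idem _ _ _)).seq h₃)).cast ?_⟩
  · rw [hx] at ht₁
    simp [hx, e] at ht₂ ht₃
    rw [e, length_pairWords] at *
    omega
  · have := hc (a + 1) (by omega)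
    rw [hx, e, unpairWords_pairWords]
    funext r
    simp only [Function.update_apply]
    grind

/-- Parsing of pairs. -/
theorem unpairWords {f : F.Idx → α → Word} (hf : FP F f) :
    FP F (fun i x => unpairWords (f i x)) := by
  refine comp' (g := fun i (y : Word) => SetReps.unpairWords y) (of_linear 60 fun a _ =>
    ⟨.seq (.unpair a (a + 1) (a + 2) (a + 3)) (.pair a (a + 1) (a + 2)),
      fun i x st hx hc => ?_⟩) hf
  obtain ⟨t₁, ht₁, h₁⟩ := Exec.unpair (φ := F.oracle i) (st := st) (a := a) (b := a + 1)
    (c := a + 2) (d := a + 3) (by omega) (by omega) (by omega) (by omega) (by omega) (by omega)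
    (hc _ (by omega)) (hc _ (by omega)) (hc _ (by omega))
  obtain ⟨t₂, ht₂, h₂⟩ := Exec.pair (φ := F.oracle i) (st := Function.update (Function.update st
    (a + 1) (SetReps.unpairWords (st a)).2) a (SetReps.unpairWords (st a)).1) (a := a) (b := a + 1)
    (c := a + 2) (by omega) (by omega) (by omega) (by simp [hc (a + 2) (by omega)])
  have e : enc (SetReps.unpairWords x) =
    pairWords (SetReps.unpairWords x).1 (SetReps.unpairWords x).2 := rfl
  have ex : enc x = x := rfl
  rw [ex] at hx
  rw [ex]
  refine ⟨_, ?_, (h₁.seq h₂).cast ?_⟩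
  · have := length_unpairWords x
    rw [hx] at ht₁
    simp [hx] at ht₂
    rw [e, length_pairWords] at *
    omega
  · have := hc (a + 1) (by omega)
    rw [hx, e]
    clear h₁ h₂ ht₁ ht₂
    funext r
    simp only [Function.update_apply]
    grind

/-- The condition is evaluated on a copy. Branching pops its one-letter code, so either branch
starts from the original store. -/
theorem cond {c : F.Idx → α → Bool} {f g : F.Idx → α → β} (hc : FP F c) (hf : FP F f)
    (hg : FP F g) : FP F (fun i x => bif c i x then f i x else g i x) := by
  intro a ha
  obtain ⟨pc, Pc, hpc⟩ := hc (a + 1) (by omega)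
  obtain ⟨pf, Pf, hpf⟩ := hf a ha
  obtain ⟨pg, Pg, hpg⟩ := hg a ha
  refine ⟨.seq (.copy a (a + 1) (a + 2)) <| .seq pc <| .case (a + 1) .skip pg pf,
    6 * Polynomial.X + Pc + Pf + Pg + 10, fun i x st hx hcl => ?_⟩
  have hc1 := hcl (a + 1) (by omega)
  obtain ⟨t₁, ht₁, h₁⟩ := Exec.copy (φ := F.oracle i) (st := st) (r := a) (d := a + 1) (u := a + 2)
    (by omega) (by omega) (by omega) (hcl _ (by omega))
  obtain ⟨t₂, ht₂, h₂⟩ := hpc i x (Function.update st (a + 1) (st a ++ st (a + 1)))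
    (by simp [hc1, hx])
    (fun r hr => by rw [Function.update_of_ne (by omega)]; exact hcl r (by omega))
  obtain ⟨t₃, ht₃, h₃⟩ : ∃ t, t + (enc (bif c i x then f i x else g i x)).length ≤
      (Pf + Pg).eval (F.size i + (enc x).length) ∧
      Exec (F.oracle i) (bif c i x then pf else pg) st
        (Function.update st a (enc (bif c i x then f i x else g i x))) t := by
    rw [Polynomial.eval_add]
    cases c i x
    · obtain ⟨t, ht, h⟩ := hpg i x st hx hcl
      exact ⟨t, by dsimp only [cond_false]; omega, h⟩
    · obtain ⟨t, ht, h⟩ := hpf i x st hx hcl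
      exact ⟨t, by dsimp only [cond_true]; omega, h⟩
  have e : Function.update (Function.update (Function.update st (a + 1) (st a ++ st (a + 1)))
      (a + 1) (enc (c i x))) (a + 1) [] = st := by
    rw [Function.update_idem, Function.update_idem, ← hc1, Function.update_eq_self]
  refine ⟨_, ?_, h₁.seq (h₂.seq (Exec.case_cons (b := c i x) (l := []) (by simp [enc])
    ((e.symm ▸ h₃ :).cast (by rw [e]))))⟩
  rw [hx] at ht₁
  simp only [Polynomial.eval_add, Polynomial.eval_mul, Polynomial.eval_X,
    Polynomial.eval_ofNat] at *
  omega

theorem revAppend {f g : F.Idx → α → Word} (hf : FP F f) (hg : FP F g) :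
    FP F (fun i x => (f i x).reverse ++ g i x) := by
  refine comp' (g := fun i (y : Word × Word) => y.1.reverse ++ y.2) (of_linear 20 fun a _ =>
    ⟨.seq (.unpair a (a + 1) (a + 2) (a + 3)) (.seq (.pour a (a + 1)) (.move (a + 1) a (a + 2))),
      fun i x st hx hc => ?_⟩) (hf.pair hg)
  have e : enc x = pairWords x.1 x.2 := rfl
  have e' : enc (x.1.reverse ++ x.2) = x.1.reverse ++ x.2 := rfl
  obtain ⟨t₁, ht₁, h₁⟩ := Exec.unpair (φ := F.oracle i) (st := st) (a := a) (b := a + 1)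
    (c := a + 2) (d := a + 3) (by omega) (by omega) (by omega) (by omega) (by omega) (by omega)
    (hc _ (by omega)) (hc _ (by omega)) (hc _ (by omega))
  obtain ⟨t₂, ht₂, h₂⟩ := Exec.pour (φ := F.oracle i) (st := Function.update (Function.update st
    (a + 1) (SetReps.unpairWords (st a)).2) a (SetReps.unpairWords (st a)).1) (r := a)
    (d := a + 1) (by omega)
  obtain ⟨t₃, ht₃, h₃⟩ := Exec.move (φ := F.oracle i) (st := Function.update (Function.update st
    (a + 1) (x.1.reverse ++ x.2)) a []) (r := a + 1) (d := a) (u := a + 2)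
    (by omega) (by omega) (by omega) (by simp [hc (a + 2) (by omega)])
  rw [hx, e, unpairWords_pairWords] at h₁ h₂ ht₂
  refine ⟨_, ?_, (h₁.seq ((h₂.cast ?_).seq h₃)).cast ?_⟩
  · rw [hx, e, length_pairWords] at ht₁
    simp at ht₂ ht₃
    rw [e, e', length_pairWords, List.length_append, List.length_reverse]
    omega
  · funext r
    simp only [Function.update_apply]
    grind
  · have := hc (a + 1) (by omega)
    rw [e']
    funext r
    simp only [Function.update_apply]
    grind

theorem tail {f : F.Idx → α → Word} (hf : FP F f) : FP F (fun i x => (f i x).tail) := by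
  refine comp' (g := fun i (y : Word) => y.tail) (of_linear 20 fun a _ =>
    ⟨.case a .skip .skip .skip, fun i x st hx hc => ?_⟩) hf
  match x, hx with
  | [], hx => exact ⟨_, by simp [enc], .case_nil hx ((Exec.skip _).cast (by
      rw [List.tail_nil, ← hx, Function.update_eq_self]))⟩
  | b :: l, hx => exact ⟨2, by simp [enc]; omega, .case_cons hx (by cases b <;> exact .skip _)⟩

theorem head {f : F.Idx → α → Word} (hf : FP F f) : FP F (fun i x => (f i x).headD false) := by
  refine comp' (g := fun i (y : Word) => y.headD false) (of_linear 20 fun a _ =>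
    ⟨.case a (.push a false) (.seq (.clear a) (.push a false)) (.seq (.clear a) (.push a true)),
      fun i x st hx hc => ?_⟩) hf
  match x, hx with
  | [], hx => exact ⟨_, by simp [enc], .case_nil hx ((Exec.push _ _ _).cast (by
      rw [hx]; rfl))⟩
  | b :: l, hx =>
    obtain ⟨t, ht, h⟩ := Exec.clear (φ := F.oracle i) (st := Function.update st a l) a
    have h₂ := h.seq (Exec.push _ a b)
    have e : (bif b then (.seq (.clear a) (.push a true)) else (.seq (.clear a) (.push a false))) =
      Prog.seq (.clear a) (.push a b) := by cases b <;> rfl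
    rw [← e] at h₂
    refine ⟨_, ?_, .case_cons hx (h₂.cast ?_)⟩
    · simp [enc] at ht ⊢; omega
    · simp [enc]

theorem isEmpty {f : F.Idx → α → Word} (hf : FP F f) : FP F (fun i x => (f i x).isEmpty) := by
  refine comp' (g := fun i (y : Word) => y.isEmpty) (of_linear 20 fun a _ =>
    ⟨.case a (.push a true) (.seq (.clear a) (.push a false)) (.seq (.clear a) (.push a false)),
      fun i x st hx hc => ?_⟩) hf
  match x, hx with
  | [], hx => exact ⟨_, by simp [enc], .case_nil hx ((Exec.push _ _ _).cast (by
      rw [hx]; rfl))⟩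
  | b :: l, hx =>
    obtain ⟨t, ht, h⟩ := Exec.clear (φ := F.oracle i) (st := Function.update st a l) a
    have h₂ := h.seq (Exec.push _ a false)
    refine ⟨_, ?_, .case_cons hx (by rw [Bool.cond_self]; exact h₂.cast (by simp [enc]))⟩
    simp [enc] at ht ⊢; omega

/-- Oracle calls with answers of polynomial length. -/
theorem oracle {f : F.Idx → α → Word} (hf : FP F f) (P : Polynomial ℕ)
    (hP : ∀ i x, (F.oracle i (f i x)).length ≤ P.eval (F.size i + (enc x).length)) :
    FP F (fun i x => F.oracle i (f i x)) := by
  intro a ha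
  obtain ⟨p, Q, hp⟩ := hf a ha
  -- The call takes constant time, but moving the answer off its port takes time linear in its
  -- length; `P` pays for that.
  refine ⟨.seq p <| .seq (.move a 0 (a + 1)) <| .seq .ask <| .move 1 a (a + 1),
    10 * Q + 10 * P + 20, fun i x st hx hc => ?_⟩
  obtain ⟨t₁, ht₁, h₁⟩ := hp i x st hx hc
  obtain ⟨t₂, ht₂, h₂⟩ := Exec.move (φ := F.oracle i) (st := Function.update st a (enc (f i x)))
    (r := a) (d := 0) (u := a + 1) (by omega) (by omega) (by omega) (by simp [hc (a + 1) (by omega)])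
  obtain ⟨t₃, ht₃, h₃⟩ := Exec.move (φ := F.oracle i) (st := Function.update (Function.update st a
    []) 1 (F.oracle i (f i x))) (r := 1) (d := a) (u := a + 1) (by omega) (by omega) (by omega)
    (by rw [Function.update_of_ne (by omega), Function.update_of_ne (by omega), hc _ (by omega)])
  have h0 := hc 0 (by omega)
  have h1 := hc 1 (by omega)
  have e : enc (f i x) = f i x := rfl
  have e' : enc (F.oracle i (f i x)) = F.oracle i (f i x) := rfl
  have := hP i x
  refine ⟨_, ?_, (h₁.seq (h₂.seq (((Exec.ask _).cast ?_).seq h₃))).cast ?_⟩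
  · simp at ht₂ ht₃
    rw [e']
    simp only [Polynomial.eval_add, Polynomial.eval_mul, Polynomial.eval_ofNat] at *
    omega
  · have e₀ : Function.update (Function.update (Function.update st a (enc (f i x))) 0
        (Function.update st a (enc (f i x)) a ++ Function.update st a (enc (f i x)) 0)) a [] 0 =
        f i x := by
      simp only [Function.update_apply]
      grind
    rw [e₀]
    funext r
    simp only [Function.update_apply]
    grind
  · funext r
    simp only [Function.update_apply]
    grind

/-- Iteration along a word, with intermediate results of polynomial length. -/
theorem foldl_aux {g : F.Idx → β × Bool → β} (hg : FP F g) (P : Polynomial ℕ)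
    (hP : ∀ i s (l : Word), (enc (l.foldl (fun s b => g i (s, b)) s)).length ≤
      P.eval (F.size i + (enc s).length + l.length)) :
    FP F (fun i (x : Word × β) => x.1.foldl (fun s b => g i (s, b)) x.2) := by
  intro a ha
  obtain ⟨p, Q, hp⟩ := hg (a + 1) (by omega)
  -- A bound for one round: pairing the intermediate result, of length at most `P`, with the current
  -- letter, and running `p` on the code of that pair.
  let N : Polynomial ℕ := Q.comp (Polynomial.X + 2 * P + 2) + 14 * P + 50
  refine ⟨.seq (.unpair a (a + 1) (a + 2) (a + 3)) <|
    .seq (.loop a (.seq (.push (a + 2) false) (.seq (.pair (a + 1) (a + 2) (a + 3)) p))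
      (.seq (.push (a + 2) true) (.seq (.pair (a + 1) (a + 2) (a + 3)) p))) <|
    .move (a + 1) a (a + 2), 10 * Polynomial.X + (N + 1) * Polynomial.X + 10 * P + 100,
    fun i x st hx hc => ?_⟩
  obtain ⟨l, s⟩ := x
  have e : enc (l, s) = pairWords l (enc s) := rfl
  set n := F.size i + (enc (l, s)).length with hn
  have hle : (enc (l, s)).length = 2 * l.length + (enc s).length + 1 := by
    rw [e, length_pairWords]
  have hs : ∀ u v, u ++ v = l → (enc (u.foldl (fun s b => g i (s, b)) s)).length ≤ P.eval n := by
    intro u v huv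
    refine (hP i s u).trans (eval_mono_nat P ?_)
    have := congrArg List.length huv
    rw [List.length_append] at this
    omega
  have hc1 := hc (a + 1) (by omega)
  have hc2 := hc (a + 2) (by omega)
  have hc3 := hc (a + 3) (by omega)
  obtain ⟨t₁, ht₁, h₁⟩ := Exec.unpair (φ := F.oracle i) (st := st) (a := a) (b := a + 1)
    (c := a + 2) (d := a + 3) (by omega) (by omega) (by omega) (by omega) (by omega) (by omega)
    hc1 hc2 hc3
  obtain ⟨t₂, ht₂, h₂⟩ := Exec.loop_of (φ := F.oracle i) (r := a)
    (p₀ := .seq (.push (a + 2) false) (.seq (.pair (a + 1) (a + 2) (a + 3)) p))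
    (p₁ := .seq (.push (a + 2) true) (.seq (.pair (a + 1) (a + 2) (a + 3)) p)) (T := N.eval n)
    (fun u v => Function.update (Function.update st (a + 1)
      (enc (u.foldl (fun s b => g i (s, b)) s))) a v) l (by simp) (fun u b v huv => by
      have hb : (bif b then
          (.seq (.push (a + 2) true) (.seq (.pair (a + 1) (a + 2) (a + 3)) p)) else
          (.seq (.push (a + 2) false) (.seq (.pair (a + 1) (a + 2) (a + 3)) p))) =
          Prog.seq (.push (a + 2) b) (.seq (.pair (a + 1) (a + 2) (a + 3)) p) := by cases b <;> rfl
      rw [hb, Function.update_idem, List.foldl_append, List.foldl_cons, List.foldl_nil]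
      have hu := hs u (b :: v) huv
      generalize u.foldl (fun s b => g i (s, b)) s = y at *
      have g₁ := Exec.push (φ := F.oracle i) (Function.update (Function.update st (a + 1)
        (enc y)) a v) (a + 2) b
      obtain ⟨r₂, hr₂, g₂⟩ := Exec.pair (φ := F.oracle i)
        (st := Function.update (Function.update (Function.update st (a + 1)
          (enc y)) a v) (a + 2) [b]) (a := a + 1) (b := a + 2) (c := a + 3) (by omega)
        (by omega) (by omega) (by simp [hc3])
      obtain ⟨r₃, hr₃, g₃⟩ := hp i (y, b) (Function.update (Function.update st a v)
        (a + 1) (enc (y, b))) (by simp)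
        (fun r hr => by
          rw [Function.update_of_ne (by omega), Function.update_of_ne (by omega)]
          exact hc r (by omega))
      have e₁ : enc (y, b) = pairWords (enc y) [b] := rfl
      refine ⟨_, ?_, (g₁.cast ?_).seq ((g₂.cast ?_).seq (g₃.cast ?_))⟩
      · have := eval_mono_nat Q (show F.size i + (enc (y, b)).length ≤ n + 2 * P.eval n + 2 by
          rw [e₁, length_pairWords, List.length_singleton]; omega)
        simp at hr₂
        simp only [N, Polynomial.eval_add, Polynomial.eval_comp, Polynomial.eval_mul,
          Polynomial.eval_X, Polynomial.eval_ofNat]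
        omega
      · simp [hc2]
      · simp only [Function.update_self]
        rw [e₁]
        funext r
        simp only [Function.update_apply]
        grind
      · funext r
        simp only [Function.update_apply]
        grind)
  obtain ⟨t₃, ht₃, h₃⟩ := Exec.move (φ := F.oracle i) (st := Function.update (Function.update st
    (a + 1) (enc (l.foldl (fun s b => g i (s, b)) s))) a []) (r := a + 1) (d := a) (u := a + 2)
    (by omega) (by omega) (by omega) (by simp [hc2])
  rw [hx, e, unpairWords_pairWords] at h₁
  refine ⟨_, ?_, (h₁.seq (h₂.seq h₃)).cast ?_⟩
  · have := hs l [] (by simp)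
    rw [hx] at ht₁
    simp at ht₃
    have h4 : (N.eval n + 1) * l.length ≤ (N.eval n + 1) * n := Nat.mul_le_mul_left _ (by omega)
    simp only [Polynomial.eval_add, Polynomial.eval_mul, Polynomial.eval_X,
      Polynomial.eval_ofNat, Polynomial.eval_one]
    omega
  · funext r
    simp only [Function.update_apply]
    grind

/-- Iteration along a word, with parameters and with intermediate results of polynomial length. -/
theorem foldl_of_bound {l : F.Idx → α → Word} {s : F.Idx → α → β} {g : F.Idx → α → β → Bool → β}
    (hl : FP F l) (hs : FP F s) (hg : FP F (fun i (z : α × β × Bool) => g i z.1 z.2.1 z.2.2))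
    (P : Polynomial ℕ) (hP : ∀ i x y (w : Word), (enc (w.foldl (g i x) y)).length ≤
      P.eval (F.size i + (enc x).length + (enc y).length + w.length)) :
    FP F (fun i x => (l i x).foldl (g i x) (s i x)) := by
  -- The parameter `x` rides along unchanged in the state, which reduces the claim to iteration
  -- without parameters.
  have key : ∀ i x y (w : Word), w.foldl (fun (z : α × β) b => (z.1, g i z.1 z.2 b)) (x, y) =
      (x, w.foldl (g i x) y) := by
    intro i x y w
    induction w generalizing y with
    | nil => rfl
    | cons b w ih => simpa using ih _
  have h1 : FP F (fun i (z : (α × β) × Bool) => (z.1.1, g i z.1.1 z.1.2 z.2)) :=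
    FP.id.fst.fst.pair (comp' hg (FP.id.fst.fst.pair (FP.id.fst.snd.pair FP.id.snd)))
  have h2 := foldl_aux h1 (2 * Polynomial.X + P + 1) (by
    rintro i ⟨x, y⟩ w
    have e : ∀ y : β, enc (x, y) = pairWords (enc x) (enc y) := fun _ => rfl
    rw [key, e, e, length_pairWords, length_pairWords]
    have := (hP i x y w).trans (eval_mono_nat P (show _ ≤ F.size i +
      (2 * (enc x).length + (enc y).length + 1) + w.length by omega))
    simp only [Polynomial.eval_add, Polynomial.eval_mul, Polynomial.eval_X,
      Polynomial.eval_ofNat, Polynomial.eval_one]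
    omega)
  have h3 := (comp' h2 (hl.pair (FP.id.pair hs))).snd
  refine h3.of_enc_eq fun i x => ?_
  rw [key]

/-- Iteration along a word when each step adds polynomially many letters. -/
theorem foldl {l : F.Idx → α → Word} {s : F.Idx → α → β} {g : F.Idx → α → β → Bool → β}
    (hl : FP F l) (hs : FP F s) (hg : FP F (fun i (z : α × β × Bool) => g i z.1 z.2.1 z.2.2))
    (P : Polynomial ℕ) (hP : ∀ i x y b, (enc (g i x y b)).length ≤
      (enc y).length + P.eval (F.size i + (enc x).length)) :
    FP F (fun i x => (l i x).foldl (g i x) (s i x)) := by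
  refine foldl_of_bound hl hs hg (Polynomial.X + Polynomial.X * P) fun i x y w => ?_
  have h : (enc (w.foldl (g i x) y)).length ≤
      (enc y).length + w.length * P.eval (F.size i + (enc x).length) := by
    induction w generalizing y with
    | nil => simp
    | cons b w ih =>
      have h1 := ih (g i x y b)
      have h2 := hP i x y b
      rw [List.foldl_cons, List.length_cons, add_mul]
      omega
  refine h.trans ?_
  simp only [Polynomial.eval_add, Polynomial.eval_mul, Polynomial.eval_X]
  refine Nat.add_le_add (by omega) (Nat.mul_le_mul (by omega) (eval_mono_nat P (by omega)))

end FP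

/-- The output convention of oracle machines for polynomial-time functionals. -/
theorem FP.exists_machine {f : F.Idx → Word → Word} (hf : FP F f) :
    ∃ (M : OracleTM) (τ t : Polynomial ℕ), ∀ i s,
      M.OutputsWithin (F.oracle i) s (f i s) (τ.eval (F.size i) * t.eval s.length) := by
  obtain ⟨p, P, hp⟩ := hf 2 le_rfl
  obtain ⟨M, hM⟩ := Prog.exists_machine (.seq p (.move 2 3 4))
  -- A bound in the sum `m + n` must be turned into a product. Evaluating at twice the larger of the
  -- two suffices, and the summand `1` keeps the other factor at least one.
  let R : Polynomial ℕ := (5 * P + 5).comp (2 * Polynomial.X) + 1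
  refine ⟨M, R, R, fun i s => ?_⟩
  obtain ⟨t₁, ht₁, h₁⟩ := hp i s (Function.update (fun _ => []) 2 s) (by simp [enc])
    (fun r hr => by rw [Function.update_of_ne (by omega)])
  obtain ⟨t₂, ht₂, h₂⟩ := Exec.move (φ := F.oracle i) (st := Function.update (Function.update
    (fun _ => []) 2 s) 2 (enc (f i s))) (r := 2) (d := 3) (u := 4) (by omega) (by omega) (by omega)
    (by simp)
  obtain ⟨c, hc, ho, ⟨he⟩⟩ := hM _ _ _ _ (h₁.seq h₂)
  refine ⟨c, hc, ho.trans (by simp [enc]), ⟨he.toEvalsTo, he.steps_le_m.trans ?_⟩⟩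
  have e : enc s = s := rfl
  rw [e] at ht₁
  simp at ht₂
  have h5 : ∀ m, R.eval m = 5 * P.eval (2 * m) + 6 := by
    intro m
    simp [R]
  rw [h5, h5]
  rcases le_total (F.size i) s.length with h | h
  · have := eval_mono_nat P (show F.size i + s.length ≤ 2 * s.length by omega)
    nlinarith
  · have := eval_mono_nat P (show F.size i + s.length ≤ 2 * F.size i by omega)
    nlinarith

@[simp]
theorem length_enc_prod (x : α) (y : β) :
    (enc (x, y)).length = 2 * (enc x).length + (enc y).length + 1 :=
  length_pairWords _ _

theorem length_enc_prod' (x : α × β) :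
    (enc x).length = 2 * (enc x.1).length + (enc x.2).length + 1 :=
  length_pairWords _ _

@[simp]
theorem length_enc_bool (b : Bool) : (enc b).length = 1 := rfl

@[simp]
theorem length_enc_word (w : Word) : (enc w).length = w.length := rfl

/-! ### Boolean and word operations -/

namespace FP

theorem not {f : F.Idx → α → Bool} (hf : FP F f) : FP F (fun i x => !f i x) :=
  (cond hf (.const false) (.const true)).of_enc_eq fun i x => by cases f i x <;> rfl

theorem and {f g : F.Idx → α → Bool} (hf : FP F f) (hg : FP F g) :
    FP F (fun i x => f i x && g i x) :=
  (cond hf hg (.const false)).of_enc_eq fun i x => by cases f i x <;> rfl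

theorem or {f g : F.Idx → α → Bool} (hf : FP F f) (hg : FP F g) :
    FP F (fun i x => f i x || g i x) :=
  (cond hf (.const true) hg).of_enc_eq fun i x => by cases f i x <;> rfl

theorem xor {f g : F.Idx → α → Bool} (hf : FP F f) (hg : FP F g) :
    FP F (fun i x => Bool.xor (f i x) (g i x)) :=
  (cond hf hg.not hg).of_enc_eq fun i x => by cases f i x <;> simp

theorem singleton {f : F.Idx → α → Bool} (hf : FP F f) : FP F (fun i x => [f i x]) :=
  hf.of_enc_eq fun _ _ => rfl

theorem cons {f : F.Idx → α → Bool} {g : F.Idx → α → Word} (hf : FP F f) (hg : FP F g) :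
    FP F (fun i x => f i x :: g i x) :=
  (hf.singleton.revAppend hg).of_enc_eq fun _ _ => by simp

theorem reverse {f : F.Idx → α → Word} (hf : FP F f) : FP F (fun i x => (f i x).reverse) :=
  (hf.revAppend (.const [])).of_enc_eq fun _ _ => by simp

theorem append {f g : F.Idx → α → Word} (hf : FP F f) (hg : FP F g) :
    FP F (fun i x => f i x ++ g i x) :=
  (hf.reverse.revAppend hg).of_enc_eq fun _ _ => by simp

/-- Here and below, words serve as unary counters: the fold runs once per letter and ignores the
letters themselves. -/
theorem drop {f g : F.Idx → α → Word} (hf : FP F f) (hg : FP F g) :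
    FP F (fun i x => (f i x).drop (g i x).length) := by
  have := FP.foldl hg hf (g := fun _ _ (l : Word) _ => l.tail) FP.id.snd.fst.tail 0
    (fun _ _ l _ => by simp)
  refine this.of_enc_eq fun i x => congrArg enc ?_
  generalize f i x = u
  generalize g i x = v
  induction v generalizing u with
  | nil => simp
  | cons b v ih => simp [ih]

theorem zeros {f : F.Idx → α → Word} (hf : FP F f) :
    FP F (fun i x => SetReps.zeros (f i x).length) := by
  have := FP.foldl hf (.const []) (g := fun _ _ (l : Word) _ => false :: l)
    (FP.cons (.const false) FP.id.snd.fst) 1 (fun _ _ l _ => by simp)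
  refine this.of_enc_eq fun i x => congrArg enc ?_
  have key : ∀ v u : Word, List.foldl (fun (l : Word) _ => false :: l) u v =
      SetReps.zeros v.length ++ u := by
    intro v
    induction v with
    | nil => simp [SetReps.zeros]
    | cons b v ih =>
      intro u
      rw [List.foldl_cons, ih, SetReps.zeros, SetReps.zeros, List.length_cons,
        List.replicate_succ', List.append_assoc, List.singleton_append]
  rw [key, List.append_nil]

end FP

/-! ## Integer arithmetic -/

/-- The number with the given binary digits, least significant first. -/
def natVal : Word → ℕ
  | [] => 0
  | b :: l => b.toNat + 2 * natVal l

theorem natVal_append (u v : Word) : natVal (u ++ v) = natVal u + 2 ^ u.length * natVal v := by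
  induction u with
  | nil => simp [natVal]
  | cons b u ih => simp only [List.cons_append, natVal, ih, List.length_cons]; ring

theorem natVal_lt (u : Word) : natVal u < 2 ^ u.length := by
  induction u with
  | nil => simp [natVal]
  | cons b u ih =>
    have : b.toNat ≤ 1 := by cases b <;> simp
    simp only [natVal, List.length_cons, pow_succ]
    omega

theorem natVal_bits (n : ℕ) : natVal n.bits = n := by
  induction n using Nat.binaryRec' with
  | zero => simp [natVal]
  | bit b n h ih => rw [Nat.bits_append_bit _ _ h, natVal, ih, Nat.bit_val]; ring

theorem natVal_zeros (k : ℕ) : natVal (zeros k) = 0 := by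
  induction k with
  | zero => rfl
  | succ k ih => rw [zeros, List.replicate_succ, natVal, ← zeros, ih]; rfl

/-- Remove the leading zeros of a binary number. -/
def trim (l : Word) : Word :=
  l.reverse.foldl (fun acc b => bif !b && acc.isEmpty then [] else b :: acc) []

/-- The scan starts at the most significant digit and drops a `0` as long as nothing has been kept,
which leaves the digits without leading zeros that `Nat.bits` produces. -/
theorem trim_eq (l : Word) : trim l = (natVal l).bits := by
  rw [trim, List.foldl_reverse]
  induction l with
  | nil => simp [natVal]
  | cons b l ih =>
    rw [List.foldr_cons, ih, natVal]
    have h : b.toNat + 2 * natVal l = Nat.bit b (natVal l) := by rw [Nat.bit_val]; ring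
    rw [h]
    by_cases h0 : natVal l = 0
    · cases b <;> simp [h0]
    · rw [Nat.bits_append_bit _ _ (fun h => absurd h h0)]
      have : (natVal l).bits ≠ [] := by
        intro h
        apply h0
        rw [← natVal_bits (natVal l), h, natVal]
      cases hb : (natVal l).bits <;> simp_all

theorem FP.trim {f : F.Idx → α → Word} (hf : FP F f) : FP F (fun i x => trim (f i x)) :=
  FP.foldl hf.reverse (.const [])
    (g := fun _ _ (acc : Word) b => bif !b && acc.isEmpty then [] else b :: acc)
    (.cond (.and FP.id.snd.snd.not FP.id.snd.fst.isEmpty) (.const [])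
      (.cons FP.id.snd.snd FP.id.snd.fst)) 1
    (fun _ _ acc b => by cases b <;> cases acc <;> simp)

/-- Integers in ones' complement: sign and digits. -/
abbrev Num : Type := Bool × Word

namespace Num

/-- The integer denoted. -/
def val (x : Num) : ℤ := if x.1 then -1 - natVal x.2 else natVal x.2

/-- Read as `s ^^ b`, the stored digits become two's complement digits, and both signs obey one
recursion. All later arithmetic uses this form. -/
theorem val_cons (s b : Bool) (l : Word) : val (s, b :: l) = (s ^^ b).toNat + 2 * val (s, l) := by
  cases s <;> cases b <;> simp [val, natVal] <;> ring

theorem val_eq_head_tail (s : Bool) (l : Word) :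
    val (s, l) = (s ^^ l.headD false).toNat + 2 * val (s, l.tail) := by
  cases l with
  | nil => cases s <;> simp [val, natVal]
  | cons b l => exact val_cons s b l

/-- The bijection sends `n ≥ 0` to `2n` and `-1 - n` to `2n + 1`. The sign is thus the lowest binary
digit of the code, and decoding is a split into head and tail. -/
theorem intEquivNat_val (x : Num) : Equiv.intEquivNat x.val = natVal (x.1 :: x.2) := by
  obtain ⟨s, l⟩ := x
  cases s
  · simp only [val, natVal]
    simp [Equiv.intEquivNat, Equiv.intEquivNatSumNat]
    rfl
  · have : val (true, l) = Int.negSucc (natVal l) := by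
      simp only [val, if_true]; omega
    rw [this, natVal]
    simp [Equiv.intEquivNat, Equiv.intEquivNatSumNat]
    ring

/-- The integer with a given code. -/
def decode (w : Word) : Num := (w.headD false, w.tail)

theorem val_decode_binaryInt (a : ℤ) : (decode (binaryInt a)).val = a := by
  apply Equiv.intEquivNat.injective
  rw [intEquivNat_val, decode]
  have : ∀ w : Word, natVal (w.headD false :: w.tail) = natVal w := by
    intro w; cases w <;> simp [natVal]
  rw [this, binaryInt, natVal_bits]

/-- The code of an integer. -/
def code (x : Num) : Word := trim (x.1 :: x.2)

theorem code_eq (x : Num) : x.code = binaryInt x.val := by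
  rw [code, trim_eq, binaryInt, intEquivNat_val]

/-- Doubling. -/
def double (x : Num) : Num := (x.1, x.1 :: x.2)

@[simp]
theorem val_double (x : Num) : x.double.val = 2 * x.val := by
  rw [double, val_cons]; simp

/-- Halving, rounded down. -/
def half (x : Num) : Num := (x.1, x.2.tail)

/-- Parity. -/
def odd (x : Num) : Bool := x.1 ^^ x.2.headD false

theorem val_eq_odd_half (x : Num) : x.val = x.odd.toNat + 2 * x.half.val :=
  val_eq_head_tail x.1 x.2

@[simp]
theorem val_half (x : Num) : x.half.val = x.val / 2 := by
  have := val_eq_odd_half x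
  have h : x.odd.toNat ≤ 1 := by cases x.odd <;> simp
  omega

theorem odd_iff (x : Num) : x.odd = true ↔ x.val % 2 = 1 := by
  have := val_eq_odd_half x
  cases h : x.odd <;> simp [h] at * <;> omega

/-- Complement. -/
def compl (x : Num) : Num := (!x.1, x.2)

@[simp]
theorem val_compl (x : Num) : x.compl.val = -1 - x.val := by
  obtain ⟨s, l⟩ := x
  cases s <;> simp [compl, val]

theorem val_neg_iff (x : Num) : x.1 = true ↔ x.val < 0 := by
  obtain ⟨s, l⟩ := x
  cases s <;> simp [val]; omega

/-- One step of binary addition: output so far, carry, remaining digits. -/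
def addStep (s s' : Bool) (z : Word × Bool × Word) (b : Bool) : Word × Bool × Word :=
  (((s ^^ b) ^^ ((s' ^^ z.2.2.headD false) ^^ z.2.1)) :: z.1,
    ((s ^^ b) && (s' ^^ z.2.2.headD false)) || (z.2.1 && ((s ^^ b) || (s' ^^ z.2.2.headD false))),
    z.2.2.tail)

/-- Addition. -/
def add (x y : Num) : Num :=
  let z := (x.2 ++ (zeros y.2.length ++ [false])).foldl (addStep x.1 y.1) ([], false, y.2)
  let s := x.1 ^^ (y.1 ^^ z.2.1)
  (s, z.1.foldl (fun acc b => (s ^^ b) :: acc) [])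

/-- The invariant of schoolbook addition: the output digits, plus the carry and both unread
remainders weighted with the next power of two, have a constant sum. When `u` is used up, only its
sign extension remains of it. -/
theorem addStep_fold (s s' : Bool) (u : Word) : ∀ z : Word × Bool × Word,
    let z' := u.foldl (addStep s s') z
    z'.1.length = z.1.length + u.length ∧ z'.2.2 = z.2.2.drop u.length ∧
      (natVal z'.1.reverse : ℤ) + 2 ^ z'.1.length * (val (s, []) + val (s', z'.2.2) + z'.2.1.toNat) =
        natVal z.1.reverse + 2 ^ z.1.length * (val (s, u) + val (s', z.2.2) + z.2.1.toNat) := by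
  induction u with
  | nil => simp
  | cons b u ih =>
    rintro ⟨o, c, v⟩
    obtain ⟨h1, h2, h3⟩ := ih (addStep s s' (o, c, v) b)
    refine ⟨?_, ?_, ?_⟩
    · rw [List.foldl_cons, h1]; simp [addStep]; omega
    · rw [List.foldl_cons, h2]; simp [addStep]
    · rw [List.foldl_cons, h3, val_cons, val_eq_head_tail s' v]
      simp only [addStep, List.reverse_cons, natVal_append, List.length_cons, List.length_reverse,
        pow_succ]
      generalize (s ^^ b) = p
      generalize (s' ^^ v.headD false) = q
      cases p <;> cases q <;> cases c <;> simp [natVal] <;> ring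

/-- Converts two's complement digits back to stored ones: the sign bit weighs `-2 ^ l.length`. -/
theorem val_map_xor (s : Bool) (l : Word) :
    val (s, l.map fun b => s ^^ b) = natVal l - s.toNat * 2 ^ l.length := by
  induction l with
  | nil => cases s <;> simp [val, natVal]
  | cons b l ih =>
    rw [List.map_cons, val_cons, ih]
    cases s <;> cases b <;> simp [natVal, pow_succ] <;> ring

theorem foldl_xor (s : Bool) (l : Word) :
    l.foldl (fun acc b => (s ^^ b) :: acc) [] = l.reverse.map fun b => s ^^ b := by
  have : ∀ acc, l.foldl (fun acc b => (s ^^ b) :: acc) acc =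
      (l.reverse.map fun b => s ^^ b) ++ acc := by
    induction l with
    | nil => simp
    | cons b l ih => simp [ih]
  simp [this]

theorem length_add (x y : Num) : (add x y).2.length = x.2.length + y.2.length + 1 := by
  have := (addStep_fold x.1 y.1 (x.2 ++ (zeros y.2.length ++ [false])) ([], false, y.2)).1
  rw [add, foldl_xor, List.length_map, List.length_reverse, this]
  simp [zeros]; omega

@[simp]
theorem val_add (x y : Num) : (add x y).val = x.val + y.val := by
  obtain ⟨s, u⟩ := x
  obtain ⟨s', v⟩ := y
  obtain ⟨h1, h2, h3⟩ := addStep_fold s s' (u ++ zeros v.length) ([], false, v)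
  have hu : val (s, u ++ zeros v.length) = val (s, u) := by
    simp only [val, natVal_append, natVal_zeros, mul_zero, add_zero]
  rw [hu] at h3
  have hv : val (s', []) = - s'.toNat := by cases s' <;> simp [val, natVal]
  have hv' : val (s, []) = - s.toNat := by cases s <;> simp [val, natVal]
  have h2' : v.drop (u ++ zeros v.length).length = [] := by simp [zeros]
  simp only [h2'] at h2
  rw [add, foldl_xor, val_map_xor, List.length_reverse]
  simp only [← List.append_assoc]
  -- The padding has used up all digits of both summands, and the remainder `c - s - s'` may still
  -- be anything from `-2` to `1`. The one additional place brings it to `0` or `-1`, so that it is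
  -- a sign.
  rw [List.foldl_append]
  generalize (u ++ zeros v.length).foldl (addStep s s') ([], false, v) = z at *
  obtain ⟨o, c, w⟩ := z
  dsimp only at h2 h3
  subst h2
  rw [hv, hv'] at h3
  simp only [List.foldl_cons, List.foldl_nil, addStep, List.reverse_cons, natVal_append,
    List.length_cons, List.length_reverse, pow_succ]
  simp [natVal] at h3 ⊢
  rw [← h3]
  cases s <;> cases s' <;> cases c <;> simp <;> ring

/-- Multiplication by a power of two. -/
def shiftLeft (x : Num) (w : Word) : Num := w.foldl (fun y _ => y.double) x

/-- Division by a power of two, rounded down. -/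
def shiftRight (x : Num) (w : Word) : Num := w.foldl (fun y _ => y.half) x

@[simp]
theorem val_shiftLeft (x : Num) (w : Word) : (x.shiftLeft w).val = x.val * 2 ^ w.length := by
  induction w generalizing x with
  | nil => simp [shiftLeft]
  | cons b w ih =>
    have := ih x.double
    rw [shiftLeft, List.foldl_cons, ← shiftLeft, this, val_double, List.length_cons, pow_succ]
    ring

@[simp]
theorem val_shiftRight (x : Num) (w : Word) : (x.shiftRight w).val = x.val / 2 ^ w.length := by
  induction w generalizing x with
  | nil => simp [shiftRight]
  | cons b w ih =>
    have := ih x.half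
    rw [shiftRight, List.foldl_cons, ← shiftRight, this, val_half, List.length_cons, pow_succ',
      Int.ediv_ediv_of_nonneg (by norm_num)]

theorem _root_.SetReps.FP.double {f : F.Idx → α → Num} (hf : FP F f) :
    FP F (fun i x => (f i x).double) :=
  hf.fst.pair (.cons hf.fst hf.snd)

theorem _root_.SetReps.FP.half {f : F.Idx → α → Num} (hf : FP F f) :
    FP F (fun i x => (f i x).half) :=
  hf.fst.pair hf.snd.tail

theorem _root_.SetReps.FP.odd {f : F.Idx → α → Num} (hf : FP F f) :
    FP F (fun i x => (f i x).odd) :=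
  hf.fst.xor hf.snd.head

theorem _root_.SetReps.FP.compl {f : F.Idx → α → Num} (hf : FP F f) :
    FP F (fun i x => (f i x).compl) :=
  hf.fst.not.pair hf.snd

theorem _root_.SetReps.FP.numDecode {f : F.Idx → α → Word} (hf : FP F f) :
    FP F (fun i x => decode (f i x)) :=
  hf.head.pair hf.tail

theorem _root_.SetReps.FP.numCode {f : F.Idx → α → Num} (hf : FP F f) :
    FP F (fun i x => (f i x).code) :=
  (FP.cons hf.fst hf.snd).trim

theorem _root_.SetReps.FP.foldl_xor {s : F.Idx → α → Bool} {l : F.Idx → α → Word} (hs : FP F s)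
    (hl : FP F l) : FP F (fun i x => (l i x).foldl (fun acc b => (s i x ^^ b) :: acc) []) :=
  FP.foldl hl (.const []) (g := fun i x (acc : Word) b => (s i x ^^ b) :: acc)
    (.cons ((hs.comp' FP.id.fst).xor FP.id.snd.snd) FP.id.snd.fst) 1 (fun i x z b => by simp)

theorem _root_.SetReps.FP.add {f g : F.Idx → α → Num} (hf : FP F f) (hg : FP F g) :
    FP F (fun i x => (f i x).add (g i x)) := by
  have h1 : FP F (fun (_ : F.Idx) (z : (Bool × Bool) × (Word × Bool × Word) × Bool) =>
      addStep z.1.1 z.1.2 z.2.1 z.2.2) := by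
    have hs : FP F (fun (_ : F.Idx) (z : (Bool × Bool) × (Word × Bool × Word) × Bool) =>
      (z.1.1 ^^ z.2.2)) := FP.id.fst.fst.xor FP.id.snd.snd
    have hs' : FP F (fun (_ : F.Idx) (z : (Bool × Bool) × (Word × Bool × Word) × Bool) =>
      (z.1.2 ^^ z.2.1.2.2.headD false)) := FP.id.fst.snd.xor FP.id.snd.fst.snd.snd.head
    have hc : FP F (fun (_ : F.Idx) (z : (Bool × Bool) × (Word × Bool × Word) × Bool) =>
      z.2.1.2.1) := FP.id.snd.fst.snd.fst
    exact (FP.cons (hs.xor (hs'.xor hc)) FP.id.snd.fst.fst).pair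
      (((hs.and hs').or (hc.and (hs.or hs'))).pair FP.id.snd.fst.snd.snd.tail)
  have h2 := FP.foldl (hf.snd.append (hg.snd.zeros.append (.const [false])))
    ((FP.const []).pair ((FP.const false).pair hg.snd))
    (g := fun i x z b => addStep (f i x).1 (g i x).1 z b)
    (h1.comp' (((hf.comp' FP.id.fst).fst.pair (hg.comp' FP.id.fst).fst).pair FP.id.snd))
    3 (fun i x z b => by
      obtain ⟨o, c, v⟩ := z
      simp [addStep]; omega)
  have h3 := hf.fst.xor (hg.fst.xor h2.snd.fst)
  exact h3.pair (h3.foldl_xor h2.fst)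

theorem _root_.SetReps.FP.shiftLeft {f : F.Idx → α → Num} {g : F.Idx → α → Word} (hf : FP F f)
    (hg : FP F g) : FP F (fun i x => (f i x).shiftLeft (g i x)) :=
  FP.foldl hg hf (g := fun _ _ (y : Num) _ => y.double) FP.id.snd.fst.double 1
    (fun _ _ y _ => by simp [double, length_enc_prod' y]; omega)

theorem _root_.SetReps.FP.shiftRight {f : F.Idx → α → Num} {g : F.Idx → α → Word} (hf : FP F f)
    (hg : FP F g) : FP F (fun i x => (f i x).shiftRight (g i x)) :=
  FP.foldl hg hf (g := fun _ _ (y : Num) _ => y.half) FP.id.snd.fst.half 0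
    (fun _ _ y _ => by simp [half, length_enc_prod' y])

end Num

/-! ## Dyadic numbers and precisions -/

theorem unaryInt_natCast (k : ℕ) : unaryInt k = zeros (2 * k) := rfl

theorem unaryInt_negSucc (k : ℕ) : unaryInt (Int.negSucc k) = zeros (2 * k + 1) := rfl

/-- Integer precisions, as differences of unary numbers. -/
abbrev Prec : Type := Word × Word

namespace Prec

/-- The integer denoted. -/
def val (n : Prec) : ℤ := n.1.length - n.2.length

/-- The unary code of the precision. -/
def code (n : Prec) : Word :=
  bif (n.2.drop n.1.length).isEmpty then
    zeros (n.1.drop n.2.length ++ n.1.drop n.2.length).length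
  else zeros (n.2.drop n.1.length ++ n.2.drop n.1.length).tail.length

theorem code_eq (n : Prec) : n.code = unaryInt n.val := by
  obtain ⟨p, r⟩ := n
  simp only [code, unaryInt, val]
  by_cases h : r.length ≤ p.length
  · have h1 : r.drop p.length = [] := by simpa using h
    have h2 : (p.length : ℤ) - r.length = ((p.length - r.length : ℕ) : ℤ) := by omega
    rw [h1, h2]
    simp only [List.isEmpty_nil, cond_true, List.length_append, List.length_drop]
    rw [← unaryInt, unaryInt_natCast]
    congr 1
    omega
  · have h1 : (r.drop p.length).isEmpty = false := by simpa using by omega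
    have h2 : (p.length : ℤ) - r.length = Int.negSucc (r.length - p.length - 1) := by omega
    rw [h1, h2]
    simp only [cond_false, List.length_tail, List.length_append, List.length_drop]
    rw [← unaryInt, unaryInt_negSucc]
    congr 1
    omega

/-- The precision with a given unary code. -/
def decode (w : Word) : Prec :=
  let z := w.foldl (fun (z : Bool × Word) _ => (!z.1, bif z.1 then false :: z.2 else z.2)) (false, [])
  bif z.1 then ([], false :: z.2) else (z.2, [])

/-- Even lengths `2k` stand for `k`, odd lengths `2k + 1` for `-1 - k`; the fold records the parity
and half the length. -/
theorem val_decode (n : ℤ) : (decode (unaryInt n)).val = n := by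
  have key : ∀ k, ((zeros (2 * k)).foldl (fun (z : Bool × Word) _ =>
      (!z.1, bif z.1 then false :: z.2 else z.2)) (false, [])) = (false, zeros k) := by
    intro k
    induction k with
    | zero => rfl
    | succ k ih =>
      have : zeros (2 * (k + 1)) = zeros (2 * k) ++ [false, false] := by
        simp [zeros, mul_add, List.replicate_succ']
      rw [this, List.foldl_append, ih]
      rfl
  cases n with
  | ofNat k =>
    rw [Int.ofNat_eq_natCast, decode, unaryInt_natCast, key]
    simp [val, zeros]
  | negSucc k =>
    rw [unaryInt_negSucc, zeros, List.replicate_succ', ← zeros]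
    simp only [decode, List.foldl_append, key]
    simp [val, zeros, Int.negSucc_eq]

theorem _root_.SetReps.FP.precCode {f : F.Idx → α → Prec} (hf : FP F f) :
    FP F (fun i x => (f i x).code) :=
  .cond (hf.snd.drop hf.fst).isEmpty
    ((hf.fst.drop hf.snd).append (hf.fst.drop hf.snd)).zeros
    ((hf.snd.drop hf.fst).append (hf.snd.drop hf.fst)).tail.zeros

theorem _root_.SetReps.FP.precDecode {f : F.Idx → α → Word} (hf : FP F f) :
    FP F (fun i x => decode (f i x)) := by
  have h := FP.foldl hf (.const (false, []))
    (g := fun _ _ (z : Bool × Word) _ => (!z.1, bif z.1 then false :: z.2 else z.2))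
    (FP.id.snd.fst.fst.not.pair (.cond FP.id.snd.fst.fst (.cons (.const false) FP.id.snd.fst.snd)
      FP.id.snd.fst.snd)) 1 (fun _ _ z _ => by
        obtain ⟨b, w⟩ := z; cases b <;> simp; omega)
  exact .cond h.fst ((FP.const []).pair (.cons (.const false) h.snd)) (h.snd.pair (.const []))

end Prec

theorem mem_dyadics_iff {q : ℚ} : q ∈ dyadics ↔ ∃ (a : ℤ) (k : ℕ), q = a / 2 ^ k := by
  simp only [dyadics, dyadicsOfPrec, Set.mem_iUnion, Set.mem_ofPred_eq]
  constructor
  · rintro ⟨m, a, rfl⟩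
    obtain ⟨k, rfl | rfl⟩ := m.eq_nat_or_neg
    · exact ⟨a, k, by simp⟩
    · exact ⟨a * 2 ^ k, 0, by simp⟩
  · rintro ⟨a, k, rfl⟩
    exact ⟨k, a, by simp⟩

theorem num_den_of_eq_div {q : ℚ} {a : ℤ} {k : ℕ} (h : q = a / 2 ^ k)
    (hk : k = 0 ∨ a % 2 = 1) : q.num = a ∧ q.den = 2 ^ k := by
  have hc : Nat.Coprime a.natAbs ((2 : ℤ) ^ k).natAbs := by
    rcases hk with rfl | ha
    · simp
    · rw [Int.natAbs_pow]
      refine Nat.Coprime.pow_right _ ?_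
      rw [Nat.coprime_comm]
      refine (Nat.Prime.coprime_iff_not_dvd Nat.prime_two).2 fun h => ?_
      omega
  have h' : q = (a : ℚ) / ((2 ^ k : ℤ) : ℚ) := by rw [h]; push_cast; rfl
  refine ⟨by rw [h', Rat.num_div_eq_of_coprime (by positivity) hc], ?_⟩
  have := Rat.den_div_eq_of_coprime (a := a) (b := 2 ^ k) (by positivity) hc
  rw [← h'] at this
  exact_mod_cast this

theorem exists_reduced {q : ℚ} (h : q ∈ dyadics) :
    ∃ k : ℕ, q.den = 2 ^ k ∧ Nat.log 2 q.den = k ∧ q = q.num / 2 ^ k := by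
  obtain ⟨a, k, hq⟩ := mem_dyadics_iff.1 h
  have h1 : q.den ∣ 2 ^ k := by
    have h' : q = Rat.divInt a (2 ^ k) := by rw [hq, Rat.divInt_eq_div]; push_cast; rfl
    have := Rat.den_dvd a (2 ^ k)
    rw [← h'] at this
    exact_mod_cast this
  obtain ⟨j, _, hj⟩ := (Nat.dvd_prime_pow Nat.prime_two).1 h1
  refine ⟨j, hj, by rw [hj, Nat.log_pow (by norm_num)], ?_⟩
  conv_lhs => rw [← Rat.num_div_den q, hj]
  push_cast
  rfl

namespace Num

/-- Subtraction. -/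
def sub (x y : Num) : Num := (x.compl.add y).compl

@[simp]
theorem val_sub (x y : Num) : (x.sub y).val = x.val - y.val := by
  simp only [sub, val_compl, val_add]; ring

theorem abs_val_le (x : Num) : |x.val| ≤ 2 ^ x.2.length := by
  have h := natVal_lt x.2
  have h' : (natVal x.2 : ℤ) < 2 ^ x.2.length := by exact_mod_cast h
  rw [abs_le, val]
  split_ifs <;> constructor <;> omega

theorem _root_.SetReps.FP.sub {f g : F.Idx → α → Num} (hf : FP F f) (hg : FP F g) :
    FP F (fun i x => (f i x).sub (g i x)) :=
  (hf.compl.add hg).compl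

end Num

/-- Dyadic numbers: a numerator and a precision. -/
abbrev Dy : Type := Num × Prec

namespace Dy

/-- The dyadic number denoted. -/
def val (x : Dy) : ℚ := x.1.val / 2 ^ x.2.val

theorem val_mem (x : Dy) : x.val ∈ dyadics :=
  Set.mem_iUnion.2 ⟨x.2.val, x.1.val, rfl⟩

theorem val_eq (x : Dy) : x.val = x.1.val * 2 ^ x.2.2.length / 2 ^ x.2.1.length := by
  rw [val, Prec.val, zpow_sub₀ (by norm_num)]
  simp [div_div_eq_mul_div]

/-- The dyadic number with a given code. -/
def decode (w : Word) : Dy := (Num.decode (unpairWords w).1, (unpairWords w).2, [])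

theorem val_decode {q : ℚ} (h : q ∈ dyadics) : (decode (dyadicCode q)).val = q := by
  obtain ⟨k, -, hk, hq⟩ := exists_reduced h
  rw [decode, dyadicCode, unpairWords_pairWords, val_eq]
  simp only [Num.val_decode_binaryInt, hk]
  conv_rhs => rw [hq]
  simp [zeros]

/-- One step of the reduction of a fraction: halve even numerators while the rest of the
denominator, which is the second component, is empty. -/
def reduceStep (z : Num × Word) : Num × Word :=
  bif z.1.odd || !z.2.isEmpty then (z.1, false :: z.2) else (z.1.half, z.2)

/-- The code of a dyadic number. -/
def code (x : Dy) : Word :=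
  let z := x.2.1.foldl (fun z _ => reduceStep z) (x.1.shiftLeft x.2.2, [])
  pairWords z.1.code (zeros z.2.length)

/-- Every round divides the value by two, by halving an even numerator or by lengthening the
denominator. The denominator is lengthened only under an odd numerator, which is then never changed,
so the final fraction is in lowest terms. -/
theorem reduce_fold (w : Word) : ∀ z : Num × Word, (z.2 = [] ∨ z.1.odd = true) →
    ((w.foldl (fun z _ => reduceStep z) z).2 = [] ∨
      (w.foldl (fun z _ => reduceStep z) z).1.odd = true) ∧
    ((w.foldl (fun z _ => reduceStep z) z).1.val : ℚ) /
        2 ^ (w.foldl (fun z _ => reduceStep z) z).2.length =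
      z.1.val / 2 ^ z.2.length / 2 ^ w.length := by
  induction w with
  | nil => simp
  | cons b w ih =>
    rintro ⟨y, k⟩ h
    rw [List.foldl_cons]
    cases ho : y.odd with
    | true =>
      have e : reduceStep (y, k) = (y, false :: k) := by simp [reduceStep, ho]
      rw [e]
      obtain ⟨h1, h2⟩ := ih (y, false :: k) (Or.inr ho)
      refine ⟨h1, h2.trans ?_⟩
      simp only [List.length_cons, pow_succ]
      field_simp
    | false =>
      obtain rfl : k = [] := by simpa [ho] using h
      have e : reduceStep (y, []) = (y.half, []) := by simp [reduceStep, ho]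
      rw [e]
      obtain ⟨h1, h2⟩ := ih (y.half, []) (Or.inl rfl)
      refine ⟨h1, h2.trans ?_⟩
      have h3 : y.val = 2 * y.half.val := by rw [y.val_eq_odd_half, ho]; simp
      simp only [h3, List.length_cons, pow_succ, List.length_nil]
      push_cast
      field_simp

theorem code_eq (x : Dy) : x.code = dyadicCode x.val := by
  obtain ⟨h1, h2⟩ := reduce_fold x.2.1 (x.1.shiftLeft x.2.2, []) (Or.inl rfl)
  rw [code]
  generalize x.2.1.foldl (fun z _ => reduceStep z) (x.1.shiftLeft x.2.2, []) = z at *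
  have hx : x.val = z.1.val / 2 ^ z.2.length := by
    rw [h2, val_eq]
    simp
  obtain ⟨e1, e2⟩ := num_den_of_eq_div hx (by
    rw [List.length_eq_zero_iff, ← Num.odd_iff]; exact h1)
  rw [dyadicCode, e1, e2, Nat.log_pow (by norm_num), Num.code_eq]

/-- Addition. -/
def add (x y : Dy) : Dy :=
  ((x.1.shiftLeft (x.2.2 ++ y.2.1)).add (y.1.shiftLeft (y.2.2 ++ x.2.1)), x.2.1 ++ y.2.1, [])

@[simp]
theorem val_add (x y : Dy) : (x.add y).val = x.val + y.val := by
  rw [val_eq, val_eq, val_eq]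
  simp only [add, Num.val_add, Num.val_shiftLeft, List.length_append, pow_add, List.length_nil]
  push_cast
  field_simp

/-- Negation. -/
def neg (x : Dy) : Dy := (Num.sub (false, []) x.1, x.2)

@[simp]
theorem val_neg (x : Dy) : x.neg.val = -x.val := by
  rw [val, val, neg, Num.val_sub]
  simp [Num.val, natVal]
  ring

theorem neg_iff (x : Dy) : x.1.1 = true ↔ x.val < 0 := by
  rw [Num.val_neg_iff, val, div_lt_iff₀ (by positivity), zero_mul]
  exact_mod_cast Iff.rfl

/-- The integer part of `x * 2 ^ m`. -/
def floorAt (x : Dy) (m : Prec) : Num :=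
  (x.1.shiftLeft (x.2.2 ++ m.1)).shiftRight (x.2.1 ++ m.2)

theorem val_mul_zpow (x : Dy) (m : Prec) : x.val * 2 ^ m.val =
    ((x.1.val * 2 ^ (x.2.2.length + m.1.length) : ℤ) : ℚ) /
      ((2 ^ (x.2.1.length + m.2.length) : ℕ) : ℚ) := by
  rw [val_eq, Prec.val, zpow_sub₀ (by norm_num)]
  push_cast
  simp only [pow_add, zpow_natCast]
  field_simp

theorem val_floorAt (x : Dy) (m : Prec) : (x.floorAt m).val = ⌊x.val * 2 ^ m.val⌋ := by
  rw [val_mul_zpow, Rat.floor_intCast_div_natCast, floorAt]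
  simp

/-- Whether `x` is an integer multiple of `2 ^ (-m)`. -/
def isMultiple (x : Dy) (m : Prec) : Bool :=
  !(((x.floorAt m).shiftLeft (x.2.1 ++ m.2)).sub (x.1.shiftLeft (x.2.2 ++ m.1))).1

/-- The rounded-down quotient times the divisor never exceeds the dividend, so the sign of their
difference alone decides equality. -/
theorem isMultiple_iff_floor (x : Dy) (m : Prec) :
    x.isMultiple m = true ↔ (⌊x.val * 2 ^ m.val⌋ : ℚ) = x.val * 2 ^ m.val := by
  have h1 : x.isMultiple m = true ↔ x.val * 2 ^ m.val ≤ ⌊x.val * 2 ^ m.val⌋ := by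
    rw [isMultiple, Bool.not_eq_true', ← Bool.not_eq_true, Num.val_neg_iff, not_lt, Num.val_sub,
      Num.val_shiftLeft, Num.val_shiftLeft, val_floorAt, sub_nonneg]
    generalize h : ⌊x.val * 2 ^ m.val⌋ = z
    rw [val_mul_zpow, div_le_iff₀ (by positivity), List.length_append, List.length_append]
    exact_mod_cast Iff.rfl
  rw [h1]
  exact ⟨fun h => le_antisymm (Int.floor_le _) h, fun h => h.ge⟩

theorem isMultiple_iff (x : Dy) (m : Prec) : x.isMultiple m = true ↔ x.val ∈ dyadicsOfPrec m.val := by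
  rw [isMultiple_iff_floor]
  constructor
  · intro h
    exact ⟨⌊x.val * 2 ^ m.val⌋, by rw [h]; field_simp⟩
  · rintro ⟨a, ha⟩
    have : x.val * 2 ^ m.val = a := by rw [ha]; field_simp
    rw [this, Int.floor_intCast]

theorem _root_.SetReps.FP.dyDecode {f : F.Idx → α → Word} (hf : FP F f) :
    FP F (fun i x => decode (f i x)) :=
  hf.unpairWords.fst.numDecode.pair (hf.unpairWords.snd.pair (.const []))

theorem _root_.SetReps.FP.dyCode {f : F.Idx → α → Dy} (hf : FP F f) :
    FP F (fun i x => (f i x).code) := by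
  have h := FP.foldl hf.snd.fst ((hf.fst.shiftLeft hf.snd.snd).pair (.const []))
    (g := fun _ _ (z : Num × Word) _ => reduceStep z)
    (.cond (FP.id.snd.fst.fst.odd.or FP.id.snd.fst.snd.isEmpty.not)
      (FP.id.snd.fst.fst.pair (.cons (.const false) FP.id.snd.fst.snd))
      (FP.id.snd.fst.fst.half.pair FP.id.snd.fst.snd)) 1 (fun _ _ z _ => by
        obtain ⟨⟨b, w⟩, k⟩ := z
        cases hz : (Num.odd (b, w) || !k.isEmpty)
        · simp [reduceStep, Num.half, hz]; omega
        · simp [reduceStep, hz]; omega)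
  exact (h.fst.numCode.pair h.snd.zeros).of_enc_eq fun _ _ => rfl

theorem _root_.SetReps.FP.dyAdd {f g : F.Idx → α → Dy} (hf : FP F f) (hg : FP F g) :
    FP F (fun i x => (f i x).add (g i x)) :=
  ((hf.fst.shiftLeft (hf.snd.snd.append hg.snd.fst)).add
    (hg.fst.shiftLeft (hg.snd.snd.append hf.snd.fst))).pair
    ((hf.snd.fst.append hg.snd.fst).pair (.const []))

theorem _root_.SetReps.FP.dyNeg {f : F.Idx → α → Dy} (hf : FP F f) :
    FP F (fun i x => (f i x).neg) :=
  (FP.sub (.const (false, [])) hf.fst).pair hf.snd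

theorem _root_.SetReps.FP.floorAt {f : F.Idx → α → Dy} {g : F.Idx → α → Prec} (hf : FP F f)
    (hg : FP F g) : FP F (fun i x => (f i x).floorAt (g i x)) :=
  (hf.fst.shiftLeft (hf.snd.snd.append hg.fst)).shiftRight (hf.snd.fst.append hg.snd)

theorem _root_.SetReps.FP.isMultiple {f : F.Idx → α → Dy} {g : F.Idx → α → Prec} (hf : FP F f)
    (hg : FP F g) : FP F (fun i x => (f i x).isMultiple (g i x)) :=
  (((hf.floorAt hg).shiftLeft (hf.snd.fst.append hg.snd)).sub
    (hf.fst.shiftLeft (hf.snd.snd.append hg.fst))).fst.not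

end Dy

/-! ## Queries -/

/-- The query word for a point and a precision. -/
def queryWord (x : Dy) (n : Prec) : Word := pairWords x.code n.code

theorem queryWord_eq (x : Dy) (n : Prec) : queryWord x n = query x.val n.val := by
  rw [queryWord, Dy.code_eq, Prec.code_eq, query]

theorem FP.queryWord {f : F.Idx → α → Dy} {g : F.Idx → α → Prec} (hf : FP F f) (hg : FP F g) :
    FP F (fun i x => queryWord (f i x) (g i x)) :=
  (hf.dyCode.pair hg.precCode).of_enc_eq fun _ _ => rfl

/-- The point of a query word. -/
def pointOf (s : Word) : Dy := Dy.decode (unpairWords s).1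

/-- The precision of a query word. -/
def precOf (s : Word) : Prec := Prec.decode (unpairWords s).2

theorem val_pointOf {q : ℚ} (hq : q ∈ dyadics) (n : ℤ) : (pointOf (query q n)).val = q := by
  rw [pointOf, query, unpairWords_pairWords, Dy.val_decode hq]

theorem val_precOf (q : ℚ) (n : ℤ) : (precOf (query q n)).val = n := by
  rw [precOf, query, unpairWords_pairWords, Prec.val_decode]

theorem FP.pointOf {f : F.Idx → α → Word} (hf : FP F f) : FP F (fun i x => pointOf (f i x)) :=
  hf.unpairWords.fst.dyDecode

theorem FP.precOf {f : F.Idx → α → Word} (hf : FP F f) : FP F (fun i x => precOf (f i x)) :=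
  hf.unpairWords.snd.precDecode

/-- The rest of a word after its first `1`. -/
def afterTrue (w : Word) : Word :=
  (w.foldl (fun (z : Bool × Word) b => bif z.1 then (true, b :: z.2) else (b, z.2))
    (false, [])).2.reverse

theorem afterTrue_eq (k : ℕ) (u : Word) : afterTrue (zeros k ++ true :: u) = u := by
  have h1 : (zeros k).foldl (fun (z : Bool × Word) b =>
      bif z.1 then (true, b :: z.2) else (b, z.2)) (false, []) = (false, []) := by
    induction k with
    | zero => rfl
    | succ k ih => rw [zeros, List.replicate_succ, List.foldl_cons, ← zeros]; exact ih
  have h2 : ∀ acc, u.foldl (fun (z : Bool × Word) b =>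
      bif z.1 then (true, b :: z.2) else (b, z.2)) (true, acc) = (true, u.reverse ++ acc) := by
    induction u with
    | nil => simp
    | cons b u ih => intro acc; rw [List.foldl_cons, cond_true, ih]; simp
  rw [afterTrue, List.foldl_append, h1, List.foldl_cons, cond_false, h2]
  simp

theorem FP.afterTrue {f : F.Idx → α → Word} (hf : FP F f) : FP F (fun i x => afterTrue (f i x)) :=
  (FP.foldl hf (.const (false, []))
    (g := fun _ _ (z : Bool × Word) b => bif z.1 then (true, b :: z.2) else (b, z.2))
    (.cond FP.id.snd.fst.fst ((FP.const true).pair (.cons FP.id.snd.snd FP.id.snd.fst.snd))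
      (FP.id.snd.snd.pair FP.id.snd.fst.snd)) 1 (fun _ _ z b => by
        obtain ⟨c, w⟩ := z
        cases c <;> simp; omega)).snd.reverse

theorem FP.pairFuns {f : F.Idx → Word → Word} {e : F.Idx → Word} (hf : FP F f)
    (he : FP F (fun i (_ : Word) => e i)) :
    FP F (fun i s => pairFuns (f i) (fun _ => e i) s) := by
  have hf' : FP F (fun i (s : Word) => f i s.tail) := hf.comp' FP.id.tail
  have := FP.cond (FP.isEmpty FP.id) (.const []) (.cond (FP.head FP.id)
    (hf'.zeros.append (.cons (.const true) he)) (he.zeros.append (.cons (.const true) hf')))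
  refine this.of_enc_eq fun i s => congrArg enc ?_
  match s with
  | [] => rfl
  | true :: s => rfl
  | false :: s => rfl

/-! ## Reductions from polynomial-time functionals -/

/-- Names in an enriched representation. -/
structure EnrichedName (Y : Set (Set ℝ)) (ρ : SetRep) (E : Set ℝ → Set Word) : Type where
  set : Set ℝ
  fn : Word → Word
  adv : Word
  mem : set ∈ Y
  name : ρ fn set
  adv_mem : adv ∈ E set

/-- The oracles of an enriched representation. -/
def enrichFamily (Y : Set (Set ℝ)) (ρ : SetRep) (E : Set ℝ → Set Word) : Family where
  Idx := EnrichedName Y ρ E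
  oracle i := pairFuns i.fn fun _ => i.adv
  size i := i.adv.length

/-- Names in a representation without advice. -/
structure PlainName (Y : Set (Set ℝ)) (ρ : SetRep) : Type where
  set : Set ℝ
  fn : Word → Word
  mem : set ∈ Y
  name : ρ fn set

/-- The oracles of a representation without advice. -/
def plainFamily (Y : Set (Set ℝ)) (ρ : SetRep) : Family where
  Idx := PlainName Y ρ
  oracle i := i.fn
  size _ := 0

/-- Names in the grid representation. -/
structure GridName (Y : Set (Set ℝ)) : Type where
  set : Set ℝ
  fn : Word → Word
  mem : set ∈ Y
  name : gridRep fn set (fn [])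

/-- The oracles of the grid representation. -/
def gridFamily (Y : Set (Set ℝ)) : Family where
  Idx := GridName Y
  oracle i := i.fn
  size i := (i.fn []).length

section

variable {Y : Set (Set ℝ)} {ρ : SetRep} {E : Set ℝ → Set Word} {ρ' : AdvisedRep}

/-- All names of all sets in `Y` form one oracle family. Uniformity of `FP` in the index is what
makes a single machine serve them all. -/
theorem FP.polyReduces_enrich {f : EnrichedName Y ρ E → Word → Word}
    (hf : FP (enrichFamily Y ρ E) f) (h : ∀ i, ∃ e, ρ' (f i) i.set e) :
    PolyReduces Y (enrich ρ E) ρ' := by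
  obtain ⟨M, τ, t, hM⟩ := hf.exists_machine
  refine ⟨M, τ, t, ?_⟩
  rintro S hS φ e ⟨he, φ₁, hφ₁, rfl⟩
  let i : EnrichedName Y ρ E := ⟨S, φ₁, e, hS, hφ₁, he⟩
  obtain ⟨e', he'⟩ := h i
  exact ⟨f i, e', he', hM i⟩

theorem FP.polyReduces_plain {f : PlainName Y ρ → Word → Word}
    (hf : FP (plainFamily Y ρ) f) (h : ∀ i, ∃ e, ρ' (f i) i.set e) :
    PolyReduces Y (plain ρ) ρ' := by
  obtain ⟨M, τ, t, hM⟩ := hf.exists_machine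
  refine ⟨M, τ, t, ?_⟩
  rintro S hS φ e ⟨rfl, hφ⟩
  let i : PlainName Y ρ := ⟨S, φ, hS, hφ⟩
  obtain ⟨e', he'⟩ := h i
  exact ⟨f i, e', he', hM i⟩

theorem FP.polyReduces_grid {f : GridName Y → Word → Word}
    (hf : FP (gridFamily Y) f) (h : ∀ i, ∃ e, ρ' (f i) i.set e) :
    PolyReduces Y gridRep ρ' := by
  obtain ⟨M, τ, t, hM⟩ := hf.exists_machine
  refine ⟨M, τ, t, ?_⟩
  intro S hS φ e hφ
  obtain rfl : e = φ [] := hφ.1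
  let i : GridName Y := ⟨S, φ, hS, hφ⟩
  obtain ⟨e', he'⟩ := h i
  exact ⟨f i, e', he', hM i⟩

/-- The first component of a name can be queried. -/
theorem FP.ask {f : EnrichedName Y ρ E → α → Word} (hf : FP (enrichFamily Y ρ E) f)
    (P : Polynomial ℕ)
    (hP : ∀ (i : EnrichedName Y ρ E) x, (i.fn (f i x)).length ≤ P.eval (i.adv.length + (enc x).length)) :
    FP (enrichFamily Y ρ E) (fun (i : EnrichedName Y ρ E) x => i.fn (f i x)) := by
  -- The answer comes with a prefix of `|adv|` zeros and a `1`, which accounts for `X + 1`.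
  have h := (FP.oracle (FP.cons (.const false) hf) (Polynomial.X + P + 1) (fun i x => by
    have := hP i x
    simp [enrichFamily, SetReps.pairFuns, SetReps.zeros]
    omega)).afterTrue
  exact h.of_enc_eq fun i x => congrArg enc (afterTrue_eq _ _)

/-- The advice of a name can be computed. -/
theorem FP.adv (w : Word) (P : Polynomial ℕ)
    (hP : ∀ i : EnrichedName Y ρ E, (i.fn w).length ≤ P.eval i.adv.length) :
    FP (enrichFamily Y ρ E) (fun (i : EnrichedName Y ρ E) (_ : α) => i.adv) := by
  -- The advice is padded by as many zeros as `i.fn w` has letters, so it can be read cheaply only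
  -- at a `w` with a short answer.
  have h := (FP.oracle (F := enrichFamily Y ρ E) (FP.const (α := α) (true :: w))
    (Polynomial.X + P + 1) (fun i x => by
    have := (hP i).trans (eval_mono_nat P (show _ ≤ i.adv.length + (enc x).length by omega))
    simp [enrichFamily, SetReps.pairFuns, SetReps.zeros]
    omega)).afterTrue
  exact h.of_enc_eq fun i x => congrArg enc (afterTrue_eq _ _)

theorem PolyReduces.mono_left {ρ₁ ρ₂ : SetRep} (h : ∀ φ S, ρ₁ φ S → ρ₂ φ S)
    (hr : PolyReduces Y (enrich ρ₂ E) ρ') : PolyReduces Y (enrich ρ₁ E) ρ' := by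
  obtain ⟨M, τ, t, hM⟩ := hr
  refine ⟨M, τ, t, ?_⟩
  rintro S hS φ e ⟨he, φ₁, hφ₁, rfl⟩
  exact hM S hS _ e ⟨he, φ₁, h _ _ hφ₁, rfl⟩

theorem PolyReduces.mono_right {ρ₁ ρ₂ : SetRep} {ρ : AdvisedRep} (h : ∀ φ S, ρ₁ φ S → ρ₂ φ S)
    (hr : PolyReduces Y ρ (enrich ρ₁ E)) : PolyReduces Y ρ (enrich ρ₂ E) := by
  obtain ⟨M, τ, t, hM⟩ := hr
  refine ⟨M, τ, t, ?_⟩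
  rintro S hS φ e hφ
  obtain ⟨ψ, e', ⟨he, φ₁, hφ₁, rfl⟩, hψ⟩ := hM S hS φ e hφ
  exact ⟨_, e', ⟨he, φ₁, h _ _ hφ₁, rfl⟩, hψ⟩

end

/-! ## Algorithms based on local information -/

/-- Increase of a precision. -/
def Prec.addNat (n : Prec) (k : ℕ) : Prec := (zeros k ++ n.1, n.2)

@[simp]
theorem Prec.val_addNat (n : Prec) (k : ℕ) : (n.addNat k).val = n.val + k := by
  simp [Prec.addNat, Prec.val, zeros]; ring

theorem FP.addNat {f : F.Idx → α → Prec} (hf : FP F f) (k : ℕ) :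
    FP F (fun i x => (f i x).addNat k) :=
  ((FP.const (SetReps.zeros k)).append hf.fst).pair hf.snd

/-- A test for being close to a set. -/
def LocalTest (S : Set ℝ) (T : Dy → Prec → Bool) : Prop := ∀ x n,
  ((Metric.ball (x.val : ℝ) ((2 : ℝ) ^ (-n.val)) ∩ S).Nonempty → T x n = true) ∧
  (Metric.closedBall (x.val : ℝ) ((2 : ℝ) ^ (-n.val + 1)) ∩ S = ∅ → T x n = false)

/-- The string function of a test. -/
def testFn (T : Dy → Prec → Bool) (s : Word) : Word := [T (pointOf s) (precOf s)]

theorem FP.testFn {T : F.Idx → Dy → Prec → Bool}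
    (hT : FP F (fun i (z : Dy × Prec) => T i z.1 z.2)) : FP F (fun i s => testFn (T i) s) :=
  (hT.comp' ((FP.pointOf FP.id).pair (FP.precOf FP.id))).singleton

theorem LocalTest.setRep {S : Set ℝ} {T : Dy → Prec → Bool} (h : LocalTest S T) :
    setRep (testFn T) S := by
  refine ⟨fun s => ?_, fun q hq n => ?_⟩
  · cases hs : T (pointOf s) (precOf s) <;> simp [testFn, hs]
  · have := h (pointOf (query q n)) (precOf (query q n))
    rw [val_pointOf hq, val_precOf] at this
    exact ⟨fun h1 => by rw [testFn, this.1 h1], fun h1 => by rw [testFn, this.2 h1]⟩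

namespace LocalTest

variable {S : Set ℝ} {T : Dy → Prec → Bool}

theorem exists_mem (h : LocalTest S T) {x : Dy} {n : Prec} (hx : T x n = true) :
    ∃ s ∈ S, |s - x.val| ≤ 2 * (2 : ℝ) ^ (-n.val) := by
  have h1 : (Metric.closedBall (x.val : ℝ) ((2 : ℝ) ^ (-n.val + 1)) ∩ S).Nonempty := by
    rw [Set.nonempty_iff_ne_empty]
    intro h2
    rw [(h x n).2 h2] at hx
    cases hx
  obtain ⟨s, hs, hS⟩ := h1
  refine ⟨s, hS, ?_⟩
  rwa [Metric.mem_closedBall, Real.dist_eq, zpow_add_one₀ (by norm_num), mul_comm] at hs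

theorem eq_true (h : LocalTest S T) {x : Dy} {n : Prec} {s : ℝ} (hs : s ∈ S)
    (hx : |s - x.val| < (2 : ℝ) ^ (-n.val)) : T x n = true :=
  (h x n).1 ⟨s, by rwa [Metric.mem_ball, Real.dist_eq], hs⟩

end LocalTest

/-! ### Distances -/

section Distance

variable (T : Dy → Prec → Bool) (x : Dy)

/-- Whether there is a point at distance about `L * 2 ^ (-m)` from `x`. -/
def hit (m : Prec) (L : Num) : Bool := T (x.add (L, m)) m || T (x.add (Dy.neg (L, m))) m

/-- One refinement of a lower bound `z.1` for the distance. -/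
def distStep (w : Word) (z : Num × Word) : Num × Word :=
  let m : Prec := (false :: z.2, w)
  let L := z.1.double
  (bif hit T x m L then L else
    bif hit T x m (L.add (false, [true])) then L.add (false, [true]) else
    bif hit T x m (L.add (false, [false, true])) then L.add (false, [false, true]) else
    bif hit T x m (L.add (false, [true, true])) then L.add (false, [true, true]) else
    L.add (false, [false, false, true]), false :: z.2)

/-- The approximation of the distance of `x` to a set of radius at most `2 ^ |e|`, with
precision `n`. -/
def distApprox (e : Word) (n : Prec) : Dy :=
  (((n.1 ++ (e ++ (x.1.2 ++ x.2.2))).foldl (fun z _ => distStep T x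
    (n.2 ++ (e ++ (x.1.2 ++ x.2.2))) z) ((false, []), [])).1.add (false, [true]), n)

variable {T x} {S : Set ℝ}

/-- A positive test gives a point of `S` within `2 * 2^(-m)` of `x + L * 2^(-m)` or `x - L *
2^(-m)`; the triangle inequality does the rest. -/
theorem infDist_le_of_hit (h : LocalTest S T) {m : Prec} {L : Num} (hL : 0 ≤ L.val)
    (hh : hit T x m L = true) :
    Metric.infDist (x.val : ℝ) S ≤ (L.val + 2) * (2 : ℝ) ^ (-m.val) := by
  have hv : ((Dy.val (L, m) : ℚ) : ℝ) = L.val * (2 : ℝ) ^ (-m.val) := by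
    simp [Dy.val, zpow_neg, div_eq_mul_inv]
  have h0 : 0 ≤ (L.val : ℝ) * (2 : ℝ) ^ (-m.val) := by positivity
  rw [hit, Bool.or_eq_true] at hh
  rcases hh with hh | hh
  · obtain ⟨s, hs, hd⟩ := h.exists_mem hh
    refine (Metric.infDist_le_dist_of_mem hs).trans ?_
    rw [Dy.val_add, Rat.cast_add, hv] at hd
    rw [Real.dist_eq, abs_le] at *
    constructor <;> linarith
  · obtain ⟨s, hs, hd⟩ := h.exists_mem hh
    refine (Metric.infDist_le_dist_of_mem hs).trans ?_
    rw [Dy.val_add, Dy.val_neg, Rat.cast_add, Rat.cast_neg, hv] at hd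
    rw [Real.dist_eq, abs_le] at *
    constructor <;> linarith

/-- Dimension one enters here. A nearest point `s` lies at distance `d` to the left or right of `x`.
If `L * 2^(-m) ≤ d < (L + 1) * 2^(-m)`, then `s` is within `2^(-m)` of one of the two tested points,
which forces a hit. -/
theorem le_infDist_of_not_hit (h : LocalTest S T) (hS : S ∈ compactSets) {m : Prec} {L : Num}
    (hL : L.val * (2 : ℝ) ^ (-m.val) ≤ Metric.infDist (x.val : ℝ) S)
    (hh : hit T x m L = false) :
    (L.val + 1) * (2 : ℝ) ^ (-m.val) ≤ Metric.infDist (x.val : ℝ) S := by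
  have hv : ((Dy.val (L, m) : ℚ) : ℝ) = L.val * (2 : ℝ) ^ (-m.val) := by
    simp [Dy.val, zpow_neg, div_eq_mul_inv]
  obtain ⟨s, hs, hd⟩ := hS.2.exists_infDist_eq_dist hS.1 (x.val : ℝ)
  rw [hit, Bool.or_eq_false_iff] at hh
  have h1 : ¬ |s - ((x.add (L, m)).val : ℝ)| < (2 : ℝ) ^ (-m.val) := fun h1 => by
    rw [h.eq_true hs h1] at hh; exact absurd hh.1 (by simp)
  have h2 : ¬ |s - ((x.add (Dy.neg (L, m))).val : ℝ)| < (2 : ℝ) ^ (-m.val) := fun h1 => by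
    rw [h.eq_true hs h1] at hh; exact absurd hh.2 (by simp)
  rw [Dy.val_add, Rat.cast_add, hv] at h1
  rw [Dy.val_add, Dy.val_neg, Rat.cast_add, Rat.cast_neg, hv] at h2
  rw [hd, Real.dist_eq] at hL ⊢
  have hp : 0 < (2 : ℝ) ^ (-m.val) := by positivity
  rcases le_total s (x.val : ℝ) with hle | hle
  · rw [abs_of_nonneg (by linarith)] at hL ⊢
    rw [abs_lt, not_and_or] at h2
    rcases h2 with h2 | h2 <;> linarith
  · rw [abs_of_nonpos (by linarith)] at hL ⊢
    rw [abs_lt, not_and_or] at h1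
    rcases h1 with h1 | h1 <;> linarith

/-- In units of the finer scale, the distance lies between `2L` and `2L + 4`. The candidates `2L, …,
2L + 3` are tried in order: each miss raises the lower bound by one, and the first hit gives a
matching upper bound. After four misses the lower bound `2L + 4` has reached the old upper bound. -/
theorem distStep_spec (h : LocalTest S T) (hS : S ∈ compactSets) {w : Word} {z : Num × Word}
    (h0 : 0 ≤ z.1.val)
    (h1 : z.1.val * (2 : ℝ) ^ (-(Prec.val (z.2, w))) ≤ Metric.infDist (x.val : ℝ) S)
    (h2 : Metric.infDist (x.val : ℝ) S ≤ (z.1.val + 2) * (2 : ℝ) ^ (-(Prec.val (z.2, w)))) :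
    let z' := distStep T x w z
    0 ≤ z'.1.val ∧
      z'.1.val * (2 : ℝ) ^ (-(Prec.val (z'.2, w))) ≤ Metric.infDist (x.val : ℝ) S ∧
      Metric.infDist (x.val : ℝ) S ≤ (z'.1.val + 2) * (2 : ℝ) ^ (-(Prec.val (z'.2, w))) := by
  obtain ⟨L, j⟩ := z
  have hm : (2 : ℝ) ^ (-(Prec.val (j, w))) = 2 * (2 : ℝ) ^ (-(Prec.val (false :: j, w))) := by
    have : -(Prec.val (j, w)) = -(Prec.val (false :: j, w)) + 1 := by simp [Prec.val]; ring
    rw [this, zpow_add_one₀ (by norm_num)]; ring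
  rw [hm] at h1 h2
  have hp : 0 < (2 : ℝ) ^ (-(Prec.val (false :: j, w))) := by positivity
  dsimp only at h0 h1 h2
  have v1 : Num.val (false, [true]) = 1 := rfl
  have v2 : Num.val (false, [false, true]) = 2 := rfl
  have v3 : Num.val (false, [true, true]) = 3 := rfl
  have v4 : Num.val (false, [false, false, true]) = 4 := rfl
  have a0 : (L.double.val : ℝ) * (2 : ℝ) ^ (-(Prec.val (false :: j, w))) ≤
      Metric.infDist (x.val : ℝ) S := by rw [Num.val_double]; push_cast; linarith
  have key : ∀ L' : Num, 0 ≤ L'.val → hit T x (false :: j, w) L' = true →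
      (L'.val : ℝ) * (2 : ℝ) ^ (-(Prec.val (false :: j, w))) ≤ Metric.infDist (x.val : ℝ) S →
      0 ≤ L'.val ∧
      L'.val * (2 : ℝ) ^ (-(Prec.val (false :: j, w))) ≤ Metric.infDist (x.val : ℝ) S ∧
      Metric.infDist (x.val : ℝ) S ≤ (L'.val + 2) * (2 : ℝ) ^ (-(Prec.val (false :: j, w))) :=
    fun L' hL' hh hl => ⟨hL', hl, infDist_le_of_hit h hL' hh⟩
  simp only [distStep]
  cases c0 : hit T x (false :: j, w) L.double with
  | true => exact key L.double (by rw [Num.val_double]; omega) c0 a0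
  | false =>
  have a1 := le_infDist_of_not_hit h hS a0 c0
  have b1 : (((L.double.add (false, [true])).val : ℤ) : ℝ) = L.double.val + 1 := by
    rw [Num.val_add, v1]; push_cast; ring
  rw [← b1] at a1
  cases c1 : hit T x (false :: j, w) (L.double.add (false, [true])) with
  | true => exact key (L.double.add (false, [true])) (by rw [Num.val_add, v1, Num.val_double]; omega) c1 a1
  | false =>
  have a2 := le_infDist_of_not_hit h hS a1 c1
  have b2 : (((L.double.add (false, [false, true])).val : ℤ) : ℝ) =
      ((L.double.add (false, [true])).val : ℤ) + 1 := by
    rw [Num.val_add, Num.val_add, v1, v2]; push_cast; ring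
  rw [← b2] at a2
  cases c2 : hit T x (false :: j, w) (L.double.add (false, [false, true])) with
  | true => exact key (L.double.add (false, [false, true])) (by rw [Num.val_add, v2, Num.val_double]; omega) c2 a2
  | false =>
  have a3 := le_infDist_of_not_hit h hS a2 c2
  have b3 : (((L.double.add (false, [true, true])).val : ℤ) : ℝ) =
      ((L.double.add (false, [false, true])).val : ℤ) + 1 := by
    rw [Num.val_add, Num.val_add, v3, v2]; push_cast; ring
  rw [← b3] at a3
  cases c3 : hit T x (false :: j, w) (L.double.add (false, [true, true])) with
  | true => exact key (L.double.add (false, [true, true])) (by rw [Num.val_add, v3, Num.val_double]; omega) c3 a3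
  | false =>
  have a4 := le_infDist_of_not_hit h hS a3 c3
  have b4 : (((L.double.add (false, [false, false, true])).val : ℤ) : ℝ) =
      ((L.double.add (false, [true, true])).val : ℤ) + 1 := by
    rw [Num.val_add, Num.val_add, v3, v4]; push_cast; ring
  rw [← b4] at a4
  refine ⟨?_, a4, ?_⟩
  · simp only [cond_false, Num.val_add, v4, Num.val_double]; omega
  · simp only [cond_false, Num.val_add, v4, Num.val_double]
    push_cast
    nlinarith

theorem abs_dyVal_le (x : Dy) : |(x.val : ℝ)| ≤ 2 ^ (x.1.2 ++ x.2.2).length := by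
  have h1 : (|(x.1.val : ℝ)|) ≤ 2 ^ x.1.2.length := by exact_mod_cast x.1.abs_val_le
  rw [Dy.val_eq, List.length_append, pow_add]
  push_cast
  rw [abs_div, abs_mul, abs_of_pos (show (0 : ℝ) < 2 ^ x.2.2.length by positivity),
    abs_of_pos (show (0 : ℝ) < 2 ^ x.2.1.length by positivity)]
  refine (div_le_self (by positivity) (one_le_pow₀ (by norm_num))).trans ?_
  gcongr

theorem infDist_le_add {b : ℝ} (hS : S.Nonempty) (hb : S ⊆ Metric.closedBall 0 b) (q : ℝ) :
    Metric.infDist q S ≤ |q| + b := by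
  obtain ⟨s, hs⟩ := hS
  have h1 := hb hs
  rw [mem_closedBall_zero_iff, Real.norm_eq_abs] at h1
  refine (Metric.infDist_le_dist_of_mem hs).trans ?_
  rw [Real.dist_eq]
  exact (abs_sub _ _).trans (by linarith)

/-- The word `n.2 ++ (e ++ …)` sets the initial scale: its unit is so large that `d ≤ |x| + 2 ^
e.length` is at most two units, and the search can start with `L = 0`. The rounds cancel the part
that was added and supply `n.1`, ending at precision `n`. The midpoint `L + 1` of the final interval
is then off by at most one unit. -/
theorem distApprox_spec (h : LocalTest S T) (hS : S ∈ compactSets) {e : Word}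
    (he : S ⊆ Metric.closedBall 0 ((2 : ℝ) ^ e.length)) (n : Prec) :
    (distApprox T x e n).val ∈ dyadicsOfPrec (n.val + 1) ∧
    |((distApprox T x e n).val : ℝ) - Metric.infDist (x.val : ℝ) S| ≤ (2 : ℝ) ^ (-n.val) := by
  have key : ∀ (w : Word) (B : Word) (z : Num × Word), 0 ≤ z.1.val →
      z.1.val * (2 : ℝ) ^ (-(Prec.val (z.2, B))) ≤ Metric.infDist (x.val : ℝ) S →
      Metric.infDist (x.val : ℝ) S ≤ (z.1.val + 2) * (2 : ℝ) ^ (-(Prec.val (z.2, B))) →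
      let z' := w.foldl (fun z _ => distStep T x B z) z
      z'.2.length = z.2.length + w.length ∧
      z'.1.val * (2 : ℝ) ^ (-(Prec.val (z'.2, B))) ≤ Metric.infDist (x.val : ℝ) S ∧
      Metric.infDist (x.val : ℝ) S ≤ (z'.1.val + 2) * (2 : ℝ) ^ (-(Prec.val (z'.2, B))) := by
    intro w B
    induction w with
    | nil => exact fun z _ h1 h2 => ⟨by simp, h1, h2⟩
    | cons b w ih =>
      intro z h0 h1 h2
      obtain ⟨g0, g1, g2⟩ := distStep_spec h hS h0 h1 h2
      obtain ⟨i0, i1, i2⟩ := ih _ g0 g1 g2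
      refine ⟨?_, i1, i2⟩
      rw [List.foldl_cons, i0]
      simp [distStep]; omega
  have hd := infDist_le_add hS.1 he (x.val : ℝ)
  have hx := abs_dyVal_le x
  obtain ⟨k0, k1, k2⟩ := key (n.1 ++ (e ++ (x.1.2 ++ x.2.2))) (n.2 ++ (e ++ (x.1.2 ++ x.2.2)))
    ((false, []), []) (by simp [Num.val, natVal])
    (by simpa [Num.val, natVal] using Metric.infDist_nonneg) (by
      have v0 : Num.val (false, []) = 0 := rfl
      have e0 : (2 : ℝ) ^ (-(Prec.val ([], n.2 ++ (e ++ (x.1.2 ++ x.2.2))))) =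
          2 ^ n.2.length * (2 ^ e.length * 2 ^ (x.1.2 ++ x.2.2).length) := by
        rw [← pow_add, ← pow_add, ← List.length_append, ← List.length_append, ← zpow_natCast]
        simp [Prec.val]
      dsimp only
      rw [v0, e0]
      have p1 : (1 : ℝ) ≤ 2 ^ n.2.length := one_le_pow₀ (by norm_num)
      have p2 : (1 : ℝ) ≤ 2 ^ e.length := one_le_pow₀ (by norm_num)
      have p3 : (1 : ℝ) ≤ 2 ^ (x.1.2 ++ x.2.2).length := one_le_pow₀ (by norm_num)
      have p4 : (2 : ℝ) ^ e.length + 2 ^ (x.1.2 ++ x.2.2).length ≤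
          2 * (2 ^ e.length * 2 ^ (x.1.2 ++ x.2.2).length) := by nlinarith
      have p5 : (2 : ℝ) ^ e.length * 2 ^ (x.1.2 ++ x.2.2).length ≤
          2 ^ n.2.length * (2 ^ e.length * 2 ^ (x.1.2 ++ x.2.2).length) :=
        le_mul_of_one_le_left (by positivity) p1
      push_cast
      linarith)
  rw [distApprox]
  generalize (n.1 ++ (e ++ (x.1.2 ++ x.2.2))).foldl (fun z _ => distStep T x
    (n.2 ++ (e ++ (x.1.2 ++ x.2.2))) z) ((false, []), []) = z at *
  have hz : Prec.val (z.2, n.2 ++ (e ++ (x.1.2 ++ x.2.2))) = n.val := by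
    simp only [Prec.val, k0, List.length_append, List.length_nil]; push_cast; ring
  rw [hz] at k1 k2
  have v1 : Num.val (false, [true]) = 1 := rfl
  rw [Dy.val, Num.val_add, v1]
  dsimp only
  -- The value has precision `n`; doubling numerator and denominator exhibits it at precision `n +
  -- 1`.
  refine ⟨⟨2 * (z.1.val + 1), ?_⟩, ?_⟩
  · rw [zpow_add_one₀ (by norm_num)]
    push_cast
    field_simp
  · push_cast
    rw [div_eq_mul_inv, ← zpow_neg, abs_le]
    constructor <;> linarith

end Distance

/-! ### The distance search runs in polynomial time -/

section

variable {T : F.Idx → Dy → Prec → Bool}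

theorem FP.hit {x : F.Idx → α → Dy} {m : F.Idx → α → Prec} {L : F.Idx → α → Num}
    (hT : FP F (fun i (z : Dy × Prec) => T i z.1 z.2)) (hx : FP F x) (hm : FP F m) (hL : FP F L) :
    FP F (fun i a => hit (T i) (x i a) (m i a) (L i a)) :=
  (hT.comp' ((hx.dyAdd (hL.pair hm)).pair hm)).or
    (hT.comp' ((hx.dyAdd (hL.pair hm).dyNeg).pair hm))

theorem FP.distStep {x : F.Idx → α → Dy} {w : F.Idx → α → Word} {z : F.Idx → α → Num × Word}
    (hT : FP F (fun i (z : Dy × Prec) => T i z.1 z.2)) (hx : FP F x) (hw : FP F w) (hz : FP F z) :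
    FP F (fun i a => distStep (T i) (x i a) (w i a) (z i a)) := by
  have hj : FP F (fun i a => false :: (z i a).2) := .cons (.const false) hz.snd
  have hm : FP F (fun i a => ((false :: (z i a).2, w i a) : Prec)) := hj.pair hw
  have hL : FP F (fun i a => (z i a).1.double) := hz.fst.double
  have hc : ∀ u : Word, FP F (fun i a => (z i a).1.double.add (false, u)) := fun u =>
    hL.add (.const (false, u))
  exact (FP.cond (FP.hit hT hx hm hL) hL (FP.cond (FP.hit hT hx hm (hc _)) (hc _)
    (FP.cond (FP.hit hT hx hm (hc _)) (hc _) (FP.cond (FP.hit hT hx hm (hc _)) (hc _)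
      (hc _))))).pair hj

/-- Needed for iteration: the lower bound gains only a constant number of digits per round, one by
doubling and at most four by adding a small constant. -/
theorem length_distStep (T : Dy → Prec → Bool) (x : Dy) (w : Word) (z : Num × Word) :
    (enc (distStep T x w z)).length ≤ (enc z).length + 20 := by
  obtain ⟨⟨s, l⟩, j⟩ := z
  have hc : ∀ u : Word, u.length ≤ 3 →
      (((Num.double (s, l)).add (false, u)).2).length ≤ l.length + 5 := fun u hu => by
    rw [Num.length_add]; simp [Num.double]; omega
  have h0 : ((Num.double (s, l)).2).length ≤ l.length + 5 := by simp [Num.double]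
  have key : ((distStep T x w ((s, l), j)).1.2).length ≤ l.length + 5 := by
    simp only [distStep]
    cases hit T x (false :: j, w) (Num.double (s, l)) with
    | true => exact h0
    | false =>
    cases hit T x (false :: j, w) ((Num.double (s, l)).add (false, [true])) with
    | true => exact hc _ (by simp)
    | false =>
    cases hit T x (false :: j, w) ((Num.double (s, l)).add (false, [false, true])) with
    | true => exact hc _ (by simp)
    | false =>
    cases hit T x (false :: j, w) ((Num.double (s, l)).add (false, [true, true])) with
    | true => exact hc _ (by simp)
    | false => exact hc _ (by simp)
  have k2 : (distStep T x w ((s, l), j)).2 = false :: j := rfl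
  rw [length_enc_prod', length_enc_prod' (distStep T x w ((s, l), j)).1, k2]
  simp only [length_enc_prod, length_enc_bool, length_enc_word, List.length_cons]
  omega

/-- The string function of the distance approximation. -/
def distFn (T : Dy → Prec → Bool) (e s : Word) : Word :=
  (distApprox T (pointOf s) e (precOf s)).code

theorem FP.distFn {e : F.Idx → Word} (hT : FP F (fun i (z : Dy × Prec) => T i z.1 z.2))
    (he : FP F (fun i (_ : Word) => e i)) : FP F (fun i s => distFn (T i) (e i) s) := by
  have hx : FP F (fun _ s => SetReps.pointOf s) := .pointOf .id
  have hn : FP F (fun _ s => SetReps.precOf s) := .precOf .id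
  have hw := he.append (hx.fst.snd.append hx.snd.snd)
  have hs : FP F (fun i (z : Word × (Num × Word) × Bool) => SetReps.distStep (T i)
      (SetReps.pointOf z.1) ((SetReps.precOf z.1).2 ++ (e i ++ ((SetReps.pointOf z.1).1.2 ++
        (SetReps.pointOf z.1).2.2))) z.2.1) :=
    FP.distStep hT (hx.comp' FP.id.fst) ((hn.snd.append hw).comp' FP.id.fst) FP.id.snd.fst
  have hf := FP.foldl (hn.fst.append hw) (.const ((false, []), []))
    (g := fun i s (z : Num × Word) _ => SetReps.distStep (T i)
      (SetReps.pointOf s) ((SetReps.precOf s).2 ++ (e i ++ ((SetReps.pointOf s).1.2 ++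
        (SetReps.pointOf s).2.2))) z) hs 20 (fun i s z b => by
        simpa using length_distStep _ _ _ _)
  exact ((hf.fst.add (.const (false, [true]))).pair hn).dyCode

theorem distRep_distFn {S : Set ℝ} {T : Dy → Prec → Bool} (h : LocalTest S T)
    (hS : S ∈ compactSets) {e : Word} (he : S ⊆ Metric.closedBall 0 ((2 : ℝ) ^ e.length)) :
    distRep (distFn T e) S := by
  intro q hq n
  have := distApprox_spec (x := pointOf (query q n)) h hS he (precOf (query q n))
  rw [val_pointOf hq, val_precOf] at this
  exact ⟨_, this.1, Dy.code_eq _, this.2⟩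

end

/-! ### Grids -/

section Grid

/-- The string function of a grid. -/
def gridFn (T : Dy → Prec → Bool) (e s : Word) : Word :=
  let x := pointOf s
  let n := precOf s
  bif s.isEmpty then e else
    [x.isMultiple n && (T x (n.addNat 1) ||
      T (x.add ((false, [true]), n.addNat 1)) (n.addNat 2))]

theorem FP.gridFn {T : F.Idx → Dy → Prec → Bool} {e : F.Idx → Word}
    (hT : FP F (fun i (z : Dy × Prec) => T i z.1 z.2)) (he : FP F (fun i (_ : Word) => e i)) :
    FP F (fun i s => gridFn (T i) (e i) s) := by
  have hx : FP F (fun _ s => SetReps.pointOf s) := .pointOf .id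
  have hn : FP F (fun _ s => SetReps.precOf s) := .precOf .id
  exact .cond (.isEmpty .id) he ((hx.isMultiple hn).and ((hT.comp' (hx.pair (hn.addNat 1))).or
    (hT.comp' ((hx.dyAdd ((FP.const (false, [true])).pair (hn.addNat 1))).pair
      (hn.addNat 2))))).singleton

theorem query_ne_nil (q : ℚ) (n : ℤ) : query q n ≠ [] := by
  simp [query, pairWords]

/-- In units of `2^(-n)`, a test of radius `1/2` about a grid point keeps any point of `S` it finds
within `1`, but the open balls miss the midpoints between grid points. A second test of radius `1/4`
about the midpoint to the right closes the gap and still guarantees distance `1/2 + 2 * 1/4 = 1`.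
For coverage, let `t = x * 2^n`: a fractional part below `1/2` is caught by the first test at `⌊t⌋`,
one in `[1/2, 3/4)` by the second test there, and a larger one by the first test at `⌊t⌋ + 1`. -/
theorem gridRep_gridFn {S : Set ℝ} {T : Dy → Prec → Bool} (h : LocalTest S T) {e : Word}
    (he : S ⊆ Metric.closedBall 0 ((2 : ℝ) ^ ofUnaryInt e)) :
    gridRep (gridFn T e) S e := by
  have h0 : gridFn T e [] = e := rfl
  have h1 : ∀ s, s ≠ [] → gridFn T e s = [(pointOf s).isMultiple (precOf s) &&
      (T (pointOf s) ((precOf s).addNat 1) ||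
        T ((pointOf s).add ((false, [true]), (precOf s).addNat 1)) ((precOf s).addNat 2))] := by
    intro s hs
    cases s with
    | nil => exact absurd rfl hs
    | cons b s => rfl
  refine ⟨h0.symm, fun s hs => ?_, by rwa [h0],
    fun n => {q | q ∈ dyadics ∧ gridFn T e (query q n) = [true]}, fun n => ⟨?_, ?_, ?_, ?_⟩⟩
  · rw [h1 s hs]
    generalize (_ && _) = b
    cases b <;> simp
  · rintro q ⟨hq, hg⟩
    rw [h1 _ (query_ne_nil q n), List.singleton_inj, Bool.and_eq_true, Dy.isMultiple_iff,
      val_pointOf hq, val_precOf] at hg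
    exact hg.1
  · intro q hq
    refine ⟨fun hB => hB.2, fun hB => ?_⟩
    have hB' : gridFn T e (query q n) ≠ [true] := fun h' => hB ⟨hq, h'⟩
    rw [h1 _ (query_ne_nil q n)] at hB' ⊢
    simpa using hB'
  · intro x hx
    have hp : (0 : ℝ) < 2 ^ (-n) := by positivity
    have e1 : (2 : ℝ) ^ (-(n + 1)) = 2 ^ (-n) / 2 := by
      rw [neg_add, zpow_add₀ (by norm_num)]; norm_num; ring
    have e2 : (2 : ℝ) ^ (-(n + 2)) = 2 ^ (-n) / 4 := by
      rw [neg_add, zpow_add₀ (by norm_num)]; norm_num; ring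
    have hm : ∀ a : ℤ, ((a / 2 ^ n : ℚ) : ℝ) = a * (2 : ℝ) ^ (-n) := by
      intro a; push_cast; rw [zpow_neg, div_eq_mul_inv]
    have hmem : ∀ a : ℤ, (a / 2 ^ n : ℚ) ∈ dyadics := fun a => Set.mem_iUnion.2 ⟨n, a, rfl⟩
    have hgrid : ∀ a : ℤ, |x - a * (2 : ℝ) ^ (-n)| < 2 ^ (-n) / 2 ∨
        |x - (a + 1 / 2) * (2 : ℝ) ^ (-n)| < 2 ^ (-n) / 4 →
        gridFn T e (query (a / 2 ^ n : ℚ) n) = [true] := by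
      intro a ha
      rw [h1 _ (query_ne_nil _ n), List.singleton_inj, Bool.and_eq_true, Dy.isMultiple_iff,
        val_pointOf (hmem a), val_precOf, Bool.or_eq_true]
      refine ⟨⟨a, rfl⟩, ha.imp (fun ha => h.eq_true hx ?_) (fun ha => h.eq_true hx ?_)⟩
      · rw [val_pointOf (hmem a), Prec.val_addNat, val_precOf, Nat.cast_one, e1, hm]
        exact ha
      · have v1 : Num.val (false, [true]) = 1 := rfl
        rw [Dy.val_add, val_pointOf (hmem a), Prec.val_addNat, val_precOf, Nat.cast_ofNat, e2,
          Rat.cast_add, hm, Dy.val, v1, Prec.val_addNat, val_precOf, Nat.cast_one]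
        have : (((1 : ℤ) / 2 ^ (n + 1) : ℚ) : ℝ) = 1 / 2 * 2 ^ (-n) := by
          rw [zpow_add_one₀ (by norm_num), zpow_neg]; push_cast; field_simp
        rw [this, ← add_mul]
        exact ha
    set t := x * (2 : ℝ) ^ n with ht
    have hxt : x = t * (2 : ℝ) ^ (-n) := by rw [ht, zpow_neg]; field_simp
    have f1 := Int.floor_le t
    have f2 := Int.lt_floor_add_one t
    have habs : ∀ c d : ℝ, |t - c| < d → |x - c * (2 : ℝ) ^ (-n)| < d * 2 ^ (-n) := by
      intro c d hcd
      rw [hxt, ← sub_mul, abs_mul, abs_of_pos hp]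
      exact mul_lt_mul_of_pos_right hcd hp
    rcases lt_or_ge (t - ⌊t⌋) (3 / 4) with hlt | hge
    · refine ⟨(⌊t⌋ / 2 ^ n : ℚ), ⟨hmem _, hgrid _ ?_⟩, ?_⟩
      · rcases lt_or_ge (t - ⌊t⌋) (1 / 2) with hlt' | hge'
        · left
          have := habs ⌊t⌋ (1 / 2) (by rw [abs_lt]; constructor <;> linarith)
          linarith
        · right
          have := habs (⌊t⌋ + 1 / 2) (1 / 4) (by rw [abs_lt]; constructor <;> linarith)
          linarith
      · rw [hm, abs_sub_comm]
        have := habs ⌊t⌋ 1 (by rw [abs_lt]; constructor <;> linarith)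
        linarith
    · refine ⟨((⌊t⌋ + 1 : ℤ) / 2 ^ n : ℚ), ⟨hmem _, hgrid _ (Or.inl ?_)⟩, ?_⟩
      · have := habs (⌊t⌋ + 1 : ℤ) (1 / 2) (by push_cast; rw [abs_lt]; constructor <;> linarith)
        linarith
      · rw [hm, abs_sub_comm]
        have := habs (⌊t⌋ + 1 : ℤ) 1 (by push_cast; rw [abs_lt]; constructor <;> linarith)
        linarith
  · rintro q ⟨hq, hg⟩
    have hp : (0 : ℝ) < 2 ^ (-n) := by positivity
    have e1 : (2 : ℝ) ^ (-(n + 1)) = 2 ^ (-n) / 2 := by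
      rw [neg_add, zpow_add₀ (by norm_num)]; norm_num; ring
    have e2 : (2 : ℝ) ^ (-(n + 2)) = 2 ^ (-n) / 4 := by
      rw [neg_add, zpow_add₀ (by norm_num)]; norm_num; ring
    rw [h1 _ (query_ne_nil _ n), List.singleton_inj, Bool.and_eq_true, Bool.or_eq_true] at hg
    rcases hg.2 with hg | hg
    · obtain ⟨s, hs, hd⟩ := h.exists_mem hg
      rw [val_pointOf hq, Prec.val_addNat, val_precOf, Nat.cast_one, e1] at hd
      refine ⟨s, hs, ?_⟩
      rw [abs_sub_comm]
      linarith
    · obtain ⟨s, hs, hd⟩ := h.exists_mem hg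
      have v1 : Num.val (false, [true]) = 1 := rfl
      rw [Dy.val_add, val_pointOf hq, Prec.val_addNat, val_precOf, Nat.cast_ofNat, e2,
        Rat.cast_add, Dy.val, v1, Prec.val_addNat, val_precOf, Nat.cast_one] at hd
      have : (((1 : ℤ) / 2 ^ (n + 1) : ℚ) : ℝ) = 1 / 2 * 2 ^ (-n) := by
        rw [zpow_add_one₀ (by norm_num), zpow_neg]; push_cast; field_simp
      rw [this, abs_le] at hd
      refine ⟨s, hs, ?_⟩
      rw [abs_le]
      constructor <;> linarith

end Grid

/-! ## Local tests from names -/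

theorem le_length_unaryInt (b : ℤ) : b ≤ (unaryInt b).length := by
  cases b with
  | ofNat k => rw [Int.ofNat_eq_natCast, unaryInt_natCast]; simp [zeros]; omega
  | negSucc k => rw [unaryInt_negSucc]; simp [zeros]; omega

theorem ofUnaryInt_unaryInt (b : ℤ) : ofUnaryInt (unaryInt b) = b := by
  simp [ofUnaryInt, unaryInt, zeros]

/-- The unary code of `b` has length at least `b`, so this length can replace `b`, which may be
negative, as an exponent. -/
theorem subset_closedBall_of_outerRadius {S : Set ℝ} {e : Word} (he : e ∈ outerRadius S) :
    S ⊆ Metric.closedBall 0 ((2 : ℝ) ^ e.length) := by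
  obtain ⟨b, hb, rfl⟩ := he
  refine hb.trans (Metric.closedBall_subset_closedBall ?_)
  rw [← zpow_natCast]
  exact zpow_le_zpow_right₀ (by norm_num) (le_length_unaryInt b)

/-- The test of a predicate on query words. -/
def predTest (φ : Word → Word) (x : Dy) (n : Prec) : Bool := (φ (queryWord x n)).headD false

theorem predTest_eq_true {φ : Word → Word} {x : Dy} {n : Prec}
    (h : φ (query x.val n.val) = [true]) : predTest φ x n = true := by
  rw [predTest, queryWord_eq, h]; rfl

theorem predTest_eq_false {φ : Word → Word} {x : Dy} {n : Prec}
    (h : φ (query x.val n.val) = [false]) : predTest φ x n = false := by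
  rw [predTest, queryWord_eq, h]; rfl

theorem localTest_of_setRep {φ : Word → Word} {S : Set ℝ} (h : setRep φ S) :
    LocalTest S (predTest φ) := fun x _ =>
  ⟨fun h1 => predTest_eq_true ((h.2 _ x.val_mem _).1 h1),
    fun h1 => predTest_eq_false ((h.2 _ x.val_mem _).2 h1)⟩

theorem IsPredicate.length {φ : Word → Word} (h : IsPredicate φ) (s : Word) :
    (φ s).length = 1 := by
  rcases h s with h | h <;> rw [h] <;> rfl

section Predicate

variable {Y : Set (Set ℝ)} {ρ : SetRep} {E : Set ℝ → Set Word}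

theorem FP.ask_predicate (hρ : ∀ φ S, ρ φ S → IsPredicate φ)
    {f : EnrichedName Y ρ E → α → Word} (hf : FP (enrichFamily Y ρ E) f) :
    FP (enrichFamily Y ρ E) (fun (i : EnrichedName Y ρ E) x => i.fn (f i x)) :=
  FP.ask hf 1 fun i x => by rw [(hρ _ _ i.name).length]; simp

theorem FP.adv_predicate (hρ : ∀ φ S, ρ φ S → IsPredicate φ) :
    FP (enrichFamily Y ρ E) (fun (i : EnrichedName Y ρ E) (_ : α) => i.adv) :=
  FP.adv [] 1 fun i => by rw [(hρ _ _ i.name).length]; simp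

theorem FP.predTest (hρ : ∀ φ S, ρ φ S → IsPredicate φ) :
    FP (enrichFamily Y ρ E) (fun (i : EnrichedName Y ρ E) (z : Dy × Prec) =>
      SetReps.predTest i.fn z.1 z.2) :=
  (FP.ask_predicate hρ (FP.queryWord FP.id.fst FP.id.snd)).head

end Predicate

/-! ### Relative distances -/

/-- The local test of a relative distance function. -/
def relTest (φ : Word → Word) (x : Dy) (n : Prec) : Bool :=
  (((Dy.decode (φ (queryWord x (n.addNat 4)))).floorAt (n.addNat 3)).add
    (true, [false, true, false, true])).1

/-- At scale `2^(-n-3)` the threshold is the integer `11`, and a number is below an integer exactly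
when its floor is; the sign of the floor minus `11` therefore decides. -/
theorem relTest_eq_true_iff {φ : Word → Word} {x : Dy} {n : Prec} {v : ℚ} (hv : v ∈ dyadics)
    (h : φ (query x.val (n.val + 4)) = dyadicCode v) :
    relTest φ x n = true ↔ (v : ℝ) < 11 / 8 * (2 : ℝ) ^ (-n.val) := by
  have v11 : Num.val (true, [false, true, false, true]) = -11 := rfl
  rw [relTest, Num.val_neg_iff, Num.val_add, v11, Dy.val_floorAt, queryWord_eq, Prec.val_addNat,
    Nat.cast_ofNat, h, Dy.val_decode hv, Prec.val_addNat, Nat.cast_ofNat]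
  have h1 : ⌊v * 2 ^ (n.val + 3)⌋ + -11 < 0 ↔ v * 2 ^ (n.val + 3) < (11 : ℤ) := by
    rw [← Int.floor_lt]; omega
  rw [h1, zpow_add₀ (by norm_num), zpow_neg, ← div_eq_mul_inv, lt_div_iff₀ (by positivity)]
  have h2 : v * (2 ^ n.val * 2 ^ (3 : ℤ)) < ((11 : ℤ) : ℚ) ↔ v * 2 ^ n.val < 11 / 8 := by
    norm_num
    constructor <;> intro h <;> linarith
  rw [h2]
  have h3 : ((v * 2 ^ n.val : ℚ) : ℝ) < ((11 / 8 : ℚ) : ℝ) ↔ v * 2 ^ n.val < 11 / 8 := Rat.cast_lt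
  rw [← h3]
  push_cast
  rfl

/-- In units of `2^(-n)`, with absolute error `1/16`: a distance below `1` gives a value below `5/4
+ 1/16 = 21/16`, and a distance above `2` gives a value above `3/2 - 1/16 = 23/16`. The threshold
`11/8 = 22/16` lies between. -/
theorem localTest_of_relDistRep {φ : Word → Word} {S : Set ℝ} (h : relDistRep φ S)
    (hS : S ∈ compactSets) : LocalTest S (relTest φ) := by
  intro x n
  obtain ⟨v, hv, hφ, h1, h2⟩ := h x.val x.val_mem (n.val + 4)
  have hv' : v ∈ dyadics := Set.mem_iUnion.2 ⟨_, hv⟩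
  have hp : (0 : ℝ) < 2 ^ (-n.val) := by positivity
  have e1 : (2 : ℝ) ^ (-(n.val + 4)) = 2 ^ (-n.val) / 16 := by
    rw [neg_add, zpow_add₀ (by norm_num)]; norm_num; ring
  rw [e1] at h1 h2
  refine ⟨?_, fun he => ?_⟩
  · rintro ⟨s, hs, hsS⟩
    rw [relTest_eq_true_iff hv' hφ]
    have := Metric.infDist_le_dist_of_mem (x := (x.val : ℝ)) hsS
    rw [Metric.mem_ball, dist_comm] at hs
    linarith
  · rw [← Bool.not_eq_true, relTest_eq_true_iff hv' hφ, not_lt]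
    obtain ⟨s, hsS, hd⟩ := hS.2.exists_infDist_eq_dist hS.1 (x.val : ℝ)
    have : ¬ dist s (x.val : ℝ) ≤ (2 : ℝ) ^ (-n.val + 1) := fun hc => by
      have : s ∈ Metric.closedBall (x.val : ℝ) ((2 : ℝ) ^ (-n.val + 1)) ∩ S := ⟨hc, hsS⟩
      rw [he] at this
      exact this
    rw [dist_comm, ← hd, zpow_add_one₀ (by norm_num), not_le] at this
    linarith

/-- In lowest terms the denominator is at most `2 ^ M`, so the numerator is at most `2 ^ (N + M)` in
absolute value. Pairing doubles the letters of the numerator, and the unary exponent adds at most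
`M`. -/
theorem length_dyadicCode_le {v : ℚ} {m : ℤ} {N M : ℕ} (hv : v ∈ dyadicsOfPrec m) (hm : m ≤ M)
    (hN : |(v : ℝ)| ≤ 2 ^ N) : (dyadicCode v).length ≤ 2 * N + 3 * M + 6 := by
  obtain ⟨a, rfl⟩ := hv
  obtain ⟨j, hj, hlog, hq⟩ := exists_reduced
    (show (a / 2 ^ m : ℚ) ∈ dyadics from Set.mem_iUnion.2 ⟨m, a, rfl⟩)
  have hjM : j ≤ M := by
    have : (a / 2 ^ m : ℚ) = Rat.divInt (a * 2 ^ (M - m).toNat) (2 ^ M) := by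
      rw [Rat.divInt_eq_div]
      push_cast
      have h1 : (2 : ℚ) ^ (M - m).toNat = 2 ^ M / 2 ^ m := by
        rw [← zpow_natCast, Int.toNat_of_nonneg (by omega), zpow_sub₀ (by norm_num), zpow_natCast]
      rw [h1]
      field_simp
    have h2 := Rat.den_dvd (a * 2 ^ (M - m).toNat) (2 ^ M)
    rw [← this, hj] at h2
    exact (Nat.pow_dvd_pow_iff_le_right (x := 2) (by norm_num)).1 (by exact_mod_cast h2)
  generalize (a / 2 ^ m : ℚ) = v at *
  have hnum : v.num.natAbs ≤ 2 ^ (N + M) := by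
    have h1 : |(v.num : ℝ)| ≤ 2 ^ N * 2 ^ j := by
      have h2 : (v.num : ℝ) = v * 2 ^ j := by
        have : (v.num : ℚ) = v * 2 ^ j := by conv_rhs => rw [hq]; field_simp
        exact_mod_cast this
      rw [h2, abs_mul, abs_of_pos (show (0 : ℝ) < 2 ^ j by positivity)]
      gcongr
    have h3 : ((v.num.natAbs : ℕ) : ℝ) ≤ ((2 ^ (N + M) : ℕ) : ℝ) := by
      rw [Nat.cast_natAbs, Int.cast_abs]
      refine h1.trans ?_
      push_cast
      rw [pow_add]
      gcongr
      norm_num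
    exact_mod_cast h3
  have hb : (binaryInt v.num).length ≤ N + M + 2 := by
    rw [binaryInt, Nat.size_eq_bits_len, Nat.size_le]
    have : Equiv.intEquivNat v.num ≤ 2 * v.num.natAbs := by
      cases v.num with
      | ofNat k => change 2 * k ≤ _; simp
      | negSucc k => change 2 * k + 1 ≤ _; simp; try omega
    have h4 : 0 < 2 ^ (N + M) := by positivity
    rw [pow_add 2 (N + M) 2]
    omega
  rw [dyadicCode, length_pairWords, hlog]
  simp [zeros]
  omega

/-- Names in the relative distance representation with outer radius. -/
abbrev RelName : Type := EnrichedName compactSets relDistRep outerRadius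

/-- The outer radius bounds the answers: `d ≤ |x| + 2 ^ adv.length`, so a correct value has linearly
many digits in the sizes of advice and query. -/
theorem RelName.length_le (i : RelName) (x : Dy) (n : Prec) :
    (i.fn (queryWord x n)).length ≤ 9 * (i.adv.length + (enc (x, n)).length) + 20 := by
  obtain ⟨v, hv, hφ, h1, h2⟩ := i.name x.val x.val_mem n.val
  rw [queryWord_eq, hφ]
  have hd := infDist_le_add i.mem.1 (subset_closedBall_of_outerRadius i.adv_mem) (x.val : ℝ)
  have hx := abs_dyVal_le x
  have hd0 : 0 ≤ Metric.infDist (x.val : ℝ) i.set := Metric.infDist_nonneg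
  have hn : (2 : ℝ) ^ (-n.val) ≤ 2 ^ n.2.length := by
    rw [← zpow_natCast]
    exact zpow_le_zpow_right₀ (by norm_num) (by simp [Prec.val])
  have hN : |(v : ℝ)| ≤ 2 ^ ((x.1.2 ++ x.2.2).length + i.adv.length + n.2.length + 2) := by
    have p1 : (1 : ℝ) ≤ 2 ^ (x.1.2 ++ x.2.2).length := one_le_pow₀ (by norm_num)
    have p2 : (1 : ℝ) ≤ 2 ^ i.adv.length := one_le_pow₀ (by norm_num)
    have p3 : (1 : ℝ) ≤ 2 ^ n.2.length := one_le_pow₀ (by norm_num)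
    rw [pow_add, pow_add, pow_add]
    generalize (2 : ℝ) ^ (x.1.2 ++ x.2.2).length = A at *
    generalize (2 : ℝ) ^ i.adv.length = B at *
    generalize (2 : ℝ) ^ n.2.length = C at *
    have q1 : A + B ≤ 2 * (A * B) := by nlinarith
    have q2 : A * B ≤ A * B * C := le_mul_of_one_le_right (by positivity) p3
    have q3 : C ≤ A * B * C := le_mul_of_one_le_left (by positivity) (by nlinarith)
    rw [abs_le]
    constructor <;> linarith
  refine (length_dyadicCode_le (M := n.1.length + 1) hv (by simp [Prec.val]) hN).trans ?_
  rw [length_enc_prod, length_enc_prod' x, length_enc_prod' x.1, length_enc_prod' x.2,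
    length_enc_prod' n]
  simp only [length_enc_word, length_enc_bool, List.length_append]
  omega

theorem FP.relTest : FP (enrichFamily compactSets relDistRep outerRadius)
    (fun (i : RelName) (z : Dy × Prec) => SetReps.relTest i.fn z.1 z.2) := by
  have hq : FP (enrichFamily compactSets relDistRep outerRadius)
      (fun (i : RelName) (z : Dy × Prec) => i.fn (SetReps.queryWord z.1 z.2)) :=
    FP.ask (.queryWord FP.id.fst FP.id.snd) (9 * Polynomial.X + 20) fun i z => by
      have := RelName.length_le i z.1 z.2
      simpa using this
  exact (((hq.comp' (FP.id.fst.pair (FP.id.snd.addNat 4))).dyDecode.floorAt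
    (FP.id.snd.addNat 3)).add (.const _)).fst

theorem FP.relAdv : FP (enrichFamily compactSets relDistRep outerRadius)
    (fun (i : RelName) (_ : α) => i.adv) :=
  FP.adv (SetReps.queryWord ((false, []), [], []) ([], [])) (9 * Polynomial.X + 200) fun i => by
    have := RelName.length_le i ((false, []), [], []) ([], [])
    refine this.trans ?_
    simp; omega

/-! ### Grids -/

theorem FP.any {ι : Type} {g : F.Idx → α → ι → Bool} (cs : List ι)
    (h : ∀ c, FP F (fun i x => g i x c)) : FP F (fun i x => cs.any (g i x)) := by
  induction cs with
  | nil => exact FP.const false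
  | cons c cs ih => exact (h c).or ih

/-- The local test of a grid. -/
def gridTest (φ : Word → Word) (x : Dy) (n : Prec) : Bool :=
  [((true, [true]) : Num), (true, []), (false, []), (false, [true]), (false, [false, true]),
    (false, [true, true])].any fun c =>
      predTest φ ((x.floorAt (n.addNat 1)).add c, n.addNat 1) (n.addNat 1)

/-- Let `h = 2^(-n-1)`. A point of `S` at distance below `2h` from `x` has a point of the grid set
within `h`, hence at distance below `3h` from `x`; its numerator differs from the floor of `x / h`
by an integer from `-2` to `3`. Conversely each of these six candidates is within `3h` of `x`, so a
marked one puts a point of `S` within `4h = 2^(-n+1)`. -/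
theorem localTest_of_gridRep {φ : Word → Word} {S : Set ℝ} (h : gridRep φ S (φ [])) :
    LocalTest S (gridTest φ) := by
  obtain ⟨-, -, -, B, hB⟩ := h
  intro x n
  obtain ⟨hB1, hB2, hB3, hB4⟩ := hB (n.val + 1)
  have hm : (n.addNat 1).val = n.val + 1 := by simp
  set h := (2 : ℝ) ^ (-(n.val + 1)) with hh
  have hp : 0 < h := by positivity
  have e1 : (2 : ℝ) ^ (-n.val) = 2 * h := by
    rw [hh, neg_add, zpow_add₀ (by norm_num)]; norm_num; ring
  have e2 : (2 : ℝ) ^ (-n.val + 1) = 4 * h := by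
    rw [zpow_add_one₀ (by norm_num), e1]; ring
  have hx : (x.val : ℝ) = (x.val * 2 ^ (n.val + 1) : ℚ) * h := by
    rw [hh, zpow_neg]; push_cast; field_simp
  have hv : ∀ a : Num, ((Dy.val (a, n.addNat 1) : ℚ) : ℝ) = Num.val a * h := fun a => by
    rw [Dy.val, hm, hh, zpow_neg]; push_cast; rw [div_eq_mul_inv]
  have hf := Dy.val_floorAt x (n.addNat 1)
  rw [hm] at hf
  set t := x.val * 2 ^ (n.val + 1) with ht
  have f1 : ((⌊t⌋ : ℤ) : ℝ) ≤ (t : ℝ) := by exact_mod_cast Int.floor_le t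
  have f2 : (t : ℝ) < (⌊t⌋ : ℤ) + 1 := by exact_mod_cast Int.lt_floor_add_one t
  have v0 : Num.val (true, [true]) = -2 := rfl
  have v1 : Num.val (true, []) = -1 := rfl
  have v2 : Num.val (false, []) = 0 := rfl
  have v3 : Num.val (false, [true]) = 1 := rfl
  have v4 : Num.val (false, [false, true]) = 2 := rfl
  have v5 : Num.val (false, [true, true]) = 3 := rfl
  constructor
  · rintro ⟨s, hs, hsS⟩
    rw [Metric.mem_ball, Real.dist_eq, e1] at hs
    obtain ⟨p, hpB, hps⟩ := hB3 s hsS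
    obtain ⟨a, ha⟩ := hB1 hpB
    have hpa : (p : ℝ) = a * h := by
      rw [ha, hh, zpow_neg]; push_cast; rw [div_eq_mul_inv]
    have hclose : |(a : ℝ) - t| < 3 := by
      have h1 : |(a : ℝ) - t| * h < 3 * h := by
        rw [← abs_of_pos hp, ← abs_mul, abs_of_pos hp, sub_mul, ← hpa, ← hx]
        rw [abs_lt] at *
        rw [abs_le] at hps
        constructor <;> linarith
      exact lt_of_mul_lt_mul_right h1 hp.le
    rw [abs_lt] at hclose
    have g1 : (-3 : ℤ) < a - ⌊t⌋ := by
      have : ((-3 : ℤ) : ℝ) < ((a - ⌊t⌋ : ℤ) : ℝ) := by push_cast; linarith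
      exact_mod_cast this
    have g2 : a - ⌊t⌋ < 4 := by
      have : ((a - ⌊t⌋ : ℤ) : ℝ) < ((4 : ℤ) : ℝ) := by push_cast; linarith
      exact_mod_cast this
    have hp' : p ∈ dyadics := Set.mem_iUnion.2 ⟨_, hB1 hpB⟩
    have hq := (hB2 p hp').1 hpB
    rw [gridTest, List.any_eq_true]
    have key : ∀ c : Num, Num.val c = a - ⌊t⌋ →
        predTest φ ((x.floorAt (n.addNat 1)).add c, n.addNat 1) (n.addNat 1) = true := by
      intro c hc
      refine predTest_eq_true ?_
      rw [hm, Dy.val, Num.val_add, hf, hc, hm, add_sub_cancel, ← ha]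
      exact hq
    obtain hc | hc | hc | hc | hc | hc : a - ⌊t⌋ = -2 ∨ a - ⌊t⌋ = -1 ∨ a - ⌊t⌋ = 0 ∨
      a - ⌊t⌋ = 1 ∨ a - ⌊t⌋ = 2 ∨ a - ⌊t⌋ = 3 := by omega
    · exact ⟨_, by simp, key _ (v0.trans hc.symm)⟩
    · exact ⟨(true, []), by simp, key _ (v1.trans hc.symm)⟩
    · exact ⟨(false, []), by simp, key _ (v2.trans hc.symm)⟩
    · exact ⟨(false, [true]), by simp, key _ (v3.trans hc.symm)⟩
    · exact ⟨(false, [false, true]), by simp, key _ (v4.trans hc.symm)⟩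
    · exact ⟨(false, [true, true]), by simp, key _ (v5.trans hc.symm)⟩
  · intro he
    rw [← Bool.not_eq_true, gridTest, List.any_eq_true]
    rintro ⟨c, hc, hT⟩
    have hcv : -2 ≤ Num.val c ∧ Num.val c ≤ 3 := by
      simp only [List.mem_cons, List.not_mem_nil, or_false] at hc
      rcases hc with rfl | rfl | rfl | rfl | rfl | rfl
      · rw [v0]; omega
      · rw [v1]; omega
      · rw [v2]; omega
      · rw [v3]; omega
      · rw [v4]; omega
      · rw [v5]; omega
    have hmem := Dy.val_mem ((x.floorAt (n.addNat 1)).add c, n.addNat 1)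
    by_cases hin : Dy.val ((x.floorAt (n.addNat 1)).add c, n.addNat 1) ∈ B (n.val + 1)
    · obtain ⟨s, hs, hd⟩ := hB4 _ hin
      have : s ∈ Metric.closedBall (x.val : ℝ) ((2 : ℝ) ^ (-n.val + 1)) ∩ S := by
        refine ⟨?_, hs⟩
        rw [Metric.mem_closedBall, Real.dist_eq, e2]
        rw [hv, Num.val_add, hf, abs_le] at hd
        have c1 : (-2 : ℝ) ≤ Num.val c := by exact_mod_cast hcv.1
        have c2 : (Num.val c : ℝ) ≤ 3 := by exact_mod_cast hcv.2
        push_cast at hd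
        rw [hx, abs_le]
        constructor <;> nlinarith
      rw [he] at this
      exact this
    · rw [predTest_eq_false (by rw [hm]; exact (hB2 _ hmem).2 hin)] at hT
      cases hT

theorem GridName.length_le {Y : Set (Set ℝ)} (i : GridName Y) (w : Word) :
    (i.fn w).length ≤ (i.fn []).length + 1 := by
  by_cases h : w = []
  · rw [h]; omega
  · rcases i.name.2.1 w h with h | h <;> rw [h] <;> simp

theorem FP.gridTest {Y : Set (Set ℝ)} : FP (gridFamily Y)
    (fun (i : GridName Y) (z : Dy × Prec) => SetReps.gridTest i.fn z.1 z.2) := by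
  have hm : FP (gridFamily Y) (fun (i : GridName Y) (z : Dy × Prec) => z.2.addNat 1) :=
    FP.id.snd.addNat 1
  refine FP.any _ fun c => (FP.oracle (FP.queryWord
    (((FP.id.fst.floorAt hm).add (.const c)).pair hm) hm) (Polynomial.X + 1) fun i z => ?_).head
  refine (GridName.length_le (Y := Y) i _).trans ?_
  simp [gridFamily]

/-- The word `φ(ε)` counts only through its length and may contain ones; the zeros of equal length
are the genuine unary code. -/
theorem FP.gridAdv {Y : Set (Set ℝ)} : FP (gridFamily Y)
    (fun (i : GridName Y) (_ : α) => SetReps.zeros (i.fn []).length) :=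
  (FP.oracle (F := gridFamily Y) (.const []) Polynomial.X fun i z => by
    simp [gridFamily]).zeros

/-! ### Weak membership -/

/-- The local test of a weak membership function of a convex set with an inner ball. -/
def convexTest (φ : Word → Word) (a : Dy) (r : Prec) (x : Dy) (n : Prec) : Bool :=
  let y : Dy := ((false, [true, true]), n.addNat 1)
  let m : Prec := (false :: (n.1 ++ r.1), [])
  bif (a.add (x.add y.neg).neg).1.1 then predTest φ (x.add y.neg) m else
    bif ((x.add y).add a.neg).1.1 then predTest φ (x.add y) m else true

/-- Write `δ = 2^(-n)` and suppose `a` is to the left of `p = x - 3/2 * δ`. If `S` has a point `s`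
in the open `δ`-ball about `x`, the small closed ball about `p` lies in `S`: its points to the right
of `a` are in `[a, s]`, because they do not exceed `p + δ/2 = x - δ < s`, and its points to the left
of `a` are in the inner ball. If `S` misses the closed `2δ`-ball about `x`, it misses the small ball
inside it. The case of `a` beyond `x + 3/2 * δ` is symmetric. Otherwise `a` itself is within `2δ` of
`x`, and the answer `true` is always admissible. -/
theorem localTest_of_wmemRep {φ : Word → Word} {S : Set ℝ} (h : wmemRep φ S)
    (hS : S ∈ convexBodies) {a : Dy} {r : Prec}
    (ha : Metric.ball (a.val : ℝ) ((2 : ℝ) ^ (-r.val)) ⊆ S) :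
    LocalTest S (convexTest φ a r) := by
  intro x n
  set y : Dy := ((false, [true, true]), n.addNat 1) with hy
  -- Dropping the negative parts of `n` and `r` and adding one makes `m` at least `n + 1` and at
  -- least `r`: the small ball has radius at most `δ/2` and at most that of the inner ball.
  set m : Prec := (false :: (n.1 ++ r.1), []) with hm
  have hyv : (y.val : ℝ) = 3 / 2 * (2 : ℝ) ^ (-n.val) := by
    have v3 : Num.val (false, [true, true]) = 3 := rfl
    rw [hy, Dy.val, v3, Prec.val_addNat, Nat.cast_one, zpow_add_one₀ (by norm_num), zpow_neg]
    push_cast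
    field_simp
  have hp : (0 : ℝ) < 2 ^ (-n.val) := by positivity
  have hp' : (0 : ℝ) < 2 ^ (-r.val) := by positivity
  have m1 : (2 : ℝ) ^ (-m.val) ≤ 1 / 2 * 2 ^ (-n.val) := by
    have : (1 / 2 : ℝ) * 2 ^ (-n.val) = 2 ^ (-n.val + -1) := by
      rw [zpow_add₀ (by norm_num)]; norm_num; ring
    rw [this]
    refine zpow_le_zpow_right₀ (by norm_num) ?_
    simp [hm, Prec.val]
  have m2 : (2 : ℝ) ^ (-m.val) ≤ 2 ^ (-r.val) := by
    refine zpow_le_zpow_right₀ (by norm_num) ?_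
    simp [hm, Prec.val]; omega
  have e1 : (2 : ℝ) ^ (-n.val + 1) = 2 * 2 ^ (-n.val) := by
    rw [zpow_add_one₀ (by norm_num)]; ring
  have haS : (a.val : ℝ) ∈ S := ha (Metric.mem_ball_self hp')
  have hord := hS.2.ordConnected
  have s1 : (a.add (x.add y.neg).neg).1.1 = true ↔ (a.val : ℝ) < x.val - y.val := by
    rw [Dy.neg_iff, Dy.val_add, Dy.val_neg, Dy.val_add, Dy.val_neg]
    rw [← Rat.cast_lt (K := ℝ)]
    push_cast
    constructor <;> intro h <;> linarith
  have s2 : ((x.add y).add a.neg).1.1 = true ↔ (x.val : ℝ) + y.val < a.val := by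
    rw [Dy.neg_iff, Dy.val_add, Dy.val_neg, Dy.val_add]
    rw [← Rat.cast_lt (K := ℝ)]
    push_cast
    constructor <;> intro h <;> linarith
  have c1 : ((x.add y.neg).val : ℝ) = x.val - y.val := by
    rw [Dy.val_add, Dy.val_neg]; push_cast; ring
  have c2 : ((x.add y).val : ℝ) = x.val + y.val := by
    rw [Dy.val_add]; push_cast; ring
  have hball : ∀ z : ℝ, |z - a.val| < 2 ^ (-r.val) → z ∈ S := fun z hz =>
    ha (by rwa [Metric.mem_ball, Real.dist_eq])
  have hfar : ∀ z : ℝ, z ∈ S →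
      Metric.closedBall (x.val : ℝ) ((2 : ℝ) ^ (-n.val + 1)) ∩ S = ∅ →
      ¬ |z - x.val| ≤ 2 * 2 ^ (-n.val) := fun z hz he hc => by
    have : z ∈ Metric.closedBall (x.val : ℝ) ((2 : ℝ) ^ (-n.val + 1)) ∩ S :=
      ⟨by rwa [Metric.mem_closedBall, Real.dist_eq, e1], hz⟩
    rw [he] at this
    exact this
  have hT : convexTest φ a r x n = bif (a.add (x.add y.neg).neg).1.1 then
      predTest φ (x.add y.neg) m else
      bif ((x.add y).add a.neg).1.1 then predTest φ (x.add y) m else true := rfl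
  rw [hT]
  cases b1 : (a.add (x.add y.neg).neg).1.1 with
  | true =>
    rw [s1, hyv] at b1
    rw [cond_true]
    have hw := h.2 _ (x.add y.neg).val_mem m.val
    rw [c1, hyv] at hw
    constructor
    · rintro ⟨s, hs, hsS⟩
      rw [Metric.mem_ball, Real.dist_eq, abs_lt] at hs
      refine predTest_eq_true (hw.1 fun z hz => ?_)
      rw [Metric.mem_closedBall, Real.dist_eq, abs_le] at hz
      rcases le_total z (a.val : ℝ) with hza | hza
      · exact hball z (by rw [abs_lt]; constructor <;> linarith)
      · exact hord.out haS hsS ⟨hza, by linarith⟩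
    · intro he
      refine predTest_eq_false (hw.2 ?_)
      rw [Set.eq_empty_iff_forall_notMem]
      rintro z ⟨hz, hzS⟩
      rw [Metric.mem_closedBall, Real.dist_eq, abs_le] at hz
      exact hfar z hzS he (by rw [abs_le]; constructor <;> linarith)
  | false =>
    have b1' : ¬ (a.val : ℝ) < x.val - y.val := by rw [← s1, b1]; simp
    rw [cond_false]
    cases b2 : ((x.add y).add a.neg).1.1 with
    | true =>
      rw [s2, hyv] at b2
      rw [cond_true]
      have hw := h.2 _ (x.add y).val_mem m.val
      rw [c2, hyv] at hw
      constructor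
      · rintro ⟨s, hs, hsS⟩
        rw [Metric.mem_ball, Real.dist_eq, abs_lt] at hs
        refine predTest_eq_true (hw.1 fun z hz => ?_)
        rw [Metric.mem_closedBall, Real.dist_eq, abs_le] at hz
        rcases le_total (a.val : ℝ) z with hza | hza
        · exact hball z (by rw [abs_lt]; constructor <;> linarith)
        · exact hord.out hsS haS ⟨by linarith, hza⟩
      · intro he
        refine predTest_eq_false (hw.2 ?_)
        rw [Set.eq_empty_iff_forall_notMem]
        rintro z ⟨hz, hzS⟩
        rw [Metric.mem_closedBall, Real.dist_eq, abs_le] at hz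
        exact hfar z hzS he (by rw [abs_le]; constructor <;> linarith)
    | false =>
      have b2' : ¬ (x.val : ℝ) + y.val < a.val := by rw [← s2, b2]; simp
      rw [hyv] at b1' b2'
      refine ⟨fun _ => rfl, fun he => ?_⟩
      exact absurd (by rw [abs_le]; constructor <;> linarith) (hfar _ haS he)

/-! ## The reductions -/

theorem relDistRep_of_distRep {φ : Word → Word} {S : Set ℝ} (h : distRep φ S) :
    relDistRep φ S := by
  intro q hq n
  obtain ⟨v, hv, h1, h2⟩ := h q hq n
  have := Metric.infDist_nonneg (x := (q : ℝ)) (s := S)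
  rw [abs_le] at h2
  exact ⟨v, hv, h1, by linarith, by linarith⟩

theorem setRep_isPredicate (φ : Word → Word) (S : Set ℝ) (h : setRep φ S) : IsPredicate φ := h.1

theorem wmemRep_isPredicate (φ : Word → Word) (S : Set ℝ) (h : wmemRep φ S) : IsPredicate φ := h.1

theorem polyReduces_relDist_dist : PolyReduces compactSets (enrich relDistRep outerRadius)
    (enrich distRep outerRadius) :=
  (FP.pairFuns (FP.distFn FP.relTest FP.relAdv) FP.relAdv).polyReduces_enrich
    fun (i : RelName) => ⟨i.adv, i.adv_mem, _, distRep_distFn (localTest_of_relDistRep i.name i.mem)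
      i.mem (subset_closedBall_of_outerRadius i.adv_mem), rfl⟩

/-- Distance names are relative distance names, so no separate copying machine is needed: the
reduction in the other direction is weakened on both sides. -/
theorem polyReduces_dist_relDist : PolyReduces compactSets (enrich distRep outerRadius)
    (enrich relDistRep outerRadius) :=
  (polyReduces_relDist_dist.mono_right fun _ _ => relDistRep_of_distRep).mono_left
    fun _ _ => relDistRep_of_distRep

theorem polyReduces_relDist_set : PolyReduces compactSets (enrich relDistRep outerRadius)
    (enrich setRep outerRadius) :=
  (FP.pairFuns (FP.testFn FP.relTest) FP.relAdv).polyReduces_enrich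
    fun (i : RelName) => ⟨i.adv, i.adv_mem, _, (localTest_of_relDistRep i.name i.mem).setRep, rfl⟩

theorem polyReduces_set_dist : PolyReduces compactSets (enrich setRep outerRadius)
    (enrich distRep outerRadius) :=
  (FP.pairFuns (FP.distFn (FP.predTest setRep_isPredicate) (FP.adv_predicate setRep_isPredicate))
    (FP.adv_predicate setRep_isPredicate)).polyReduces_enrich
    fun i => ⟨i.adv, i.adv_mem, _, distRep_distFn (localTest_of_setRep i.name)
      i.mem (subset_closedBall_of_outerRadius i.adv_mem), rfl⟩

theorem polyReduces_set_grid : PolyReduces compactSets (enrich setRep outerRadius) gridRep := by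
  refine (FP.gridFn (FP.predTest setRep_isPredicate) (FP.adv_predicate setRep_isPredicate)).polyReduces_enrich
    fun i => ⟨i.adv, gridRep_gridFn (localTest_of_setRep i.name) ?_⟩
  obtain ⟨b, hb, he⟩ := i.adv_mem
  rw [he, ofUnaryInt_unaryInt]
  exact hb

theorem polyReduces_grid_set : PolyReduces compactSets gridRep (enrich setRep outerRadius) := by
  refine (FP.pairFuns (FP.testFn FP.gridTest) FP.gridAdv).polyReduces_grid
    fun (i : GridName compactSets) => ⟨_, ?_, _, (localTest_of_gridRep i.name).setRep, rfl⟩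
  refine ⟨ofUnaryInt (i.fn []), i.name.2.2.1, ?_⟩
  rw [unaryInt, ofUnaryInt, Equiv.apply_symm_apply]

/-- The same point is queried at precision `n + 1`. If the closed ball lies in `S`, its center
belongs to `S` and the open ball meets `S`; the negative condition is at radius `2^(-(n+1)+1) =
2^(-n)`, exactly as required. -/
theorem polyReduces_set_wmem : PolyReduces regularSets (plain setRep) (plain wmemRep) := by
  have hq : FP (plainFamily regularSets setRep) (fun (i : PlainName regularSets setRep) s =>
      i.fn (queryWord (pointOf s) ((precOf s).addNat 1))) :=
    FP.oracle (F := plainFamily regularSets setRep)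
      (.queryWord (.pointOf .id) (.addNat (.precOf .id) 1)) 1 fun i s => by
        have := (PlainName.name i).1.length (queryWord (pointOf s) ((precOf s).addNat 1))
        simpa [plainFamily] using this.le
  refine hq.polyReduces_plain fun i => ⟨[], rfl, fun s => i.name.1 _, fun q hq n => ?_⟩
  beta_reduce
  rw [queryWord_eq, val_pointOf hq, Prec.val_addNat, val_precOf, Nat.cast_one]
  have := i.name.2 q hq (n + 1)
  rw [show -(n + 1) + 1 = -n by ring] at this
  refine ⟨fun h => this.1 ⟨q, Metric.mem_ball_self (by positivity), h ?_⟩, this.2⟩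
  exact Metric.mem_closedBall_self (by positivity)

/-- Names in the weak membership representation of convex bodies with inner balls. -/
abbrev BodyName : Type := EnrichedName convexBodies wmemRep innerBall

theorem FP.convexTest : FP (enrichFamily convexBodies wmemRep innerBall)
    (fun (i : BodyName) (z : Dy × Prec) =>
      SetReps.convexTest i.fn (SetReps.pointOf i.adv) (SetReps.precOf i.adv) z.1 z.2) := by
  have ha : FP (enrichFamily convexBodies wmemRep innerBall)
      (fun (i : BodyName) (_ : Dy × Prec) => i.adv) := FP.adv_predicate wmemRep_isPredicate
  have hx : FP (enrichFamily convexBodies wmemRep innerBall)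
      (fun (_ : BodyName) (z : Dy × Prec) => z.1) := FP.id.fst
  have hn : FP (enrichFamily convexBodies wmemRep innerBall)
      (fun (_ : BodyName) (z : Dy × Prec) => z.2) := FP.id.snd
  have hy : FP (enrichFamily convexBodies wmemRep innerBall)
      (fun (_ : BodyName) (z : Dy × Prec) =>
        ((((false, [true, true]) : Num), z.2.addNat 1) : Dy)) := (FP.const _).pair (hn.addNat 1)
  have hm : FP (enrichFamily convexBodies wmemRep innerBall)
      (fun (i : BodyName) (z : Dy × Prec) =>
        ((false :: (z.2.1 ++ (SetReps.precOf i.adv).1), []) : Prec)) :=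
    (FP.cons (.const false) (hn.fst.append (FP.precOf ha).fst)).pair (.const ([] : Word))
  have h1 := hx.dyAdd hy.dyNeg
  have h2 := hx.dyAdd hy
  have t1 := (FP.predTest wmemRep_isPredicate).comp' (h1.pair hm)
  have t2 := (FP.predTest wmemRep_isPredicate).comp' (h2.pair hm)
  have d1 := ((FP.pointOf ha).dyAdd h1.dyNeg).fst.fst
  have d2 := (h2.dyAdd (FP.pointOf ha).dyNeg).fst.fst
  exact d1.cond t1 (d2.cond t2 (.const true))

theorem polyReduces_wmem_set :
    PolyReduces convexBodies (enrich wmemRep innerBall) (plain setRep) := by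
  refine (FP.testFn FP.convexTest).polyReduces_enrich fun (i : BodyName) => ⟨[], rfl, ?_⟩
  refine (localTest_of_wmemRep i.name i.mem ?_).setRep
  obtain ⟨a, had, r, hr, he⟩ := i.adv_mem
  have hq : i.adv = query a r := he
  rw [hq, val_pointOf had, val_precOf]
  exact hr

end SetReps

theorem mainTheorem6 :
    (SetReps.PolyEquiv SetReps.compactSets
        (SetReps.enrich SetReps.distRep SetReps.outerRadius)
        (SetReps.enrich SetReps.relDistRep SetReps.outerRadius) ∧
      SetReps.PolyEquiv SetReps.compactSets
        (SetReps.enrich SetReps.relDistRep SetReps.outerRadius)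
        (SetReps.enrich SetReps.setRep SetReps.outerRadius) ∧
      SetReps.PolyEquiv SetReps.compactSets
        (SetReps.enrich SetReps.setRep SetReps.outerRadius)
        SetReps.gridRep) ∧
    SetReps.PolyReduces SetReps.regularSets
      (SetReps.plain SetReps.setRep) (SetReps.plain SetReps.wmemRep) ∧
    SetReps.PolyReduces SetReps.convexBodies
      (SetReps.enrich SetReps.wmemRep SetReps.innerBall) (SetReps.plain SetReps.setRep) := by
  open SetReps in
  exact ⟨⟨⟨polyReduces_dist_relDist, polyReduces_relDist_dist⟩,
    ⟨polyReduces_relDist_set, polyReduces_set_dist.mono_right fun _ _ => relDistRep_of_distRep⟩,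
    polyReduces_set_grid, polyReduces_grid_set⟩, polyReduces_set_wmem, polyReduces_wmem_set⟩
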